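/- **Setting.** Let $\mathcal H$ be a holomorphic vector bundle of finite rank on the punctured unit disc $\Delta^*$ with an integrable connection $\nabla$ and a flat real structure (a complex conjugation on the fibers $\mathcal H_q$ preserving horizontality of local sections). Let $\varphi(z)=e^{2\pi i z}$, $\varphi:\mathfrak H\to\Delta^*$, where $\mathfrak H$ is the upper half plane, and let $H$ be the space of multivalued horizontal sections of $\mathcal H$ (horizontal sections of $\varphi^*\mathcal H$), with the induced conjugation; evaluation at any $z$ over $q$ identifies $H$ with $\mathcal H_q$. Let $(Ts)(z)=s(z+1)$ be the monodromy, assumed unipotent, and $N=-\log T$. The canonical extension is $\tilde{\mathcal H}=H\otimes\mathcal O_\Delta$, identified with $\mathcal H$ over $\Delta^*$ by $h\mapsto (e^{zN}h)(z)$ at $q=\varphi(z)$. Let $\mathcal F^\bullet$ be a decreasing filtration of $\mathcal H$ (indexed by $\mathbb Z$) by holomorphic subbundles such that the corresponding subbundles of $\tilde{\mathcal H}|_{\Delta^*}$ extend to holomorphic subbundles $\tilde{\mathcal F}^\bullet$ of $\tilde{\mathcal H}$ over $\Delta$; put $F^\bullet=\tilde{\mathcal F}^\bullet_0$, a filtration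 of $H=\tilde{\mathcal H}_0$. Let $d\ge 0$ be an integer and let $W=W(N,d)$ be the monodromy weight filtration of $N$ centered at $d$: the finite increasing filtration with $NW_i\subset W_{i-2}$ and $N^l:\mathrm{Gr}^W_{d+l}H\cong\mathrm{Gr}^W_{d-l}H$ for all $l\ge0$. (A) Assume that $(H,W,F)$ is a mixed Hodge structure defined over $\mathbb R$ (in particular $F$ is finite) and that $N$ is a morphism of mixed Hodge structures of type $(-1,-1)$; thus $NF^p\subset F^{p-1}$. **Invariants.** Let $S$ be a nondegenerate bilinear form on $H$, defined over $\mathbb R$, with $S(v,u)=(-1)^dS(u,v)$ and $S(u,Nv)+S(Nu,v)=0$. It induces a bilinear form, still denoted $S$, on every $\mathcal H_q$. Assume $S(\mathcal F_q^p,\mathcal F_q^{d-p+1})=0$ for all $p$ and all $q\in\Delta^*$. For $l\ge 0$ let $P_{d+l}=\ker(N^{l+1}:\mathrm{Gr}^W_{d+l}H\to\mathrm{Gr}^W_{d-l-2}H)$, and for $a+b=d+l$ let $(s_+^{a,b},s_-^{a,b})$ be the signature of the Hermitian form $S(C\,\cdot,N^l\,\overline{\cdot})$ on the $(a,b)$-component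 of $P_{d+l}$, where the Weil operator $C$ is multiplication by $i^{a-b}$ on type $(a,b)$. For integers $p,k$ and $l=p+k-d$, put $$\mathbf S_\pm^{p,k}=\sum_{r\ge\max(-l,0)}s_\pm^{p+r,k+r}.$$ **Theorem.** 1. Under (A), for all $q\in\Delta^*$ with $|q|$ sufficiently small, $\mathcal F_q^\bullet$ is $d$-opposed to its complex conjugate, that is, $\mathcal F_q^p\oplus\overline{\mathcal F_q^{d-p+1}}=\mathcal H_q$ for all $p$; so $\mathcal F_q^\bullet$ is a (real) Hodge structure of weight $d$ on $\mathcal H_q$. 2. Assume moreover that $S$ is given as above. Then for all $q\in\Delta^*$ with $|q|$ sufficiently small and all $p$, the signature of $S(C\,\cdot,\overline{\cdot})$ on the $(p,d-p)$-component $\mathcal F_q^p\cap\overline{\mathcal F_q^{d-p}}$ of $\mathcal H_q$ is $$\Bigl(\sum_{k\in\mathbb Z}\mathbf S_+^{p,k},\ \sum_{k\in\mathbb Z}\mathbf S_-^{p,k}\Bigr).$$ If $\mathcal F^0=\mathcal H$ and $\mathcal F^{d+1}=0$, this equals $$\Bigl(\sum_{k=0}^d\mathbf S_+^{p,k},\ \sum_{k=0}^d\mathbf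 S_-^{p,k}\Bigr)=\Bigl(\sum_{l\ge p-d,\ r\ge\max(-l,0)}s_+^{p+r,d+l-p+r},\ \sum_{l\ge p-d,\ r\ge\max(-l,0)}s_-^{p+r,d+l-p+r}\Bigr).$$ In particular, if $(H,W,F)$ is a mixed Hodge structure polarized by $N$ and $S$, centered at $d$, or if only $s_-^{p,d+l-p}=0$ for all $p$ and all $l\ge0$, then for $|q|$ sufficiently small $\mathcal F_q^\bullet$ is a Hodge structure of weight $d$ on $\mathcal H_q$ polarized by $S$. Here $(H,W,F)$ is polarized by $N$ and $S$, centered at $d$, if in addition to the above $N^{d+1}=0$, $S(F^p,F^{d-p+1})=0$ for all $p$, and for all $l\ge 0$ the Hodge structure of weight $d+l$ on $P_{d+l}$ is polarized by $S(\cdot,N^l\,\cdot)$. -/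

import Mathlib

open Bundle Filter
open scoped Manifold ContDiff Topology

namespace DegenerationHodge

noncomputable section

/-! ### Linear algebra: nilpotent operators, weight filtrations, mixed Hodge structures -/

section LinearAlgebra

variable {X : Type*} [AddCommGroup X] [Module ℂ X]

/-- The logarithm `∑_{k ≥ 1} (-1)^(k-1) (T - 1)^k / k` of a unipotent endomorphism `T`. -/
def unipLog (T : Module.End ℂ X) : Module.End ℂ X :=
  ∑ k ∈ Finset.range (nilpotencyClass (T - 1)),
    ((-1 : ℂ) ^ k / ((k : ℂ) + 1)) • (T - 1) ^ (k + 1)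

/-- The exponential `∑_k A^k / k!` of a nilpotent endomorphism `A`. -/
def nilExp (A : Module.End ℂ X) : Module.End ℂ X :=
  ∑ k ∈ Finset.range (nilpotencyClass A), ((k.factorial : ℂ)⁻¹) • A ^ k

/-- The complex conjugate of a subspace. -/
def conjSub (c : X →ₛₗ[starRingEnd ℂ] X) (A : Submodule ℂ X) : Submodule ℂ X :=
  A.map c

/-- `Gr^W_k = W_k / W_{k-1}`. -/
abbrev Gr (W : ℤ → Submodule ℂ X) (k : ℤ) : Type _ :=
  ↥(W k) ⧸ (W (k - 1)).submoduleOf (W k)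

/-- The subspace of `Gr^W_k` induced by a subspace `A`, i.e. the image of `A ∩ W_k`. -/
def grInd (W : ℤ → Submodule ℂ X) (k : ℤ) (A : Submodule ℂ X) : Submodule ℂ (Gr W k) :=
  (A.submoduleOf (W k)).map ((W (k - 1)).submoduleOf (W k)).mkQ

theorem pow_shift {N : Module.End ℂ X} {W : ℤ → Submodule ℂ X}
    (hN : ∀ i, ∀ x ∈ W i, N x ∈ W (i - 2)) (m : ℕ) :
    ∀ i, ∀ x ∈ W i, (N ^ m) x ∈ W (i - 2 * m) := by
  induction m with
  | zero => intro i x hx; simpa using hx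
  | succ m ih =>
    intro i x hx
    have h := hN _ _ (ih i x hx)
    rw [pow_succ', Module.End.mul_apply]
    have e : i - 2 * ((m + 1 : ℕ) : ℤ) = i - 2 * (m : ℤ) - 2 := by push_cast; ring
    rw [e]
    exact h

/-- The map `Gr^W_k → Gr^W_{k-2m}` induced by `N^m`, when `N W_i ⊆ W_{i-2}` for all `i`. -/
def grPow (N : Module.End ℂ X) (W : ℤ → Submodule ℂ X)
    (hN : ∀ i, ∀ x ∈ W i, N x ∈ W (i - 2)) (m : ℕ) (k : ℤ) :
    Gr W k →ₗ[ℂ] Gr W (k - 2 * m) :=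
  Submodule.mapQ _ _ ((N ^ m).restrict (pow_shift hN m k)) (by
    intro x hx
    have h := pow_shift hN m (k - 1) x.1 hx
    have e : k - 1 - 2 * (m : ℤ) = k - 2 * (m : ℤ) - 1 := by ring
    rw [e] at h
    exact h)

/-- `W` is the monodromy weight filtration `W(N, d)` of `N` centered at `d`. -/
structure IsMonodromyWeight (N : Module.End ℂ X) (d : ℕ) (W : ℤ → Submodule ℂ X) : Prop where
  mono : Monotone W
  bot : ∃ k, W k = ⊥
  top : ∃ k, W k = ⊤
  shift : ∀ i, ∀ x ∈ W i, N x ∈ W (i - 2)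
  iso : ∀ l : ℕ, Function.Bijective (grPow N W shift l (d + l))

/-- `F` is a finite decreasing filtration that is `d`-opposed to its complex conjugate, i.e. a
pure (real) Hodge structure of weight `d`. -/
structure IsPureHodge (c : X →ₛₗ[starRingEnd ℂ] X) (F : ℤ → Submodule ℂ X) (d : ℤ) :
    Prop where
  anti : Antitone F
  top : ∃ p, F p = ⊤
  bot : ∃ p, F p = ⊥
  opposed : ∀ p, IsCompl (F p) (conjSub c (F (d - p + 1)))

/-- `(X, W, F)` is a mixed Hodge structure, defined over `ℝ` with respect to the conjugation `c`:
for every `k` the filtration induced by `F` on `Gr^W_k` is `k`-opposed to its conjugate (which,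
as `W` is real, is the filtration induced by the conjugate of `F`). -/
structure IsMixedHodge (c : X →ₛₗ[starRingEnd ℂ] X) (W F : ℤ → Submodule ℂ X) : Prop where
  weight_mono : Monotone W
  weight_bot : ∃ k, W k = ⊥
  weight_top : ∃ k, W k = ⊤
  weight_real : ∀ k, conjSub c (W k) = W k
  hodge_anti : Antitone F
  hodge_top : ∃ p, F p = ⊤
  hodge_bot : ∃ p, F p = ⊥
  opposed : ∀ k p, IsCompl (grInd W k (F p)) (grInd W k (conjSub c (F (k - p + 1))))

/-- `(X, W, F)` is a real mixed Hodge structure, `N` is a morphism of real mixed Hodge structures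
of type `(-1, -1)`, and `W = W(N, d)`. -/
structure IsLimitMHS (c : X →ₛₗ[starRingEnd ℂ] X) (N : Module.End ℂ X) (d : ℕ)
    (W F : ℤ → Submodule ℂ X) : Prop where
  mixed : IsMixedHodge c W F
  weight : IsMonodromyWeight N d W
  real : ∀ x, N (c x) = c (N x)
  hodge : ∀ p, ∀ x ∈ F p, N x ∈ F (p - 1)

/-- `S` is a nondegenerate `(-1)^d`-symmetric bilinear form, defined over `ℝ`, for which `N` is an
infinitesimal isometry. -/
structure IsCompatibleForm (c : X →ₛₗ[starRingEnd ℂ] X) (N : Module.End ℂ X) (d : ℕ)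
    (S : LinearMap.BilinForm ℂ X) : Prop where
  nondegenerate : S.Nondegenerate
  real : ∀ u v, S (c u) (c v) = starRingEnd ℂ (S u v)
  symm : ∀ u v, S v u = (-1) ^ d * S u v
  isometry : ∀ u v, S u (N v) + S (N u) v = 0

/-- The Hermitian form `S(C u, conj v)` on vectors `u`, `v` of Hodge type `(p, q)`; there the Weil
operator `C` is multiplication by `i^(p-q)`. -/
def weilForm (c : X →ₛₗ[starRingEnd ℂ] X) (S : LinearMap.BilinForm ℂ X) (p q : ℤ) (u v : X) : ℂ :=
  Complex.I ^ (p - q) * S u (c v)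

/-- The `(p, d-p)`-component of the Hodge structure `F` of weight `d`. -/
def hodgeComp (c : X →ₛₗ[starRingEnd ℂ] X) (F : ℤ → Submodule ℂ X) (d p : ℤ) : Submodule ℂ X :=
  F p ⊓ conjSub c (F (d - p))

/-- Positive index of inertia of the Hermitian form `h` on `K`: the largest dimension of a subspace
of `K` on which `h` is positive definite. -/
def posIndex (h : X → X → ℂ) (K : Submodule ℂ X) : ℕ :=
  sSup {n | ∃ L ≤ K, Module.finrank ℂ L = n ∧ ∀ x ∈ L, x ≠ 0 → 0 < (h x x).re}

/-- Negative index of inertia of the Hermitian form `h` on `K`. -/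
def negIndex (h : X → X → ℂ) (K : Submodule ℂ X) : ℕ :=
  posIndex (fun x y => -h x y) K

/-- The Hodge structure `F` of weight `d` is polarized by `S`. -/
structure IsPolarizedHodge (c : X →ₛₗ[starRingEnd ℂ] X) (F : ℤ → Submodule ℂ X) (d : ℕ)
    (S : LinearMap.BilinForm ℂ X) : Prop where
  pure : IsPureHodge c F d
  nondegenerate : S.Nondegenerate
  real : ∀ u v, S (c u) (c v) = starRingEnd ℂ (S u v)
  symm : ∀ u v, S v u = (-1) ^ d * S u v
  isotropic : ∀ p, ∀ u ∈ F p, ∀ v ∈ F (d - p + 1), S u v = 0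
  pos : ∀ p, ∀ u ∈ hodgeComp c F d p, u ≠ 0 → 0 < (weilForm c S p (d - p) u u).re

section Primitive

variable {N : Module.End ℂ X} {d : ℕ} {W : ℤ → Submodule ℂ X}

/-- For `w = d + l` with `l ≥ 0`, the primitive part
`P_{d+l} = ker (N^{l+1} : Gr^W_{d+l} → Gr^W_{d-l-2})`. -/
def primitive (hW : IsMonodromyWeight N d W) (w : ℤ) : Submodule ℂ (Gr W w) :=
  LinearMap.ker (grPow N W hW.shift ((w - d).toNat + 1) w)

/-- The `(p, q)`-component of the Hodge structure of weight `p + q` on `P_{p+q}`. -/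
def primComp (c : X →ₛₗ[starRingEnd ℂ] X) (hW : IsMonodromyWeight N d W)
    (F : ℤ → Submodule ℂ X) (p q : ℤ) : Submodule ℂ (Gr W (p + q)) :=
  primitive hW (p + q) ⊓ (grInd W (p + q) (F p) ⊓ grInd W (p + q) (conjSub c (F q)))

/-- A representative in `W_k` of a class in `Gr^W_k`. -/
def grLift (W : ℤ → Submodule ℂ X) (k : ℤ) (x : Gr W k) : X :=
  ((Function.surjInv ((W (k - 1)).submoduleOf (W k)).mkQ_surjective x : ↥(W k)) : X)

/-- For `w = d + l` with `l ≥ 0`, the pairing `S(x, N^l y)` on `Gr^W_w`, computed on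
representatives. (For `W = W(N, d)` and `N` an infinitesimal isometry of `S`, one has
`S(W_a, W_b) = 0` for `a + b < 2d`, so that the choice of representatives is irrelevant.) -/
def grPairing (N : Module.End ℂ X) (d : ℕ) (W : ℤ → Submodule ℂ X)
    (S : LinearMap.BilinForm ℂ X) (w : ℤ) (x y : Gr W w) : ℂ :=
  S (grLift W w x) ((N ^ (w - d).toNat) (grLift W w y))

/-- For `p + q = d + l` with `l ≥ 0`, the Hermitian form `S(C x, N^l conj y)` on classes `x`, `y` of
type `(p, q)` in `Gr^W_{p+q}`, computed on representatives as in `grPairing`. -/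
def grForm (c : X →ₛₗ[starRingEnd ℂ] X) (N : Module.End ℂ X) (d : ℕ) (W : ℤ → Submodule ℂ X)
    (S : LinearMap.BilinForm ℂ X) (p q : ℤ) (x y : Gr W (p + q)) : ℂ :=
  Complex.I ^ (p - q) *
    S (grLift W (p + q) x) ((N ^ (p + q - d).toNat) (c (grLift W (p + q) y)))

/-- For `p + q = d + l` with `l ≥ 0`, the number `s_+^{p,q}`: the positive index of
`S(C x, N^l conj y)` on the `(p, q)`-component of `P_{p+q}`. -/
def sPlus (c : X →ₛₗ[starRingEnd ℂ] X) (hW : IsMonodromyWeight N d W)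
    (F : ℤ → Submodule ℂ X) (S : LinearMap.BilinForm ℂ X) (p q : ℤ) : ℕ :=
  posIndex (grForm c N d W S p q) (primComp c hW F p q)

/-- For `p + q = d + l` with `l ≥ 0`, the number `s_-^{p,q}`. -/
def sMinus (c : X →ₛₗ[starRingEnd ℂ] X) (hW : IsMonodromyWeight N d W)
    (F : ℤ → Submodule ℂ X) (S : LinearMap.BilinForm ℂ X) (p q : ℤ) : ℕ :=
  negIndex (grForm c N d W S p q) (primComp c hW F p q)

/-- `S^{p,k} = ∑_{r ≥ max(-l, 0)} s^{p+r,k+r}` where `l = p + k - d`. Only terms with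
`(p + r) + (k + r) ≥ d` occur, and only finitely many of them are nonzero. -/
def bigS (s : ℤ → ℤ → ℕ) (d : ℕ) (p k : ℤ) : ℕ :=
  ∑ᶠ (r : ℕ) (_ : max (-(p + k - d)) 0 ≤ (r : ℤ)), s (p + r) (k + r)

/-- `∑ s^{p+r,d+l-p+r}` over the integers `l ≥ p - d` and `r ≥ max(-l, 0)`; only finitely many terms
are nonzero. -/
def doubleSum (s : ℤ → ℤ → ℕ) (d : ℕ) (p : ℤ) : ℕ :=
  ∑ᶠ (x : ℤ × ℕ) (_ : p - d ≤ x.1 ∧ max (-x.1) 0 ≤ (x.2 : ℤ)), s (p + x.2) (d + x.1 - p + x.2)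

/-- The mixed Hodge structure `(X, W, F)` is polarized by `N` and `S`, centered at `d`. The last two
fields are the Hodge-Riemann relations for `S(x, N^l y)` on the primitive part `P_{d+l}`, `l ≥ 0`;
that this form is real and `(-1)^(d+l)`-symmetric is contained in `form`. -/
structure IsPolarizedMHS (c : X →ₛₗ[starRingEnd ℂ] X) (hW : IsMonodromyWeight N d W)
    (F : ℤ → Submodule ℂ X) (S : LinearMap.BilinForm ℂ X) : Prop where
  limit : IsLimitMHS c N d W F
  form : IsCompatibleForm c N d S
  pow_eq_zero : N ^ (d + 1) = 0
  isotropic : ∀ p, ∀ u ∈ F p, ∀ v ∈ F (d - p + 1), S u v = 0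
  prim_isotropic : ∀ w : ℤ, d ≤ w → ∀ p,
    ∀ x ∈ primitive hW w ⊓ grInd W w (F p), ∀ y ∈ primitive hW w ⊓ grInd W w (F (w - p + 1)),
      grPairing N d W S w x y = 0
  prim_pos : ∀ p q : ℤ, d ≤ p + q → ∀ x ∈ primComp c hW F p q, x ≠ 0 →
    0 < (grForm c N d W S p q x x).re

end Primitive

end LinearAlgebra

/-! ### The punctured disc and flat bundles on it -/

/-- The punctured unit disc `Δ*`. -/
def puncturedDisc : TopologicalSpace.Opens ℂ :=
  ⟨{q | 0 < ‖q‖ ∧ ‖q‖ < 1},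
    (isOpen_lt continuous_const continuous_norm).inter (isOpen_lt continuous_norm continuous_const)⟩

/-- The uniformization `z ↦ exp(2πiz)` of `Δ*` by the upper half plane. -/
def unif (z : UpperHalfPlane) : puncturedDisc :=
  ⟨Complex.exp (2 * Real.pi * Complex.I * z),
    norm_pos_iff.mpr (Complex.exp_ne_zero _), UpperHalfPlane.norm_exp_two_pi_I_lt_one z⟩

theorem unif_add_one (z : UpperHalfPlane) : unif ((1 : ℝ) +ᵥ z) = unif z := by
  apply Subtype.ext
  change Complex.exp _ = Complex.exp _
  rw [UpperHalfPlane.coe_vadd, mul_add, Complex.exp_add]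
  simp [Complex.exp_two_pi_mul_I]

section Bundle

variable (V : Type*) [NormedAddCommGroup V] [NormedSpace ℂ V]
  (E : puncturedDisc → Type*)
  [∀ q, AddCommGroup (E q)] [∀ q, Module ℂ (E q)] [∀ q, TopologicalSpace (E q)]
  [∀ q, IsTopologicalAddGroup (E q)] [∀ q, ContinuousSMul ℂ (E q)]
  [TopologicalSpace (TotalSpace V E)] [FiberBundle V E] [VectorBundle ℂ V E]

variable {E} in
/-- The section `σ` is holomorphic on `U`. -/
def HolOn (σ : ∀ q, E q) (U : Set puncturedDisc) : Prop :=
  ContMDiffOn 𝓘(ℂ, ℂ) (𝓘(ℂ, ℂ).prod 𝓘(ℂ, V)) ω (fun q => TotalSpace.mk' V q (σ q)) U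

variable {V E} in
/-- The section `σ` is holomorphic on `U`, and horizontal there for the connection `D`. -/
def IsHorizontalOn (D : CovariantDerivative 𝓘(ℂ, ℂ) V E) (σ : ∀ q, E q)
    (U : Set puncturedDisc) : Prop :=
  HolOn V σ U ∧ ∀ q ∈ U, D σ q = 0

/-- A holomorphic connection on a holomorphic vector bundle on `Δ*` (integrable, since `Δ*` has
complex dimension one), with a flat real structure: a complex conjugation on each fiber that takes
horizontal local sections to horizontal local sections. -/
structure RealFlatConnection where
  /-- the connection -/
  conn : CovariantDerivative 𝓘(ℂ, ℂ) V E
  holomorphic : ∀ U : Set puncturedDisc, IsOpen U → ContMDiffCovariantDerivativeOn V ω conn.toFun U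
  /-- the complex conjugation on the fibers -/
  conj : ∀ q, E q →ₛₗ[starRingEnd ℂ] E q
  conj_conj : ∀ q u, conj q (conj q u) = u
  conj_flat : ∀ (U : Set puncturedDisc) (σ : ∀ q, E q), IsOpen U → IsHorizontalOn conn σ U →
    IsHorizontalOn conn (fun q => conj q (σ q)) U

variable {E} in
/-- The subspaces `F q` of `E q` form a holomorphic subbundle: locally they have a
holomorphic frame. -/
def IsHolSubbundle (F : ∀ q, Submodule ℂ (E q)) : Prop :=
  ∀ q₀, ∃ U : Set puncturedDisc, IsOpen U ∧ q₀ ∈ U ∧ ∃ (n : ℕ) (σ : Fin n → ∀ q, E q),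
    (∀ i, HolOn V (σ i) U) ∧
    ∀ q ∈ U, LinearIndependent ℂ (fun i => σ i q) ∧
      Submodule.span ℂ (Set.range fun i => σ i q) = F q

/-- A holomorphic subbundle of the trivial bundle with (finite-dimensional) fiber `X` over the unit
disc; a map to `X` is holomorphic if its composite with every linear functional is. -/
def IsHolSubbundleOfTrivial {X : Type*} [AddCommGroup X] [Module ℂ X]
    (F : ℂ → Submodule ℂ X) : Prop :=
  ∀ q₀ ∈ Metric.ball (0 : ℂ) 1, ∃ U ⊆ Metric.ball (0 : ℂ) 1, IsOpen U ∧ q₀ ∈ U ∧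
    ∃ (n : ℕ) (f : Fin n → ℂ → X),
      (∀ i, ∀ ℓ : Module.Dual ℂ X, DifferentiableOn ℂ (fun q => ℓ (f i q)) U) ∧
      ∀ q ∈ U, LinearIndependent ℂ (fun i => f i q) ∧
        Submodule.span ℂ (Set.range fun i => f i q) = F q

variable {V E}

/-- Multivalued sections: a value in `E q` for every `q` and every `z` over `q`. -/
abbrev MultiSection (E : puncturedDisc → Type*) : Type _ :=
  ∀ q, {z : UpperHalfPlane // unif z = q} → E q

set_option linter.unusedSectionVars false in
theorem IsHorizontalOn.mdiff {D : CovariantDerivative 𝓘(ℂ, ℂ) V E} {σ : ∀ q, E q}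
    {U : Set puncturedDisc} (h : IsHorizontalOn D σ U) (hU : IsOpen U) {q : puncturedDisc}
    (hq : q ∈ U) :
    MDifferentiableAt 𝓘(ℂ, ℂ) (𝓘(ℂ, ℂ).prod 𝓘(ℂ, V)) (fun q => TotalSpace.mk' V q (σ q)) q :=
  ((h.1 q hq).contMDiffAt (hU.mem_nhds hq)).mdifferentiableAt (by simp)

set_option linter.unusedSectionVars false in
theorem IsHorizontalOn.mono {D : CovariantDerivative 𝓘(ℂ, ℂ) V E} {σ : ∀ q, E q}
    {U U' : Set puncturedDisc} (h : IsHorizontalOn D σ U) (hU : U' ⊆ U) :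
    IsHorizontalOn D σ U' :=
  ⟨h.1.mono hU, fun q hq => h.2 q (hU hq)⟩

theorem IsHorizontalOn.add {D : CovariantDerivative 𝓘(ℂ, ℂ) V E} {σ τ : ∀ q, E q}
    {U : Set puncturedDisc} (hU : IsOpen U) (h : IsHorizontalOn D σ U)
    (h' : IsHorizontalOn D τ U) : IsHorizontalOn D (σ + τ) U := by
  refine ⟨ContMDiffOn.add_section h.1 h'.1, fun q hq => ?_⟩
  have := (D.isCovariantDerivativeOnUniv).add (h.mdiff hU hq) (h'.mdiff hU hq)
  rw [this, h.2 q hq, h'.2 q hq, add_zero]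

theorem IsHorizontalOn.smul {D : CovariantDerivative 𝓘(ℂ, ℂ) V E} {σ : ∀ q, E q}
    {U : Set puncturedDisc} (hU : IsOpen U) (a : ℂ) (h : IsHorizontalOn D σ U) :
    IsHorizontalOn D (a • σ) U := by
  refine ⟨ContMDiffOn.const_smul_section h.1, fun q hq => ?_⟩
  have := (D.isCovariantDerivativeOnUniv).smul_const a (h.mdiff hU hq)
  rw [this, h.2 q hq, smul_zero]

/-- `H`: the space of multivalued horizontal sections. -/
def horizontalSections (D : RealFlatConnection V E) : Submodule ℂ (MultiSection E) where
  carrier := {s | ∀ z : UpperHalfPlane, ∃ U : Set puncturedDisc, IsOpen U ∧ unif z ∈ U ∧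
    ∃ σ : ∀ q, E q, IsHorizontalOn D.conn σ U ∧ ∀ᶠ w in 𝓝 z, s (unif w) ⟨w, rfl⟩ = σ (unif w)}
  add_mem' := by
    intro s t hs ht z
    obtain ⟨U, hU, hz, σ, hσ, hs⟩ := hs z
    obtain ⟨U', hU', hz', τ, hτ, ht⟩ := ht z
    refine ⟨U ∩ U', hU.inter hU', ⟨hz, hz'⟩, σ + τ,
      .add (hU.inter hU') (hσ.mono Set.inter_subset_left) (hτ.mono Set.inter_subset_right), ?_⟩
    filter_upwards [hs, ht] with w h1 h2
    simp [h1, h2]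
  zero_mem' := by
    intro z
    refine ⟨Set.univ, isOpen_univ, trivial, 0, ⟨?_, fun q _ => ?_⟩, .of_forall fun w => rfl⟩
    · exact (contMDiff_zeroSection ℂ E).contMDiffOn
    · simp
  smul_mem' := by
    intro a s hs z
    obtain ⟨U, hU, hz, σ, hσ, hs⟩ := hs z
    refine ⟨U, hU, hz, a • σ, hσ.smul hU a, ?_⟩
    filter_upwards [hs] with w h1
    simp [h1]

variable (D : RealFlatConnection V E)

/-- Evaluation of multivalued horizontal sections at a point `z` over `q`. -/
def evalAt (q : puncturedDisc) (z : {z : UpperHalfPlane // unif z = q}) :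
    horizontalSections D →ₗ[ℂ] E q where
  toFun s := s.1 q z
  map_add' _ _ := rfl
  map_smul' _ _ := rfl

/-- The monodromy `T` on `H`, given by parallel transport along a counter-clockwise loop:
`(T s)(z) = s(z + 1)`. -/
def monodromy : Module.End ℂ (horizontalSections D) where
  toFun s := ⟨fun q z => s.1 q ⟨(1 : ℝ) +ᵥ z.1, (unif_add_one z.1).trans z.2⟩, by
    intro z
    obtain ⟨U, hU, hz, σ, hσ, hs⟩ := s.2 ((1 : ℝ) +ᵥ z)
    refine ⟨U, hU, unif_add_one z ▸ hz, σ, hσ, ?_⟩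
    have hc : Tendsto (fun w : UpperHalfPlane => (1 : ℝ) +ᵥ w) (𝓝 z) (𝓝 ((1 : ℝ) +ᵥ z)) :=
      Continuous.tendsto (UpperHalfPlane.isOpenEmbedding_coe.continuous_iff.mpr
        (((continuous_const (y := ((1 : ℝ) : ℂ))).add UpperHalfPlane.continuous_coe).congr fun w => by
          simp [UpperHalfPlane.coe_vadd])) z
    filter_upwards [hc.eventually hs] with w hw
    have key : ∀ q (hq : unif ((1 : ℝ) +ᵥ w) = q), s.1 q ⟨(1 : ℝ) +ᵥ w, hq⟩ = σ q := by
      rintro q rfl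
      exact hw
    exact key _ _⟩
  map_add' _ _ := rfl
  map_smul' _ _ := rfl

/-- The complex conjugation on `H`. -/
def conjH : horizontalSections D →ₛₗ[starRingEnd ℂ] horizontalSections D where
  toFun s := ⟨fun q z => D.conj q (s.1 q z), by
    intro z
    obtain ⟨U, hU, hz, σ, hσ, hs⟩ := s.2 z
    refine ⟨U, hU, hz, fun q => D.conj q (σ q), D.conj_flat U σ hU hσ, ?_⟩
    filter_upwards [hs] with w hw
    rw [hw]⟩
  map_add' s t := by
    apply Subtype.ext
    funext q z
    exact map_add (D.conj q) _ _
  map_smul' a s := by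
    apply Subtype.ext
    funext q z
    exact (D.conj q).map_smulₛₗ a _

/-- `N = -log T`. -/
def logMonodromy : Module.End ℂ (horizontalSections D) :=
  -unipLog (monodromy D)

/-- The canonical extension is the trivial bundle over the unit disc with fiber `H`. Over
`q = exp(2πiz)` in `Δ*` it is identified with the given bundle by `h ↦ (exp(zN) h)(z)`, which does
not depend on the choice of `z`. -/
def canonicalFrame (q : puncturedDisc) (z : {z : UpperHalfPlane // unif z = q}) :
    horizontalSections D →ₗ[ℂ] E q :=
  evalAt D q z ∘ₗ nilExp ((z.1 : ℂ) • logMonodromy D)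

/-- The filtration `F'` by holomorphic subbundles of the canonical extension over the whole unit
disc (with `F' p 0` the fiber at the origin) extends the filtration of the canonical extension over
`Δ*` that corresponds to `F`. -/
structure IsCanonicalExtension (F : ℤ → ∀ q, Submodule ℂ (E q))
    (F' : ℤ → ℂ → Submodule ℂ (horizontalSections D)) : Prop where
  subbundle : ∀ p, IsHolSubbundleOfTrivial (F' p)
  restrict : ∀ (p : ℤ) (q : puncturedDisc) (z : {z : UpperHalfPlane // unif z = q}),
    F' p q = (F p q).comap (canonicalFrame D q z)

open Classical in
/-- The bilinear form on the fiber `E q` induced by a bilinear form `S` on `H`, where `H` is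
identified with `E q` by evaluation at any `z` over `q`. It exists (and is unique) if
`S(T s, T t) = S(s, t)`, in particular if `T` is unipotent and `N` is an infinitesimal isometry
of `S`. -/
def fiberForm (S : LinearMap.BilinForm ℂ (horizontalSections D)) (q : puncturedDisc) :
    LinearMap.BilinForm ℂ (E q) :=
  if h : ∃ B : LinearMap.BilinForm ℂ (E q),
      ∀ (z : {z : UpperHalfPlane // unif z = q}) (s t : horizontalSections D),
        B (evalAt D q z s) (evalAt D q z t) = S s t
  then h.choose else 0

end Bundle

end

end DegenerationHodge

/-! Write `t = √(Im z)`. Since `zN = Re z · N + i t² N` and the first summand is real, the fiber at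
`q = φ(z)` can be identified with `H`, compatibly with conjugation and `S`, so that `F_q` becomes
`exp(i t² N) F'_q` (`IsCanonicalExtension.eq_map`). The question is thus the behaviour of `exp(i t²
N) F'_q` and its conjugate as `t → ∞`. Replacing `F'_q` by `F'_0` costs only an error `O(q)`, which
decays faster than any power of `t`.

On the limit mixed Hodge structure one chooses strings: vectors `v_σ ∈ F^(A σ) ∩ W_(d+l σ)` lifting
bases of the components of the primitive parts. The vectors `N^j v_σ`, `j ≤ l σ`, form a basis of
`H` adapted to both `F` and `W` (`IsStringFamily.inf_le_span`, `IsStringFamily.linearIndependent`).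
The mixed Hodge structure need not split over `ℝ`, so `N^(l+1) v_σ` need not vanish and `v_σ` need
not lie in the conjugate filtration, but these defects have lower weight. Multiplying the coordinate
of `N^j v_σ` by `t^(l-2j)` turns `t² N` into `N` and sends all terms of lower weight to zero. Hence
the rescaled filtrations converge to `exp(iN)` and `exp(-iN)` applied to standard filtrations of a
direct sum of Jordan blocks (`IsStringFamily.lowConv_scale`).

A Jordan block of size `l + 1` is the space of polynomials of degree at most `l` with `N = d/dX`,
and `exp(sN)` is translation by `s`. The polynomials `(X+i)^(l-m) (X-i)^m` then span the Hodge
components of the limit. They show that the two limit filtrations span everything; spanning is an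
open condition, and a dimension count upgrades it to opposedness
(`IsStringFamily.eventually_isPureHodge`).

For the signature, the strings are chosen orthogonal for the Hermitian forms on the primitive parts.
The rescaled Gram matrix of `S(·, conj ·)` converges to the one pairing position `j` with `l - j` in
the same string (`IsStringFamily.tendsto_gram`). Its values on the above polynomials are computed by
a translation invariant pairing, the transvectant (`sum_hodgeVec`), and every vector of a string
receives the sign of its highest vector. So the index on the `(p, d-p)`-component counts the pairs
`(σ, j)` with `A σ - j = p` and given sign, which is what the sums of the `s_±` count.

That `H` is identified with each fiber at all is analytic continuation of horizontal sections over
the upper half plane (`evalAt_bijective`). -/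

namespace DegenerationHodge

/-! ### Exponentials and logarithms of nilpotent and unipotent endomorphisms. -/

open Polynomial in
/-- The truncated exponential of the truncated logarithm agrees with `1 + X` to order `n`. -/
theorem truncExp_truncLog_coeff (n : ℕ) :
    ∀ k < n, (((∑ i ∈ Finset.range n, C ((i.factorial : ℂ)⁻¹) *
      (∑ k ∈ Finset.range n, C ((-1 : ℂ) ^ k / ((k : ℂ) + 1)) * X ^ (k + 1)) ^ i) -
        (1 + X) : ℂ[X])).coeff k = 0 := by
  set L : ℂ[X] := ∑ k ∈ Finset.range n, C ((-1 : ℂ) ^ k / ((k : ℂ) + 1)) * X ^ (k + 1) with hL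
  have hXL : X ∣ L := Finset.dvd_sum fun i _ => ⟨C ((-1 : ℂ) ^ i / ((i : ℂ) + 1)) * X ^ i, by ring⟩
  rcases n with _ | n
  · simp
  set E : ℂ[X] := ∑ i ∈ Finset.range (n + 1), C ((i.factorial : ℂ)⁻¹) * L ^ i with hE
  -- Both `E` and `1 + X` solve `(1 + X) Y' = Y` up to order `n` and have constant term `1`. The
  -- recursion for the coefficients of their difference then propagates the vanishing from degree
  -- `0` upwards.
  have hdL : (1 + X) * derivative L = 1 - (-X) ^ (n + 1) := by
    have : derivative L = ∑ k ∈ Finset.range (n + 1), (-X) ^ k := by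
      rw [hL, derivative_sum]
      refine Finset.sum_congr rfl fun k _ => ?_
      have h0 : ((k : ℂ) + 1) ≠ 0 := by exact_mod_cast Nat.succ_ne_zero k
      rw [derivative_C_mul_X_pow]
      push_cast
      rw [div_mul_cancel₀ _ h0, neg_pow (X : ℂ[X])]
      simp
    rw [this]
    have := mul_neg_geom_sum (-X : ℂ[X]) (n + 1)
    rw [← this]; ring
  have hdE : derivative E = derivative L * (E - C ((n.factorial : ℂ)⁻¹) * L ^ n) := by
    have h1 : E - C ((n.factorial : ℂ)⁻¹) * L ^ n =
        ∑ i ∈ Finset.range n, C ((i.factorial : ℂ)⁻¹) * L ^ i := by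
      rw [hE, Finset.sum_range_succ]; ring
    rw [h1, hE, derivative_sum, Finset.sum_range_succ', Finset.mul_sum]
    simp only [derivative_C_mul, derivative_pow, Nat.factorial_zero, pow_zero]
    simp only [Nat.add_sub_cancel, derivative_one, mul_zero, add_zero]
    refine Finset.sum_congr rfl fun i _ => ?_
    have h2 : C (((i + 1).factorial : ℂ)⁻¹) * C ((i + 1 : ℕ) : ℂ) = C ((i.factorial : ℂ)⁻¹) := by
      rw [← C_mul, Nat.factorial_succ]
      congr 1
      have h0 : ((i : ℂ) + 1) ≠ 0 := by exact_mod_cast Nat.succ_ne_zero i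
      have h1 : (i.factorial : ℂ) ≠ 0 := by exact_mod_cast i.factorial_ne_zero
      push_cast
      field_simp
    rw [← h2]
    ring
  have hmod : (X : ℂ[X]) ^ n ∣ (1 + X) * derivative (E - (1 + X)) - (E - (1 + X)) := by
    have e : (1 + X) * derivative (E - (1 + X)) - (E - (1 + X)) =
        X ^ n * (-(-1) ^ (n + 1) * X * (E - C ((n.factorial : ℂ)⁻¹) * L ^ n))
          - C ((n.factorial : ℂ)⁻¹) * L ^ n := by
      have e1 : (-X : ℂ[X]) ^ (n + 1) = X ^ n * ((-1) ^ (n + 1) * X) := by rw [neg_pow]; ring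
      simp only [derivative_sub, derivative_add, derivative_one, derivative_X, hdE]
      rw [e1] at hdL
      linear_combination (E - C ((n.factorial : ℂ)⁻¹) * L ^ n) * hdL
    rw [e]
    exact dvd_sub (dvd_mul_right _ _) (dvd_mul_of_dvd_right (pow_dvd_pow_of_dvd hXL n) _)
  rw [X_pow_dvd_iff] at hmod
  intro k
  induction k with
  | zero =>
    intro _
    have hL0 : L.coeff 0 = 0 := X_dvd_iff.mp hXL
    rw [coeff_zero_eq_eval_zero] at hL0 ⊢
    simp [hE, eval_finsetSum, hL0, Finset.sum_range_succ']
  | succ k ih =>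
    intro hk
    have h1 := hmod k (by omega)
    have h2 := ih (by omega)
    rw [add_mul, one_mul, coeff_sub, coeff_add, coeff_derivative, h2] at h1
    have h3 : (X * derivative (E - (1 + X))).coeff k = 0 := by
      rcases k with _ | k
      · simp
      · rw [coeff_X_mul, coeff_derivative, h2, zero_mul]
    rw [h3] at h1
    have h0 : ((k : ℂ) + 1) ≠ 0 := by exact_mod_cast Nat.succ_ne_zero k
    simpa [h0] using h1

section NilpotentExpLog

variable {X : Type*} [AddCommGroup X] [Module ℂ X]

theorem nilExp_eq_sum {A : Module.End ℂ X} {k : ℕ} (h : A ^ k = 0) :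
    nilExp A = ∑ i ∈ Finset.range k, ((i.factorial : ℂ)⁻¹) • A ^ i := by
  rw [nilExp]
  apply Finset.sum_subset
  · exact Finset.range_mono (Nat.sInf_le h)
  · intro i _ hi
    have : A ^ i = 0 :=
      pow_eq_zero_of_le (by simpa using hi) (pow_nilpotencyClass ⟨k, h⟩)
    simp [this]

theorem nilExp_add {A B : Module.End ℂ X} (hAB : Commute A B) (hA : IsNilpotent A)
    (hB : IsNilpotent B) : nilExp (A + B) = nilExp A * nilExp B := by
  -- `IsNilpotent.exp` has rational coefficients; after restriction of scalars it agrees with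
  -- `nilExp` term by term.
  let : Module ℚ (Module.End ℂ X) := Module.compHom _ (algebraMap ℚ ℂ)
  have key : ∀ C : Module.End ℂ X, nilExp C = IsNilpotent.exp C := by
    intro C
    refine Finset.sum_congr rfl fun i _ => ?_
    change _ = (algebraMap ℚ ℂ (i.factorial : ℚ)⁻¹) • C ^ i
    simp
  simp only [key]
  exact IsNilpotent.exp_add_of_commute hAB hA hB

theorem nilExp_zero : nilExp (0 : Module.End ℂ X) = 1 := by
  rw [nilExp_eq_sum (k := 1) (by simp)]
  simp

theorem nilExp_neg_mul {A : Module.End ℂ X} (hA : IsNilpotent A) :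
    nilExp (-A) * nilExp A = 1 := by
  rw [← nilExp_add ((Commute.refl A).neg_left) hA.neg hA, neg_add_cancel, nilExp_zero]

theorem nilExp_mul_neg {A : Module.End ℂ X} (hA : IsNilpotent A) :
    nilExp A * nilExp (-A) = 1 := by
  rw [← nilExp_add ((Commute.refl A).neg_right) hA hA.neg, add_neg_cancel, nilExp_zero]

theorem nilExp_neg_apply {A : Module.End ℂ X} (hA : IsNilpotent A) (u : X) :
    nilExp (-A) (nilExp A u) = u := by
  rw [← Module.End.mul_apply, nilExp_neg_mul hA, Module.End.one_apply]

theorem nilExp_apply_neg {A : Module.End ℂ X} (hA : IsNilpotent A) (u : X) :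
    nilExp A (nilExp (-A) u) = u := by
  rw [← Module.End.mul_apply, nilExp_mul_neg hA, Module.End.one_apply]

theorem _root_.IsNilpotent.smul_end {N : Module.End ℂ X} (hN : IsNilpotent N) (a : ℂ) :
    IsNilpotent (a • N) := by
  obtain ⟨k, hk⟩ := hN
  exact ⟨k, by rw [smul_pow, hk, smul_zero]⟩

theorem map_pow_of_map {Y : Type*} [AddCommGroup Y] [Module ℂ Y] {σ : ℂ →+* ℂ}
    {f : X →ₛₗ[σ] Y} {A : Module.End ℂ X} {B : Module.End ℂ Y} (h : ∀ x, f (A x) = B (f x))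
    (i : ℕ) (x : X) : f ((A ^ i) x) = (B ^ i) (f x) := by
  induction i generalizing x with
  | zero => simp
  | succ i ih => rw [pow_succ, Module.End.mul_apply, ih, h, pow_succ, Module.End.mul_apply]

theorem conj_nilExp_smul {c : X →ₛₗ[starRingEnd ℂ] X} {N : Module.End ℂ X}
    (hN : IsNilpotent N) (hc : ∀ x, N (c x) = c (N x)) (a : ℂ) (u : X) :
    c (nilExp (a • N) u) = nilExp (starRingEnd ℂ a • N) (c u) := by
  obtain ⟨k, hk⟩ := hN
  rw [nilExp_eq_sum (k := k) (by rw [smul_pow, hk, smul_zero]),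
    nilExp_eq_sum (k := k) (by rw [smul_pow, hk, smul_zero])]
  simp only [LinearMap.sum_apply, map_sum]
  refine Finset.sum_congr rfl fun i _ => ?_
  simp only [LinearMap.smul_apply, smul_pow, map_smulₛₗ, map_inv₀, map_natCast, map_pow]
  rw [map_pow_of_map (fun x => (hc x).symm)]

theorem form_pow {S : LinearMap.BilinForm ℂ X} {A : Module.End ℂ X}
    (h : ∀ u v, S u (A v) + S (A u) v = 0) (i : ℕ) (u v : X) :
    S ((A ^ i) u) v = (-1) ^ i * S u ((A ^ i) v) := by
  induction i generalizing u v with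
  | zero => simp
  | succ i ih =>
    have := h u ((A ^ i) v)
    rw [pow_succ, Module.End.mul_apply, ih, ← pow_succ, pow_succ' A, Module.End.mul_apply]
    linear_combination (-1) ^ i * this

/-- An infinitesimal isometry crosses `S` with a sign, so its exponential crosses as the inverse.
This gives invariance of `S` under `T`, under `exp(zN)` and under `exp(Re z · N)`. -/
theorem form_nilExp {S : LinearMap.BilinForm ℂ X} {A : Module.End ℂ X} (hA : IsNilpotent A)
    (h : ∀ u v, S u (A v) + S (A u) v = 0) (u v : X) :
    S (nilExp A u) v = S u (nilExp (-A) v) := by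
  obtain ⟨k, hk⟩ := hA
  rw [nilExp_eq_sum hk, nilExp_eq_sum (k := k) (by rw [neg_pow, hk, mul_zero])]
  simp only [LinearMap.sum_apply, map_sum, LinearMap.smul_apply, map_smul, smul_eq_mul]
  refine Finset.sum_congr rfl fun i _ => ?_
  rw [form_pow h]
  rcases Nat.even_or_odd i with hi | hi <;> simp [hi.neg_pow]

theorem form_nilExp_nilExp {S : LinearMap.BilinForm ℂ X} {A : Module.End ℂ X}
    (hA : IsNilpotent A) (h : ∀ u v, S u (A v) + S (A u) v = 0) (u v : X) :
    S (nilExp A u) (nilExp A v) = S u v := by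
  rw [form_nilExp hA h, nilExp_neg_apply hA]

theorem unipLog_eq_sum {T : Module.End ℂ X} {n : ℕ} (h : (T - 1) ^ n = 0) :
    unipLog T = ∑ k ∈ Finset.range n, ((-1 : ℂ) ^ k / ((k : ℂ) + 1)) • (T - 1) ^ (k + 1) := by
  rw [unipLog]
  apply Finset.sum_subset
  · exact Finset.range_mono (Nat.sInf_le h)
  · intro i _ hi
    have : (T - 1) ^ (i + 1) = 0 :=
      pow_eq_zero_of_le (Nat.le_succ_of_le (by simpa using hi)) (pow_nilpotencyClass ⟨n, h⟩)
    simp [this]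

theorem unipLog_eq_mul {T : Module.End ℂ X} : ∃ B, Commute (T - 1) B ∧ unipLog T = (T - 1) * B := by
  refine ⟨∑ k ∈ Finset.range (nilpotencyClass (T - 1)),
    ((-1 : ℂ) ^ k / ((k : ℂ) + 1)) • (T - 1) ^ k, ?_, ?_⟩
  · exact Commute.sum_right _ _ _ fun i _ => ((Commute.refl _).pow_right i).smul_right _
  · rw [unipLog, Finset.mul_sum]
    exact Finset.sum_congr rfl fun i _ => by rw [pow_succ', mul_smul_comm]

theorem unipLog_pow_eq_zero {T : Module.End ℂ X} {n : ℕ} (h : (T - 1) ^ n = 0) :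
    unipLog T ^ n = 0 := by
  obtain ⟨B, hB, e⟩ := unipLog_eq_mul (T := T)
  rw [e, hB.mul_pow, h, zero_mul]

/-- The congruence `exp(log(1 + X)) ≡ 1 + X` modulo `X^n` is evaluated at `T - 1`, whose `n`-th
power vanishes. -/
theorem nilExp_unipLog {T : Module.End ℂ X} (hT : IsNilpotent (T - 1)) :
    nilExp (unipLog T) = T := by
  obtain ⟨n, hn⟩ := hT
  rw [nilExp_eq_sum (unipLog_pow_eq_zero hn), unipLog_eq_sum hn]
  have h := truncExp_truncLog_coeff n
  rw [← Polynomial.X_pow_dvd_iff] at h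
  obtain ⟨Q, hQ⟩ := h
  have := congrArg (Polynomial.aeval (T - 1)) hQ
  simp only [map_sub, map_sum, map_mul, map_pow, map_add, Polynomial.aeval_C, Polynomial.aeval_X,
    map_one, hn, zero_mul, ← Algebra.smul_def] at this
  rw [sub_eq_zero] at this
  rw [this]; abel

end NilpotentExpLog

end DegenerationHodge

/-! ### The coordinate of the punctured disc and linear differential equations. -/

namespace DegenerationHodge

/-- A local inverse of the inclusion of the punctured disc into `ℂ`. -/
noncomputable def discPoint (q₀ : puncturedDisc) : ℂ → puncturedDisc := (chartAt ℂ q₀).symm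

theorem mem_chartAt_source (q₀ q : puncturedDisc) : q ∈ (chartAt ℂ q₀).source := by
  rw [TopologicalSpace.Opens.chartAt_eq, OpenPartialHomeomorph.subtypeRestr_source]
  exact Set.mem_univ (q : ℂ)

theorem discPoint_coe (q₀ q : puncturedDisc) : discPoint q₀ (q : ℂ) = q :=
  (chartAt ℂ q₀).left_inv (mem_chartAt_source q₀ q)

/-- The coordinate vector field of the punctured disc. -/
def coordField (q : puncturedDisc) : TangentSpace 𝓘(ℂ, ℂ) q := (1 : ℂ)

/-- All charts of an open subset of `ℂ` are restrictions of the identity. So one inverse chart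
`discPoint q₀` serves at every point `q`, and manifold derivatives become ordinary ones. -/
theorem mvfderiv_coordField {G : Type*} [NormedAddCommGroup G] [NormedSpace ℂ G]
    {f : puncturedDisc → G} {q : puncturedDisc} (q₀ : puncturedDisc)
    (hf : MDifferentiableAt 𝓘(ℂ, ℂ) 𝓘(ℂ, G) f q) :
    mvfderiv 𝓘(ℂ, ℂ) f q (coordField q) = deriv (f ∘ discPoint q₀) q := by
  have h : mvfderiv 𝓘(ℂ, ℂ) f q (coordField q) = fderivWithin ℂ
      (writtenInExtChartAt 𝓘(ℂ, ℂ) 𝓘(ℂ, G) q f) (Set.range 𝓘(ℂ, ℂ)) (extChartAt 𝓘(ℂ, ℂ) q q)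
        (1 : ℂ) := by
    change mfderiv 𝓘(ℂ, ℂ) 𝓘(ℂ, G) f q (1 : ℂ) = _
    exact congrArg (fun L : ℂ →L[ℂ] G => L 1) hf.mfderiv
  rw [h, modelWithCornersSelf_coe, Set.range_id, fderivWithin_univ]
  rfl

theorem mdifferentiableAt_iff_discPoint {G : Type*} [NormedAddCommGroup G] [NormedSpace ℂ G]
    {f : puncturedDisc → G} {q : puncturedDisc} (q₀ : puncturedDisc) 
    (hf : MDifferentiableAt 𝓘(ℂ, ℂ) 𝓘(ℂ, G) f q) : DifferentiableAt ℂ (f ∘ discPoint q₀) q := by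
  have := hf.differentiableWithinAt_writtenInExtChartAt
  rw [modelWithCornersSelf_coe, Set.range_id, differentiableWithinAt_univ] at this
  exact this

theorem contMDiffAt_coe_disc (q : puncturedDisc) :
    ContMDiffAt 𝓘(ℂ, ℂ) 𝓘(ℂ, ℂ) ω (fun q : puncturedDisc => (q : ℂ)) q :=
  contMDiff_subtype_val q

theorem contMDiff_coordField :
    ContMDiff 𝓘(ℂ, ℂ) (𝓘(ℂ, ℂ).prod 𝓘(ℂ, ℂ)) ω
      (fun q : puncturedDisc => TotalSpace.mk' ℂ q (coordField q)) := by
  intro q₀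
  rw [contMDiffAt_section]
  refine (contMDiffAt_const (c := (1 : ℂ))).congr_of_eventuallyEq (.of_forall fun q => ?_)
  exact tangentCoordChange_self (I := 𝓘(ℂ, ℂ)) (x := q₀) (z := q) (by
    rw [extChartAt_source]; exact mem_chartAt_source q₀ q)


/-- Local existence of holomorphic solutions of holomorphic linear differential equations. -/
theorem exists_hasDerivAt_linear {G : Type*} [NormedAddCommGroup G] [NormedSpace ℂ G]
    [CompleteSpace G] {A : ℂ → G →L[ℂ] G} {z₀ : ℂ} {U : Set ℂ} (hU : U ∈ 𝓝 z₀)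
    (hA : DifferentiableOn ℂ A U) :
    ∃ r > 0, ∀ y₀ : G, ∃ Y : ℂ → G, Y z₀ = y₀ ∧
      ∀ z ∈ Metric.ball z₀ r, HasDerivAt Y (A z (Y z)) z := by
  have hcont : ContinuousAt A z₀ := (hA.continuousOn.continuousAt hU)
  set C : ℝ := ‖A z₀‖ + 1 with hC
  have hC0 : 0 < C := by positivity
  have hev : ∀ᶠ z in 𝓝 z₀, ‖A z‖ ≤ C ∧ z ∈ U :=
    ((hcont.norm.eventually_lt_const (u := C) (by simp [hC])).mono fun _ h => h.le).and hU
  obtain ⟨r₀, hr₀, hball⟩ := Metric.eventually_nhds_iff_ball.mp hev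
  -- With this radius, applying `A` and integrating halves the norm. The radius depends on `A` only,
  -- so it is the same for all initial values.
  set r := min r₀ (1 / (2 * C)) with hr
  have hrpos : 0 < r := lt_min hr₀ (by positivity)
  have hrC : C * r ≤ 1 / 2 := by
    calc C * r ≤ C * (1 / (2 * C)) := by gcongr; exact min_le_right _ _
      _ = 1 / 2 := by field_simp
  have hsub : Metric.ball z₀ r ⊆ Metric.ball z₀ r₀ := Metric.ball_subset_ball (min_le_left _ _)
  have hAd : DifferentiableOn ℂ A (Metric.ball z₀ r) :=
    hA.mono fun z hz => (hball z (hsub hz)).2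
  refine ⟨r, hrpos, fun y₀ => ?_⟩
  have hprim : ∀ f : ℂ → G, ∃ g : ℂ → G, DifferentiableOn ℂ f (Metric.ball z₀ r) →
      g z₀ = 0 ∧ ∀ z ∈ Metric.ball z₀ r, HasDerivAt g (A z (f z)) z := by
    intro f
    by_cases hf : DifferentiableOn ℂ f (Metric.ball z₀ r)
    · obtain ⟨g, h1, h2⟩ := ((hAd.clm_apply hf).isExactOn_ball).with_val_at z₀ 0
      exact ⟨g, fun _ => ⟨h1, h2⟩⟩
    · exact ⟨0, fun h => absurd h hf⟩
  choose P hP using hprim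
  -- Picard iteration written as a series: the solution is `∑ f n`, where `f (n + 1)` is the
  -- primitive of `A · f n` vanishing at `z₀`. Differentiating termwise shifts the series by one.
  let f : ℕ → ℂ → G := fun n => Nat.rec (fun _ => y₀) (fun _ g => P g) n
  have hf0 : f 0 = fun _ => y₀ := rfl
  have hfs : ∀ n, f (n + 1) = P (f n) := fun n => rfl
  have hd : ∀ n, DifferentiableOn ℂ (f n) (Metric.ball z₀ r) := by
    intro n
    induction n with
    | zero => rw [hf0]; exact differentiableOn_const _
    | succ n ih =>
      intro z hz
      rw [hfs]
      exact ((hP (f n) ih).2 z hz).differentiableAt.differentiableWithinAt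
  have hz₀ : z₀ ∈ Metric.ball z₀ r := Metric.mem_ball_self hrpos
  have hb : ∀ n, ∀ z ∈ Metric.ball z₀ r, ‖f n z‖ ≤ (1 / 2) ^ n * ‖y₀‖ := by
    intro n
    induction n with
    | zero => intro z _; simp [hf0]
    | succ n ih =>
      intro z hz
      have h := hP (f n) (hd n)
      have hmv := (convex_ball z₀ r).norm_image_sub_le_of_norm_hasDerivWithin_le
        (f := P (f n)) (f' := fun z => A z (f n z)) (C := C * ((1 / 2) ^ n * ‖y₀‖))
        (fun w hw => (h.2 w hw).hasDerivWithinAt)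
        (fun w hw => ((A w).le_opNorm _).trans (mul_le_mul (hball w (hsub hw)).1 (ih w hw)
          (norm_nonneg _) hC0.le)) hz₀ hz
      rw [hfs]
      rw [h.1, sub_zero] at hmv
      have hzr : ‖z - z₀‖ ≤ r := (mem_ball_iff_norm.mp hz).le
      calc ‖P (f n) z‖ ≤ C * ((1 / 2) ^ n * ‖y₀‖) * ‖z - z₀‖ := hmv
        _ ≤ C * ((1 / 2) ^ n * ‖y₀‖) * r := by gcongr
        _ = (C * r) * ((1 / 2) ^ n * ‖y₀‖) := by ring
        _ ≤ (1 / 2) * ((1 / 2) ^ n * ‖y₀‖) := by gcongr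
        _ = (1 / 2) ^ (n + 1) * ‖y₀‖ := by ring
  have hsum : Summable fun n : ℕ => (1 / 2 : ℝ) ^ n * ‖y₀‖ :=
    (summable_geometric_of_lt_one (by norm_num) (by norm_num)).mul_right _
  refine ⟨fun z => ∑' n, f n z, ?_, fun z hz => ?_⟩
  · change ∑' n, f n z₀ = y₀
    refine (tsum_eq_single 0 fun n hn => ?_).trans rfl
    obtain ⟨m, rfl⟩ := Nat.exists_eq_succ_of_ne_zero hn
    exact (hP (f m) (hd m)).1
  · have hdiff : DifferentiableAt ℂ (fun z => ∑' n, f n z) z :=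
      (Complex.differentiableOn_tsum_of_summable_norm hsum hd Metric.isOpen_ball hb).differentiableAt
        (Metric.isOpen_ball.mem_nhds hz)
    have h1 := Complex.hasSum_deriv_of_summable_norm hsum hd Metric.isOpen_ball hb hz
    have hs : Summable fun n => f n z :=
      Summable.of_norm_bounded hsum fun n => hb n z hz
    have h2 : HasSum (fun n => deriv (f n) z) (A z (∑' n, f n z)) := by
      rw [← hasSum_nat_add_iff' 1]
      have h3 : HasSum (fun n => A z (f n z)) (A z (∑' n, f n z)) := (A z).hasSum hs.hasSum
      have h4 : deriv (f 0) z = 0 := by rw [hf0]; simp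
      simp only [Finset.sum_range_one, h4, sub_zero]
      refine h3.congr_fun fun n => ?_
      exact ((hP (f n) (hd n)).2 z hz).deriv
    rw [← h1.unique h2]
    exact hdiff.hasDerivAt

end DegenerationHodge

/-! ### Local flat coordinates of a connection. -/

namespace DegenerationHodge

theorem exists_hasDerivAt_system {κ : Type*} [Fintype κ] {B : κ → κ → ℂ → ℂ} {z₀ : ℂ} {U : Set ℂ}
    (hU : U ∈ 𝓝 z₀) (hB : ∀ i j, DifferentiableOn ℂ (B i j) U) :
    ∃ r > 0, ∀ y₀ : κ → ℂ, ∃ Y : ℂ → κ → ℂ, Y z₀ = y₀ ∧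
      ∀ z ∈ Metric.ball z₀ r, ∀ i, HasDerivAt (fun z => Y z i) (∑ j, B i j z * Y z j) z := by
  classical
  let A : ℂ → (κ → ℂ) →L[ℂ] (κ → ℂ) := fun w =>
    ∑ i, ∑ j, B i j w • (ContinuousLinearMap.proj (R := ℂ) (φ := fun _ : κ => ℂ) j).smulRight
      (Pi.single i (1 : ℂ) : κ → ℂ)
  have hA : DifferentiableOn ℂ A U := by
    refine DifferentiableOn.fun_sum fun i _ => DifferentiableOn.fun_sum fun j _ => ?_
    exact (hB i j).smul_const _
  obtain ⟨r, hr, h⟩ := exists_hasDerivAt_linear hU hA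
  refine ⟨r, hr, fun y₀ => ?_⟩
  obtain ⟨Y, h0, hY⟩ := h y₀
  refine ⟨Y, h0, fun z hz i => ?_⟩
  refine (hasDerivAt_pi.mp (hY z hz) i).congr_deriv ?_
  simp [A, Pi.single_apply, mul_ite]

section Bundle

set_option linter.unusedSectionVars false

variable {V : Type*} [NormedAddCommGroup V] [NormedSpace ℂ V] [FiniteDimensional ℂ V]
  {E : puncturedDisc → Type*}
  [∀ q, AddCommGroup (E q)] [∀ q, Module ℂ (E q)] [∀ q, TopologicalSpace (E q)]
  [∀ q, IsTopologicalAddGroup (E q)] [∀ q, ContinuousSMul ℂ (E q)]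
  [TopologicalSpace (TotalSpace V E)] [FiberBundle V E] [VectorBundle ℂ V E]
  [ContMDiffVectorBundle ω V E 𝓘(ℂ, ℂ)]

/-- The matrix of the connection in the frame attached to the trivialization at `q₀`. -/
noncomputable def connMatrix (D : RealFlatConnection V E) (q₀ : puncturedDisc)
    (i j : Fin (Module.finrank ℂ V)) (q : puncturedDisc) : ℂ :=
  haveI : ContMDiffVectorBundle 1 V E 𝓘(ℂ, ℂ) := .of_le (n := ω) le_top
  (trivializationAt V E q₀).localFrameCoeff 𝓘(ℂ, ℂ) (Module.finBasis ℂ V) i q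
    (D.conn ((trivializationAt V E q₀).localFrame (Module.finBasis ℂ V) j) q (coordField q))

theorem contMDiffOn_connMatrix (D : RealFlatConnection V E) (q₀ : puncturedDisc)
    (i j : Fin (Module.finrank ℂ V)) :
    ContMDiffOn 𝓘(ℂ, ℂ) 𝓘(ℂ, ℂ) ω (connMatrix D q₀ i j) (trivializationAt V E q₀).baseSet := by
  have : ContMDiffVectorBundle 1 V E 𝓘(ℂ, ℂ) := .of_le (n := ω) le_top
  set e := trivializationAt V E q₀
  set b := Module.finBasis ℂ V
  have hfr : ContMDiffOn 𝓘(ℂ, ℂ) (𝓘(ℂ, ℂ).prod 𝓘(ℂ, V)) (ω + 1)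
      (fun q => TotalSpace.mk' V q (e.localFrame b j q)) e.baseSet := 
    e.contMDiffOn_localFrame_baseSet ω b j
  have h1 := (D.holomorphic e.baseSet e.open_baseSet).contMDiff hfr
  have h2 : ContMDiffOn 𝓘(ℂ, ℂ) (𝓘(ℂ, ℂ).prod 𝓘(ℂ, V)) ω
      (fun q => TotalSpace.mk' V q (D.conn (e.localFrame b j) q (coordField q))) e.baseSet :=
    h1.clm_bundle_apply (contMDiff_coordField.contMDiffOn)
  exact contMDiffOn_baseSet_localFrameCoeff b h2 i

theorem conn_sum (D : RealFlatConnection V E) {κ : Type*} (s : Finset κ) (f : κ → ∀ q, E q)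
    {q : puncturedDisc}
    (hf : ∀ i ∈ s, MDifferentiableAt 𝓘(ℂ, ℂ) (𝓘(ℂ, ℂ).prod 𝓘(ℂ, V))
      (fun q => TotalSpace.mk' V q (f i q)) q) :
    D.conn (fun q => ∑ i ∈ s, f i q) q = ∑ i ∈ s, D.conn (f i) q := by
  classical
  induction s using Finset.induction_on with
  | empty => 
    have : (fun q => ∑ i ∈ (∅ : Finset κ), f i q) = (0 : ∀ q, E q) := by ext; simp
    rw [this]; simp
  | insert a s ha ih =>
    have h1 : (fun q => ∑ i ∈ insert a s, f i q) = f a + fun q => ∑ i ∈ s, f i q := by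
      ext q; simp [Finset.sum_insert ha]
    have h2 := fun i hi => hf i (Finset.mem_insert_of_mem hi)
    rw [h1, D.conn.isCovariantDerivativeOnUniv.add (hf a (Finset.mem_insert_self _ _))
      (MDifferentiableAt.sum_section h2), ih h2, Finset.sum_insert ha]

/-- The connection in terms of the frame attached to the trivialization at `q₀`. -/
theorem localFrameCoeff_conn (D : RealFlatConnection V E) (q₀ : puncturedDisc)
    [ContMDiffVectorBundle 1 V E 𝓘(ℂ, ℂ)]
    {σ : ∀ q, E q} {q : puncturedDisc} (hq : q ∈ (trivializationAt V E q₀).baseSet)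
    (hσ : MDifferentiableAt 𝓘(ℂ, ℂ) (𝓘(ℂ, ℂ).prod 𝓘(ℂ, V))
      (fun q => TotalSpace.mk' V q (σ q)) q) (i : Fin (Module.finrank ℂ V)) :
    (trivializationAt V E q₀).localFrameCoeff 𝓘(ℂ, ℂ) (Module.finBasis ℂ V) i q
      (D.conn σ q (coordField q)) =
    ∑ j, connMatrix D q₀ i j q *
      (trivializationAt V E q₀).localFrameCoeff 𝓘(ℂ, ℂ) (Module.finBasis ℂ V) j q (σ q) +
    deriv ((fun q => (trivializationAt V E q₀).localFrameCoeff 𝓘(ℂ, ℂ) (Module.finBasis ℂ V) i q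
      (σ q)) ∘ discPoint q₀) q := by
  set e := trivializationAt V E q₀ with he
  set b := Module.finBasis ℂ V with hb
  set f : Fin (Module.finrank ℂ V) → puncturedDisc → ℂ :=
    fun j q => e.localFrameCoeff 𝓘(ℂ, ℂ) b j q (σ q) with hf
  have hfr : ∀ j, MDifferentiableAt 𝓘(ℂ, ℂ) (𝓘(ℂ, ℂ).prod 𝓘(ℂ, V))
      (fun q => TotalSpace.mk' V q (e.localFrame b j q)) q := fun j =>
    (contMDiffAt_localFrame_of_mem (n := ω) e b j hq).mdifferentiableAt (by simp)
  have hfd : ∀ j, MDifferentiableAt 𝓘(ℂ, ℂ) 𝓘(ℂ, ℂ) (f j) q := fun j =>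
    mdifferentiableAt_localFrameCoeff (I := 𝓘(ℂ, ℂ)) b hq hσ j
  have hprod : ∀ j, MDifferentiableAt 𝓘(ℂ, ℂ) (𝓘(ℂ, ℂ).prod 𝓘(ℂ, V))
      (fun q => TotalSpace.mk' V q ((f j • e.localFrame b j) q)) q := fun j =>
    (hfd j).smul_section (hfr j)
  have h1 : D.conn σ q = D.conn (fun q => ∑ j, (f j • e.localFrame b j) q) q := by
    refine D.conn.isCovariantDerivativeOnUniv.congr_of_eventuallyEq hσ
      (MDifferentiableAt.sum_section fun j _ => hprod j) univ_mem ?_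
    exact e.eventually_eq_localFrame_sum_coeff_smul b hq
  have h2 : D.conn σ q (coordField q) = ∑ j, (f j q • D.conn (e.localFrame b j) q (coordField q) +
      deriv (f j ∘ discPoint q₀) q • e.localFrame b j q) := by
    rw [h1, conn_sum D _ _ fun j _ => hprod j, sum_apply]
    refine Finset.sum_congr rfl fun j _ => ?_
    rw [D.conn.isCovariantDerivativeOnUniv.leibniz (hfr j) (hfd j)]
    simp only [add_apply, smul_apply,
      ContinuousLinearMap.smulRight_apply]
    rw [mvfderiv_coordField q₀ (hfd j)]
  rw [h2, map_sum]
  simp only [map_add, map_smul, smul_eq_mul, Finset.sum_add_distrib]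
  congr 1
  · refine Finset.sum_congr rfl fun j _ => ?_
    rw [mul_comm]; rfl
  · have hk : ∀ j, e.localFrameCoeff 𝓘(ℂ, ℂ) b i q (e.localFrame b j q) =
        if j = i then 1 else 0 := by
      intro j
      rw [e.localFrameCoeff_apply_of_mem_baseSet b hq, e.localFrame_apply_of_mem_baseSet b hq,
        Module.Basis.repr_self, Finsupp.single_apply]
    rw [Finset.sum_eq_single i (fun j _ hj => by rw [hk, if_neg hj, mul_zero]) (by simp), hk,
      if_pos rfl, mul_one]

/-- In a local frame, horizontality reads `y' = -B y`. Its solutions have constant pairing with the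
solutions `Z k` of the adjoint system `Z' = Bᵀ Z`, so pairing with the `Z k` gives flat coordinates
`τ` and no fundamental matrix has to be inverted. Surjectivity of `τ` is local existence of
horizontal sections, injectivity follows by dimension, and constancy along any horizontal section
gives local uniqueness. -/
theorem exists_flat_coordinates (D : RealFlatConnection V E) (q₀ : puncturedDisc) :
    ∃ U : Set puncturedDisc, IsOpen U ∧ q₀ ∈ U ∧ ∃ (N : ℕ) (τ : ∀ q, E q →ₗ[ℂ] (Fin N → ℂ)),
      (∀ q ∈ U, Function.Injective (τ q)) ∧
      (∀ v, ∃ σ, IsHorizontalOn D.conn σ U ∧ ∀ q ∈ U, τ q (σ q) = v) ∧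
      ∀ (σ : ∀ q, E q) (U' : Set puncturedDisc), IsOpen U' → q₀ ∈ U' → IsHorizontalOn D.conn σ U' →
        ∀ᶠ q in 𝓝 q₀, τ q (σ q) = τ q₀ (σ q₀) := by
  have : ContMDiffVectorBundle 1 V E 𝓘(ℂ, ℂ) := .of_le (n := ω) le_top
  set e := trivializationAt V E q₀ with he
  let B : Fin (Module.finrank ℂ V) → Fin (Module.finrank ℂ V) → ℂ → ℂ := fun i j w => connMatrix D q₀ i j (discPoint q₀ w)
  set Ω : Set ℂ := (↑) '' e.baseSet with hΩ
  have hΩo : IsOpen Ω := puncturedDisc.isOpen.isOpenMap_subtype_val _ e.open_baseSet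
  have hq₀ : q₀ ∈ e.baseSet := FiberBundle.mem_baseSet_trivializationAt' q₀
  have hq₀Ω : (q₀ : ℂ) ∈ Ω := ⟨q₀, hq₀, rfl⟩
  have hB : ∀ i j, DifferentiableOn ℂ (B i j) Ω := by
    rintro i j _ ⟨q, hq, rfl⟩
    have h := ((contMDiffOn_connMatrix D q₀ i j) q hq).contMDiffAt (e.open_baseSet.mem_nhds hq)
    exact (mdifferentiableAt_iff_discPoint q₀
      (h.mdifferentiableAt (by simp))).differentiableWithinAt
  obtain ⟨r₁, hr₁, hY⟩ := exists_hasDerivAt_system (B := fun i j z => -B i j z)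
    (hΩo.mem_nhds hq₀Ω) fun i j => (hB i j).neg
  obtain ⟨r₂, hr₂, hZ⟩ := exists_hasDerivAt_system (B := fun i j z => B j i z)
    (hΩo.mem_nhds hq₀Ω) fun i j => hB j i
  choose Z hZ0 hZ using fun k : Fin (Module.finrank ℂ V) => hZ (Pi.single k 1)
  choose Y hY0 hY using hY
  obtain ⟨r₃, hr₃, hball⟩ := Metric.isOpen_iff.mp hΩo _ hq₀Ω
  set r := min r₁ (min r₂ r₃) with hr
  have hrpos : 0 < r := lt_min hr₁ (lt_min hr₂ hr₃)
  set U : Set puncturedDisc := (↑) ⁻¹' Metric.ball (q₀ : ℂ) r with hU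
  have hUo : IsOpen U := Metric.isOpen_ball.preimage continuous_subtype_val
  have hsub₁ : Metric.ball (q₀ : ℂ) r ⊆ Metric.ball (q₀ : ℂ) r₁ :=
    Metric.ball_subset_ball (min_le_left _ _)
  have hsub₂ : Metric.ball (q₀ : ℂ) r ⊆ Metric.ball (q₀ : ℂ) r₂ :=
    Metric.ball_subset_ball ((min_le_right _ _).trans (min_le_left _ _))
  have hsub₃ : Metric.ball (q₀ : ℂ) r ⊆ Ω :=
    (Metric.ball_subset_ball ((min_le_right _ _).trans (min_le_right _ _))).trans hball
  have hUb : U ⊆ e.baseSet := by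
    intro q hq
    obtain ⟨q', hq', h⟩ := hsub₃ hq
    rwa [← Subtype.ext h]
  let coef : ∀ (j : Fin (Module.finrank ℂ V)) q, E q →ₗ[ℂ] ℂ := fun j q => e.localFrameCoeff 𝓘(ℂ, ℂ) (Module.finBasis ℂ V) j q
  let τ : ∀ q, E q →ₗ[ℂ] (Fin (Module.finrank ℂ V) → ℂ) := fun q =>
    LinearMap.pi fun k => ∑ j, Z k q j • coef j q
  have hτ : ∀ q u k, τ q u k = ∑ j, Z k q j * coef j q u := by
    intro q u k; simp [τ]
  -- the pairing of a solution with a solution of the adjoint system is constant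
  have hpair : ∀ (f : ℂ → Fin (Module.finrank ℂ V) → ℂ) (k : Fin (Module.finrank ℂ V)) (z : ℂ), z ∈ Metric.ball (q₀ : ℂ) r →
      (∀ i, HasDerivAt (fun z => f z i) (∑ j, -B i j z * f z j) z) →
      HasDerivAt (fun z => ∑ j, Z k z j * f z j) 0 z := by
    intro f k z hz hf
    have h := HasDerivAt.fun_sum (u := Finset.univ)
      fun j _ => (hZ k z (hsub₂ hz) j).mul (hf j)
    refine h.congr_deriv ?_
    rw [Finset.sum_add_distrib]
    simp only [Finset.sum_mul, Finset.mul_sum]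
    rw [Finset.sum_comm, ← Finset.sum_add_distrib]
    refine Finset.sum_eq_zero fun i _ => ?_
    rw [← Finset.sum_add_distrib]
    refine Finset.sum_eq_zero fun j _ => ?_
    ring
  have hconst : ∀ (f : ℂ → Fin (Module.finrank ℂ V) → ℂ) (ρ : ℝ), ρ ≤ r →
      (∀ z ∈ Metric.ball (q₀ : ℂ) ρ, ∀ i, HasDerivAt (fun z => f z i) (∑ j, -B i j z * f z j) z) →
      ∀ k, ∀ z ∈ Metric.ball (q₀ : ℂ) ρ, ∑ j, Z k z j * f z j = f q₀ k := by
    intro f ρ hρ hf k z hz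
    have hd : ∀ z ∈ Metric.ball (q₀ : ℂ) ρ, HasDerivAt (fun z => ∑ j, Z k z j * f z j) 0 z :=
      fun z hz => hpair f k z (Metric.ball_subset_ball hρ hz) (hf z hz)
    have hρ0 : 0 < ρ := dist_nonneg.trans_lt (Metric.mem_ball.mp hz)
    have := Metric.isOpen_ball.is_const_of_deriv_eq_zero (convex_ball (q₀ : ℂ) ρ).isPreconnected
      (fun z hz => (hd z hz).differentiableAt.differentiableWithinAt)
      (fun z hz => (hd z hz).deriv) hz (Metric.mem_ball_self hρ0)
    rw [this, hZ0]
    simp [Pi.single_apply]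
  have hcoef : ∀ (f : ℂ → Fin (Module.finrank ℂ V) → ℂ) (q), q ∈ e.baseSet → ∀ i,
      coef i q (∑ j, f q j • e.localFrame (Module.finBasis ℂ V) j q) = f q i := by
    intro f q hq i
    have hk : ∀ j, coef i q (e.localFrame (Module.finBasis ℂ V) j q) = if j = i then 1 else 0 := by
      intro j
      rw [e.localFrameCoeff_apply_of_mem_baseSet (Module.finBasis ℂ V) hq, e.localFrame_apply_of_mem_baseSet (Module.finBasis ℂ V) hq,
        Module.Basis.repr_self, Finsupp.single_apply]
    simp [map_sum, hk]
  have hsurj : ∀ v, ∃ σ, IsHorizontalOn D.conn σ U ∧ ∀ q ∈ U, τ q (σ q) = v := by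
    intro v
    let σ : ∀ q, E q := fun q => ∑ j, Y v q j • e.localFrame (Module.finBasis ℂ V) j q
    have hσc : ∀ q ∈ e.baseSet, ∀ i, coef i q (σ q) = Y v q i := hcoef (Y v)
    have hYd : ∀ i, DifferentiableOn ℂ (fun z => Y v z i) (Metric.ball (q₀ : ℂ) r) := fun i z hz =>
      (hY v z (hsub₁ hz) i).differentiableAt.differentiableWithinAt
    have hσh : HolOn V σ U := by
      refine (contMDiffOn_iff_localFrameCoeff (e := e) (Module.finBasis ℂ V) hUo hUb).mpr fun i => ?_
      have h1 : ContMDiffOn 𝓘(ℂ, ℂ) 𝓘(ℂ, ℂ) ω (fun z => Y v z i) (Metric.ball (q₀ : ℂ) r) :=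
        (((hYd i).analyticOn Metric.isOpen_ball).contDiffOn
          Metric.isOpen_ball.uniqueDiffOn).contMDiffOn
      have h2 : ContMDiffOn 𝓘(ℂ, ℂ) 𝓘(ℂ, ℂ) ω (fun q : puncturedDisc => Y v q i) U :=
        h1.comp (fun q _ => (contMDiffAt_coe_disc q).contMDiffWithinAt) fun q hq => hq
      exact h2.congr fun q hq => hσc q (hUb hq) i
    refine ⟨σ, ⟨hσh, fun q hq => ?_⟩, fun q hq => ?_⟩
    · have hm := ((hσh q hq).contMDiffAt (hUo.mem_nhds hq)).mdifferentiableAt (by simp)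
      have h0 : ∀ i, coef i q (D.conn σ q (coordField q)) = 0 := by
        intro i
        have h := localFrameCoeff_conn D q₀ (hUb hq) hm i
        have hder : deriv ((fun q => coef i q (σ q)) ∘ discPoint q₀) q =
            ∑ j, -B i j q * Y v q j := by
          rw [← (hY v q (hsub₁ hq) i).deriv]
          refine EventuallyEq.deriv_eq ?_
          filter_upwards [Metric.isOpen_ball.mem_nhds hq] with w hw
          obtain ⟨q', hq', rfl⟩ := hsub₃ hw
          rw [Function.comp_apply, discPoint_coe]
          exact hσc q' hq' i
        refine h.trans ?_
        rw [hder, ← Finset.sum_add_distrib]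
        refine Finset.sum_eq_zero fun j _ => ?_
        have := hσc q (hUb hq) j
        simp only [coef] at this
        rw [this]
        simp only [B, discPoint_coe]
        ring
      have h1 : D.conn σ q (coordField q) = 0 := by
        have := e.eq_sum_localFrameCoeff_smul (I := 𝓘(ℂ, ℂ)) (b := Module.finBasis ℂ V)
          (s := fun q => D.conn σ q (coordField q)) (hUb hq)
        rw [this]
        exact Finset.sum_eq_zero fun i _ => by
          have := h0 i
          simp only [coef] at this
          rw [this, zero_smul]
      -- The tangent spaces are lines spanned by `coordField`, so vanishing in this direction is
      -- enough.
      refine ContinuousLinearMap.ext fun x => ?_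
      have hx : x = (id x : ℂ) • coordField q := (mul_one (id x : ℂ)).symm
      rw [hx, map_smul, h1, smul_zero]
      rfl
    · funext k
      rw [hτ]
      have h1 := hconst (Y v) r le_rfl (fun z hz => hY v z (hsub₁ hz)) k q hq
      rw [hY0] at h1
      rw [← h1]
      exact Finset.sum_congr rfl fun j _ => by rw [hσc q (hUb hq)]
  refine ⟨U, hUo, Metric.mem_ball_self hrpos, Module.finrank ℂ V, τ, fun q hq => ?_, hsurj, ?_⟩
  · have hs : Function.Surjective (τ q) := fun v => by
      obtain ⟨σ, _, h⟩ := hsurj v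
      exact ⟨σ q, h q hq⟩
    have eq : E q ≃ₗ[ℂ] V := e.linearEquivAt ℂ q (hUb hq)
    have : FiniteDimensional ℂ (E q) := Module.Finite.equiv eq.symm
    refine (LinearMap.injective_iff_surjective_of_finrank_eq_finrank ?_).mpr hs
    rw [eq.finrank_eq, Module.finrank_fin_fun]
  · intro σ U' hU' hq' hσ
    obtain ⟨ρ₁, hρ₁, hb₁⟩ := Metric.isOpen_iff.mp
      (puncturedDisc.isOpen.isOpenMap_subtype_val _ hU') _ ⟨q₀, hq', rfl⟩
    have hp : ∀ (q : puncturedDisc) j, coef j (discPoint q₀ q) (σ (discPoint q₀ q)) =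
        coef j q (σ q) := by
      intro q j
      have aux : ∀ p, p = q → coef j p (σ p) = coef j q (σ q) := by rintro _ rfl; rfl
      exact aux _ (discPoint_coe q₀ q)
    set ρ := min r ρ₁
    have hρ : 0 < ρ := lt_min hrpos hρ₁
    have hsol : ∀ z ∈ Metric.ball (q₀ : ℂ) ρ, ∀ i, HasDerivAt
        (fun z => coef i (discPoint q₀ z) (σ (discPoint q₀ z)))
        (∑ j, -B i j z * coef j (discPoint q₀ z) (σ (discPoint q₀ z))) z := by
      intro z hz i
      obtain ⟨q, hq, rfl⟩ := hb₁ (Metric.ball_subset_ball (min_le_right _ _) hz)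
      have hqU : q ∈ U := Metric.ball_subset_ball (min_le_left _ _) hz
      have hm := hσ.mdiff hU' hq
      have h := localFrameCoeff_conn D q₀ (hUb hqU) hm i
      rw [hσ.2 q hq] at h
      have hd := mdifferentiableAt_iff_discPoint q₀
        (mdifferentiableAt_localFrameCoeff (I := 𝓘(ℂ, ℂ)) (Module.finBasis ℂ V) (hUb hqU) hm i)
      refine hd.hasDerivAt.congr_deriv ?_
      simp only [zero_apply, map_zero] at h
      have h3 := eq_neg_of_add_eq_zero_right h.symm
      refine h3.trans ?_
      rw [← Finset.sum_neg_distrib]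
      refine Finset.sum_congr rfl fun j _ => ?_
      rw [hp]
      simp only [B, discPoint_coe, neg_mul]
      rfl
    have hkey := hconst (fun z i => coef i (discPoint q₀ z) (σ (discPoint q₀ z))) ρ (min_le_left _ _) hsol
    have hnear : ∀ᶠ q : puncturedDisc in 𝓝 q₀, (q : ℂ) ∈ Metric.ball (q₀ : ℂ) ρ :=
      continuous_subtype_val.continuousAt.eventually (Metric.ball_mem_nhds _ hρ)
    filter_upwards [hnear] with q hq
    funext k
    have h1 := hkey k q hq
    have h2 := hkey k q₀ (Metric.mem_ball_self hρ)
    simp only [hp] at h1 h2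
    rw [hτ, hτ, h1, h2]

end Bundle
end DegenerationHodge

/-! ### Analytic continuation; multivalued horizontal sections and fibers. -/

namespace DegenerationHodge

section Continuation

variable {Ω : Type*} [TopologicalSpace Ω] {G : Type*} [NormedAddCommGroup G] [NormedSpace ℝ G]
  {Y : Ω → Type*}

/-- Two sections that are flat on a preconnected set and agree at one of its points agree on it. -/
theorem eq_of_flat {Hor : (∀ w, Y w) → Ω → Prop}
    (huniq : ∀ s t z, Hor s z → Hor t z →
      (s z = t z → ∀ᶠ w in 𝓝 z, s w = t w) ∧ (s z ≠ t z → ∀ᶠ w in 𝓝 z, s w ≠ t w))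
    {U : Set Ω} (hU : IsPreconnected U) {s t : ∀ w, Y w} (hs : ∀ w ∈ U, Hor s w)
    (ht : ∀ w ∈ U, Hor t w) {z : Ω} (hz : z ∈ U) (hst : s z = t z) {w : Ω} (hw : w ∈ U) :
    s w = t w := by
  let A : Set Ω := interior {w | s w = t w}
  let B : Set Ω := interior {w | s w ≠ t w}
  have hA : ∀ w ∈ U, s w = t w → w ∈ A := fun w hw h =>
    mem_interior_iff_mem_nhds.mpr ((huniq s t w (hs w hw) (ht w hw)).1 h)
  have hB : ∀ w ∈ U, s w ≠ t w → w ∈ B := fun w hw h =>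
    mem_interior_iff_mem_nhds.mpr ((huniq s t w (hs w hw) (ht w hw)).2 h)
  by_contra hne
  obtain ⟨x, -, hxA, hxB⟩ := hU A B isOpen_interior isOpen_interior
    (fun w hw => by
      by_cases h : s w = t w
      exacts [Or.inl (hA w hw h), Or.inr (hB w hw h)])
    ⟨z, hz, hA z hz hst⟩ ⟨w, hw, hB w hw hne⟩
  exact (interior_subset (s := {w | s w ≠ t w}) hxB) (interior_subset (s := {w | s w = t w}) hxA)

/-- Analytic continuation: a local system on a convex open set has a global section through every
point. -/
theorem exists_flat_section {e : Ω → G} (he : Topology.IsOpenEmbedding e)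
    (hconv : Convex ℝ (Set.range e)) {Hor : (∀ w, Y w) → Ω → Prop}
    (hcongr : ∀ s t z, (∀ᶠ w in 𝓝 z, s w = t w) → Hor s z → Hor t z)
    (hex : ∀ z₀, ∃ U ∈ 𝓝 z₀, ∀ z ∈ U, ∀ y : Y z, ∃ s, s z = y ∧ ∀ w ∈ U, Hor s w)
    (huniq : ∀ s t z, Hor s z → Hor t z →
      (s z = t z → ∀ᶠ w in 𝓝 z, s w = t w) ∧ (s z ≠ t z → ∀ᶠ w in 𝓝 z, s w ≠ t w))
    (z₀ : Ω) (y : Y z₀) : ∃ s, s z₀ = y ∧ ∀ z, Hor s z := by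
  classical
  have hpre : ∀ C : Set G, Convex ℝ C → C ⊆ Set.range e → IsPreconnected (e ⁻¹' C) := by
    intro C hC hCr
    rw [← he.isInducing.isPreconnected_image, Set.image_preimage_eq_inter_range,
      Set.inter_eq_left.mpr hCr]
    exact hC.isPreconnected
  have key : ∀ z : Ω, ∃ C : Set G, IsOpen C ∧ Convex ℝ C ∧ C ⊆ Set.range e ∧ e z₀ ∈ C ∧ e z ∈ C ∧
      ∃ s, s z₀ = y ∧ ∀ w, e w ∈ C → Hor s w := by
    intro z
    choose U hU hUs using hex
    have hK : segment ℝ (e z₀) (e z) ⊆ Set.range e :=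
      hconv.segment_subset ⟨z₀, rfl⟩ ⟨z, rfl⟩
    have hKc : IsCompact (segment ℝ (e z₀) (e z)) := by
      rw [segment_eq_image_lineMap]
      exact isCompact_Icc.image (AffineMap.lineMap_continuous)
    obtain ⟨ε, hε, hleb⟩ := lebesgue_number_lemma_of_metric (c := fun w => e '' interior (U w)) hKc
      (fun w => he.isOpenMap _ isOpen_interior) (fun x hx => by
        obtain ⟨w, rfl⟩ := hK hx
        exact Set.mem_iUnion.mpr ⟨w, w, mem_interior_iff_mem_nhds.mpr (hU w), rfl⟩)
    let p : ℝ → G := AffineMap.lineMap (e z₀) (e z)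
    have hp : ∀ t ∈ Set.Icc (0 : ℝ) 1, p t ∈ segment ℝ (e z₀) (e z) := by
      intro t ht
      rw [segment_eq_image_lineMap]
      exact ⟨t, ht, rfl⟩
    have hseg : ∀ T : ℝ, 0 ≤ T → segment ℝ (e z₀) (p T) = p '' Set.Icc 0 T := by
      intro T hT
      have h := image_segment ℝ (AffineMap.lineMap (k := ℝ) (e z₀) (e z)) 0 T
      rw [AffineMap.lineMap_apply_zero, segment_eq_Icc hT] at h
      exact h.symm
    obtain ⟨n, hn⟩ := exists_nat_gt (dist (e z₀) (e z) / (ε / 2))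
    have hn0 : (0 : ℝ) < n := (by positivity : (0 : ℝ) ≤ _).trans_lt hn
    have hstep : ∀ k : ℕ, dist (p (k / n)) (p ((k + 1 : ℕ) / n)) < ε / 2 := by
      intro k
      rw [dist_lineMap_lineMap]
      have h1 : dist ((k : ℝ) / n) ((k + 1 : ℕ) / n) = 1 / n := by
        rw [Real.dist_eq, ← sub_div]
        push_cast
        rw [show (k : ℝ) - (k + 1) = -1 by ring, abs_div, abs_neg, abs_one, abs_of_pos hn0]
      rw [h1, one_div, inv_mul_lt_iff₀ hn0]
      rwa [div_lt_iff₀ (by positivity)] at hn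
    -- Neighbourhoods of initial pieces of the segment. They are convex, so `C k` meets the next
    -- ball in a connected set and the continuation across that ball is unambiguous. The width `ε /
    -- 2` with steps shorter than `ε / 2` makes `C (k + 1)` lie in the union of `C k` and one ball
    -- of radius `ε`.
    let C : ℕ → Set G := fun k => Metric.thickening (ε / 2) (segment ℝ (e z₀) (p (k / n)))
    have hCo : ∀ k, IsOpen (C k) := fun k => Metric.isOpen_thickening
    have hCc : ∀ k, Convex ℝ (C k) := fun k => (convex_segment _ _).thickening _
    have hself : ∀ k : ℕ, ∀ x ∈ segment ℝ (e z₀) (p (k / n)), x ∈ C k := fun k x hx =>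
      Metric.self_subset_thickening (by positivity) _ hx
    have hcell : ∀ k : ℕ, k ≤ n → ∃ V : Set Ω, e '' V = Metric.ball (p (k / n)) ε ∧
        ∀ w ∈ V, ∀ y : Y w, ∃ s, s w = y ∧ ∀ w ∈ V, Hor s w := by
      intro k hk
      obtain ⟨i, hi⟩ := hleb (p (k / n)) (hp _ ⟨by positivity, by
        rw [div_le_one hn0]; exact_mod_cast hk⟩)
      refine ⟨e ⁻¹' Metric.ball (p (k / n)) ε, ?_, ?_⟩
      · rw [Set.image_preimage_eq_inter_range, Set.inter_eq_left]
        exact hi.trans (Set.image_subset_range _ _)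
      · have hsub : e ⁻¹' Metric.ball (p (k / n)) ε ⊆ U i := by
          intro w hw
          obtain ⟨w', hw', h⟩ := hi hw
          exact he.injective h ▸ interior_subset hw'
        intro w hw y
        obtain ⟨s, hs, hs'⟩ := hUs i w (hsub hw) y
        exact ⟨s, hs, fun w hw => hs' w (hsub hw)⟩
    have hind : ∀ k : ℕ, k ≤ n → C k ⊆ Set.range e ∧
        ∃ s, s z₀ = y ∧ ∀ w, e w ∈ C k → Hor s w := by
      intro k
      induction k with
      | zero =>
        intro hk
        obtain ⟨V, hV, hVs⟩ := hcell 0 hk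
        have hC0 : C 0 ⊆ Metric.ball (p ((0 : ℕ) / n)) ε := by
          intro x hx
          obtain ⟨x', hx', hd⟩ := Metric.mem_thickening_iff.mp hx
          simp only [p, Nat.cast_zero, zero_div, AffineMap.lineMap_apply_zero, segment_same,
            Set.mem_singleton_iff] at hx' ⊢
          subst hx'
          exact hd.trans (by linarith)
        have hz : z₀ ∈ V := by
          have : e z₀ ∈ e '' V := by
            rw [hV]
            simp [p, hε]
          obtain ⟨w, hw, h⟩ := this
          exact he.injective h ▸ hw
        obtain ⟨s, hs, hs'⟩ := hVs z₀ hz y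
        refine ⟨hC0.trans (hV ▸ Set.image_subset_range _ _), s, hs, fun w hw => hs' w ?_⟩
        obtain ⟨w', hw', h⟩ := hV.symm ▸ hC0 hw
        exact he.injective h ▸ hw'
      | succ k ih =>
        intro hk
        obtain ⟨hCr, s, hs, hs'⟩ := ih (by omega)
        obtain ⟨V, hV, hVs⟩ := hcell k (by omega)
        have hVe : ∀ w, w ∈ V ↔ e w ∈ Metric.ball (p (k / n)) ε := fun w => by
          rw [← hV]; exact ⟨fun h => ⟨w, h, rfl⟩, fun ⟨w', hw', h⟩ => he.injective h ▸ hw'⟩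
        have hcov : C (k + 1) ⊆ C k ∪ Metric.ball (p (k / n)) ε := by
          intro x hx
          obtain ⟨x', hx', hd⟩ := Metric.mem_thickening_iff.mp hx
          rw [hseg _ (by positivity)] at hx'
          obtain ⟨t, ⟨ht0, ht1⟩, rfl⟩ := hx'
          rcases le_total t (k / n) with h | h
          · refine Or.inl (Metric.mem_thickening_iff.mpr ⟨p t, ?_, hd⟩)
            rw [hseg _ (by positivity)]
            exact ⟨t, ⟨ht0, h⟩, rfl⟩
          · right
            have h5 : dist (p t) (p (k / n)) ≤ dist (p (k / n)) (p ((k + 1 : ℕ) / n)) := by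
              rw [dist_comm, dist_lineMap_lineMap, dist_lineMap_lineMap, Real.dist_eq,
                Real.dist_eq, abs_sub_comm, abs_of_nonneg (sub_nonneg.mpr h), abs_sub_comm,
                abs_of_nonneg (sub_nonneg.mpr (h.trans ht1))]
              gcongr
            calc dist x (p (k / n)) ≤ dist x (p t) + dist (p t) (p (k / n)) := dist_triangle _ _ _
              _ < ε / 2 + ε / 2 := add_lt_add_of_lt_of_le hd (h5.trans (hstep k).le)
              _ = ε := by ring
        have hmid : p (k / n) ∈ C k := hself k _ (right_mem_segment _ _ _)
        obtain ⟨m, hm⟩ := hCr hmid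
        have hmV : m ∈ V := by rw [hVe, hm]; exact Metric.mem_ball_self hε
        obtain ⟨s', hsm, hs''⟩ := hVs m hmV (s m)
        have hagree : ∀ w ∈ V, e w ∈ C k → s w = s' w := by
          intro w hw hw'
          refine eq_of_flat huniq (U := e ⁻¹' (C k ∩ Metric.ball (p (k / n)) ε))
            (hpre _ ((hCc k).inter (convex_ball _ _)) (Set.inter_subset_left.trans hCr))
            (fun w hw => hs' w hw.1) (fun w hw => hs'' w ((hVe w).mpr hw.2))
            (z := m) ⟨hm ▸ hmid, hm ▸ Metric.mem_ball_self hε⟩ hsm.symm ⟨hw', (hVe w).mp hw⟩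
        refine ⟨hcov.trans (Set.union_subset hCr (hV ▸ Set.image_subset_range _ _)),
          fun w => if e w ∈ C k then s w else s' w, ?_, ?_⟩
        · have : e z₀ ∈ C k := hself k _ (left_mem_segment _ _ _)
          exact (if_pos this).trans hs
        · intro w hw
          by_cases hwk : e w ∈ C k
          · refine hcongr s _ w ?_ (hs' w hwk)
            filter_upwards [he.continuous.continuousAt.preimage_mem_nhds
              ((hCo k).mem_nhds hwk)] with w' hw'
            exact (if_pos hw').symm
          · have hwV : w ∈ V := (hVe w).mpr ((hcov hw).resolve_left hwk)
            refine hcongr s' _ w ?_ (hs'' w hwV)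
            filter_upwards [he.continuous.continuousAt.preimage_mem_nhds
              (Metric.isOpen_ball.mem_nhds ((hVe w).mp hwV))] with w' hw'
            split_ifs with h
            · exact (hagree w' ((hVe w').mpr hw') h).symm
            · rfl
    obtain ⟨h1, h2⟩ := hind n le_rfl
    refine ⟨C n, hCo n, hCc n, h1, hself n _ (left_mem_segment _ _ _), hself n _ ?_, h2⟩
    have : p ((n : ℝ) / n) = e z := by
      rw [div_self hn0.ne']
      simp [p]
    rw [this]
    exact right_mem_segment _ _ _
  choose C hCo hCc hCr hC0 hC1 s hs hs' using key
  -- Continuations along two segments from `z₀` agree on the intersection of their convex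
  -- neighbourhoods, since it is connected and contains `e z₀`. So the endpoint values fit together
  -- to a flat section.
  have hagree : ∀ z w, e w ∈ C z → s w w = s z w := by
    intro z w hw
    exact eq_of_flat huniq (U := e ⁻¹' (C z ∩ C w))
      (hpre _ ((hCc z).inter (hCc w)) (Set.inter_subset_left.trans (hCr z)))
      (fun w' h => hs' w w' h.2) (fun w' h => hs' z w' h.1) (z := z₀) ⟨hC0 z, hC0 w⟩
      ((hs w).trans (hs z).symm) ⟨hw, hC1 w⟩
  refine ⟨fun z => s z z, hs z₀, fun z => hcongr (s z) _ z ?_ (hs' z z (hC1 z))⟩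
  filter_upwards [he.continuous.continuousAt.preimage_mem_nhds ((hCo z).mem_nhds (hC1 z))]
    with w hw
  exact (hagree z w hw).symm

end Continuation

section Bundle

set_option linter.unusedSectionVars false

variable {V : Type*} [NormedAddCommGroup V] [NormedSpace ℂ V] [FiniteDimensional ℂ V]
  {E : puncturedDisc → Type*}
  [∀ q, AddCommGroup (E q)] [∀ q, Module ℂ (E q)] [∀ q, TopologicalSpace (E q)]
  [∀ q, IsTopologicalAddGroup (E q)] [∀ q, ContinuousSMul ℂ (E q)]
  [TopologicalSpace (TotalSpace V E)] [FiberBundle V E] [VectorBundle ℂ V E]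
  [ContMDiffVectorBundle ω V E 𝓘(ℂ, ℂ)]

theorem continuous_unif : Continuous unif := by
  refine Continuous.subtype_mk ?_ _
  exact Complex.continuous_exp.comp (continuous_const.mul UpperHalfPlane.continuous_coe)

/-- A section of the pullback to the upper half plane is flat at `z`. -/
def IsFlatAt (D : RealFlatConnection V E) (s : ∀ z : UpperHalfPlane, E (unif z))
    (z : UpperHalfPlane) : Prop :=
  ∃ U : Set puncturedDisc, IsOpen U ∧ unif z ∈ U ∧
    ∃ σ : ∀ q, E q, IsHorizontalOn D.conn σ U ∧ ∀ᶠ w in 𝓝 z, s w = σ (unif w)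

theorem IsFlatAt.congr {D : RealFlatConnection V E} {s t : ∀ z : UpperHalfPlane, E (unif z)}
    {z : UpperHalfPlane} (h : ∀ᶠ w in 𝓝 z, s w = t w) (hs : IsFlatAt D s z) : IsFlatAt D t z := by
  obtain ⟨U, hU, hz, σ, hσ, hsσ⟩ := hs
  refine ⟨U, hU, hz, σ, hσ, ?_⟩
  filter_upwards [h, hsσ] with w h1 h2
  rw [← h1, h2]

theorem exists_isFlatAt (D : RealFlatConnection V E) (z₀ : UpperHalfPlane) :
    ∃ U ∈ 𝓝 z₀, ∀ z ∈ U, ∀ y : E (unif z), ∃ s, s z = y ∧ ∀ w ∈ U, IsFlatAt D s w := by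
  obtain ⟨U, hU, hz, n, τ, hinj, hsurj, -⟩ := exists_flat_coordinates D (unif z₀)
  refine ⟨unif ⁻¹' U, continuous_unif.continuousAt.preimage_mem_nhds (hU.mem_nhds hz), ?_⟩
  intro z hz y
  obtain ⟨σ, hσ, hσ'⟩ := hsurj (τ _ y)
  refine ⟨fun w => σ (unif w), hinj _ hz (hσ' _ hz), fun w hw => ?_⟩
  exact ⟨U, hU, hw, σ, hσ, .of_forall fun _ => rfl⟩

/-- In flat coordinates both sections are locally constant, so agreement and disagreement at a point
both spread to a neighbourhood. -/
theorem IsFlatAt.eventually_eq_or_ne {D : RealFlatConnection V E}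
    {s t : ∀ z : UpperHalfPlane, E (unif z)} {z : UpperHalfPlane} (hs : IsFlatAt D s z)
    (ht : IsFlatAt D t z) :
    (s z = t z → ∀ᶠ w in 𝓝 z, s w = t w) ∧ (s z ≠ t z → ∀ᶠ w in 𝓝 z, s w ≠ t w) := by
  obtain ⟨U, hU, hz, n, τ, hinj, -, hloc⟩ := exists_flat_coordinates D (unif z)
  have key : ∀ s, IsFlatAt D s z → ∀ᶠ w in 𝓝 z, τ _ (s w) = τ _ (s z) := by
    rintro s ⟨U', hU', hz', σ, hσ, hsσ⟩
    have h1 := continuous_unif.continuousAt.eventually (hloc σ U' hU' hz' hσ)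
    filter_upwards [h1, hsσ] with w h2 h3
    rw [h3, h2, hsσ.self_of_nhds]
  constructor <;> intro h <;>
    filter_upwards [key s hs, key t ht, continuous_unif.continuousAt.preimage_mem_nhds
      (hU.mem_nhds hz)] with w h1 h2 hw
  · exact hinj _ hw (by rw [h1, h2, h])
  · intro h3
    exact h (hinj _ hz (by rw [← h1, ← h2, h3]))

/-- The upper half plane is convex: connectedness gives uniqueness of a flat section with given
value, and continuation along segments gives existence. -/
theorem evalAt_bijective (D : RealFlatConnection V E) (q : puncturedDisc)
    (z : {z : UpperHalfPlane // unif z = q}) : Function.Bijective (evalAt D q z) := by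
  obtain ⟨z, rfl⟩ := z
  have hflat : ∀ s : horizontalSections D, ∀ z, IsFlatAt D (fun z => s.1 (unif z) ⟨z, rfl⟩) z :=
    fun s z => s.2 z
  have hconv : Convex ℝ (Set.range ((↑) : UpperHalfPlane → ℂ)) := by
    rw [UpperHalfPlane.range_coe]
    exact convex_halfSpace_im_gt 0
  have hpre : IsPreconnected (Set.univ : Set UpperHalfPlane) := by
    rw [← UpperHalfPlane.isOpenEmbedding_coe.isInducing.isPreconnected_image, Set.image_univ]
    exact hconv.isPreconnected
  constructor
  · rw [injective_iff_map_eq_zero]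
    intro s hs
    apply Subtype.ext
    funext q w
    obtain ⟨w, rfl⟩ := w
    exact eq_of_flat (fun _ _ _ => IsFlatAt.eventually_eq_or_ne) hpre (fun w _ => hflat s w)
      (fun w _ => hflat 0 w) (Set.mem_univ z) hs (Set.mem_univ w)
  · intro y
    obtain ⟨s, hs, hs'⟩ := exists_flat_section UpperHalfPlane.isOpenEmbedding_coe hconv
      (fun _ _ _ => IsFlatAt.congr (D := D)) (exists_isFlatAt D)
      (fun _ _ _ => IsFlatAt.eventually_eq_or_ne) z y
    exact ⟨⟨fun q w => w.2 ▸ s w.1, fun z => hs' z⟩, hs⟩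

end Bundle
end DegenerationHodge

/-! ### Strings: bases adapted to the Hodge and the weight filtration. -/

namespace DegenerationHodge

section Strings

set_option linter.unusedSectionVars false

variable {X : Type*} [AddCommGroup X] [Module ℂ X]

/-- The subspace of `W_k` containing `W_{k-1}` that corresponds to `grInd W k A`. -/
def grLayer (W : ℤ → Submodule ℂ X) (A : Submodule ℂ X) (k : ℤ) : Submodule ℂ X :=
  A ⊓ W k ⊔ W (k - 1)

/-- Two filtrations `F`, `F'` that are opposed on the graded pieces of the monodromy weight
filtration `W` of `N`, and shifted by `N`. -/
structure IsOpposedTriple (N : Module.End ℂ X) (d : ℤ) (W F F' : ℤ → Submodule ℂ X) : Prop where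
  mono : Monotone W
  bot : ∃ k, W k = ⊥
  top : ∃ k, W k = ⊤
  anti : Antitone F
  hodge_top : ∃ p, F p = ⊤
  hodge_bot : ∃ p, F p = ⊥
  anti' : Antitone F'
  sup : ∀ k p, W k ≤ grLayer W (F p) k ⊔ grLayer W (F' (k - p + 1)) k
  inf : ∀ k p, grLayer W (F p) k ⊓ grLayer W (F' (k - p + 1)) k ≤ W (k - 1)
  shift : ∀ i, ∀ x ∈ W i, N x ∈ W (i - 2)
  hodge : ∀ p, ∀ x ∈ F p, N x ∈ F (p - 1)
  hodge' : ∀ p, ∀ x ∈ F' p, N x ∈ F' (p - 1)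
  inj : ∀ l : ℕ, ∀ u ∈ W (d + l), (N ^ l) u ∈ W (d - l - 1) → u ∈ W (d + l - 1)
  surj : ∀ l : ℕ, ∀ v ∈ W (d - l), ∃ u ∈ W (d + l), v - (N ^ l) u ∈ W (d - l - 1)

/-- The subspace of `W_k` containing `W_{k-1}` that corresponds to the `(a, k-a)`-component of
`Gr^W_k`. -/
def typeComp (W F F' : ℤ → Submodule ℂ X) (a k : ℤ) : Submodule ℂ X :=
  grLayer W (F a) k ⊓ grLayer W (F' (k - a)) k

variable {N : Module.End ℂ X} {d : ℤ} {W F F' : ℤ → Submodule ℂ X}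

theorem le_grLayer (W : ℤ → Submodule ℂ X) (A : Submodule ℂ X) (k : ℤ) :
    W (k - 1) ≤ grLayer W A k := le_sup_right

theorem grLayer_le (hW : Monotone W) (A : Submodule ℂ X) (k : ℤ) : grLayer W A k ≤ W k :=
  sup_le inf_le_right (hW (by omega))

theorem grLayer_mono {A B : Submodule ℂ X} (h : A ≤ B) (k : ℤ) : grLayer W A k ≤ grLayer W B k :=
  sup_le_sup_right (inf_le_inf_right _ h) _

theorem map_grLayer (hW : ∀ i, ∀ x ∈ W i, N x ∈ W (i - 2)) {A B : Submodule ℂ X}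
    (h : ∀ x ∈ A, N x ∈ B) {k : ℤ} {x : X} (hx : x ∈ grLayer W A k) :
    N x ∈ grLayer W B (k - 2) := by
  obtain ⟨y, ⟨hy, hy'⟩, w, hw, rfl⟩ := Submodule.mem_sup.mp hx
  rw [map_add]
  refine Submodule.add_mem_sup ⟨h y hy, hW _ y hy'⟩ ?_
  have := hW _ w hw
  rwa [show k - 1 - 2 = k - 2 - 1 by ring] at this

namespace IsOpposedTriple

variable (h : IsOpposedTriple N d W F F')
include h

theorem le_typeComp (a k : ℤ) : W (k - 1) ≤ typeComp W F F' a k :=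
  le_inf (le_grLayer _ _ _) (le_grLayer _ _ _)

theorem typeComp_le (a k : ℤ) : typeComp W F F' a k ≤ W k :=
  inf_le_left.trans (grLayer_le h.mono _ _)

theorem map_typeComp {a k : ℤ} {x : X} (hx : x ∈ typeComp W F F' a k) :
    N x ∈ typeComp W F F' (a - 1) (k - 2) := by
  refine ⟨map_grLayer h.shift (h.hodge a) hx.1, ?_⟩
  have := map_grLayer h.shift (h.hodge' (k - a)) hx.2
  rwa [show k - a - 1 = k - 2 - (a - 1) by ring] at this

theorem pow_map_typeComp (m : ℕ) {a k : ℤ} {x : X} (hx : x ∈ typeComp W F F' a k) :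
    (N ^ m) x ∈ typeComp W F F' (a - m) (k - 2 * m) := by
  induction m with
  | zero => simpa using hx
  | succ m ih =>
    have := h.map_typeComp ih
    rw [pow_succ', Module.End.mul_apply]
    convert this using 2 <;> push_cast <;> ring

/-- Opposedness at `p + 1` splits off a summand in the layers of both `F p` and `F' (k - p)`, hence
of type `(p, k - p)`. What remains lies in the layer of `F (p + 1)`, and the process stops because
`F` is finite. -/
theorem exists_sum_typeComp (k p : ℤ) {u : X} (hu : u ∈ grLayer W (F p) k) :
    ∃ (s : Finset ℤ) (f : ℤ → X), (∀ a ∈ s, p ≤ a) ∧ (∀ a, f a ∈ typeComp W F F' a k) ∧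
      u = ∑ a ∈ s, f a := by
  obtain ⟨p₁, hp₁⟩ := h.hodge_bot
  obtain ⟨n, hn⟩ : ∃ n : ℕ, p₁ - p ≤ n := ⟨(p₁ - p).toNat, Int.self_le_toNat _⟩
  induction n generalizing p u with
  | zero =>
    refine ⟨{p}, fun a => if a = p then u else 0, by simp, fun a => ?_, by simp⟩
    have hF : F p = ⊥ := le_bot_iff.mp (hp₁ ▸ h.anti (by push_cast at hn; omega))
    dsimp only
    split_ifs with ha
    · subst ha
      apply h.le_typeComp
      simpa [grLayer, hF] using hu
    · exact zero_mem _
  | succ n ih =>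
    have hk := h.sup k (p + 1) (grLayer_le h.mono _ _ hu)
    obtain ⟨u', hu', u'', hu'', rfl⟩ := Submodule.mem_sup.mp hk
    obtain ⟨s, f, hs, hf, hsum⟩ := ih (p + 1) hu' (by push_cast at hn; omega)
    rw [show k - (p + 1) + 1 = k - p by ring] at hu''
    have hps : p ∉ s := fun hp => by have := hs p hp; omega
    refine ⟨insert p s, fun a => if a = p then u'' else f a, ?_, fun a => ?_, ?_⟩
    · intro a ha
      rcases Finset.mem_insert.mp ha with rfl | ha
      · rfl
      · have := hs a ha; omega
    · dsimp only
      split_ifs with ha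
      · subst ha
        refine ⟨?_, hu''⟩
        have h1 := grLayer_mono (W := W) (h.anti (show a ≤ a + 1 by omega)) k hu'
        have := sub_mem hu h1
        rwa [add_sub_cancel_left] at this
      · exact hf a
    · rw [Finset.sum_insert hps, if_pos rfl, add_comm, hsum]
      congr 1
      exact Finset.sum_congr rfl fun a ha => by
        rw [if_neg (fun e : a = p => hps (e ▸ ha))]

/-- Directness of the Hodge decomposition of `Gr^W_k`: modulo `W (k - 1)` the term of smallest type
is minus a sum of terms of larger type, so it lies in two opposed layers. The shift `e` allows for
images under `N ^ e`, which lowers types by `e`. -/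
theorem mem_of_sum_typeComp_mem (e k : ℤ) (s : Finset ℤ) {f : ℤ → X}
    (hf : ∀ a ∈ s, f a ∈ typeComp W F F' (a - e) k) (hs : ∑ a ∈ s, f a ∈ W (k - 1)) :
    ∀ a ∈ s, f a ∈ W (k - 1) := by
  induction s using Finset.induction_on_min with
  | empty => simp
  | insert a s ha ih =>
    have has : a ∉ s := fun hh => lt_irrefl _ (ha a hh)
    rw [Finset.sum_insert has] at hs
    have h1 : ∑ x ∈ s, f x ∈ grLayer W (F (a - e + 1)) k := by
      refine Submodule.sum_mem _ fun x hx => ?_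
      refine grLayer_mono (h.anti ?_) k (hf x (Finset.mem_insert_of_mem hx)).1
      have := ha x hx; omega
    have h2 : f a ∈ W (k - 1) := by
      refine h.inf k (a - e + 1) ⟨?_, ?_⟩
      · have := sub_mem (le_grLayer W (F (a - e + 1)) k hs) h1
        rwa [add_sub_cancel_right] at this
      · rw [show k - (a - e + 1) + 1 = k - (a - e) by ring]
        exact (hf a (Finset.mem_insert_self _ _)).2
    have h3 : ∑ x ∈ s, f x ∈ W (k - 1) := by
      have := sub_mem hs h2
      rwa [add_sub_cancel_left] at this
    intro x hx
    rcases Finset.mem_insert.mp hx with rfl | hx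
    · exact h2
    · exact ih (fun a ha => hf a (Finset.mem_insert_of_mem ha)) h3 x hx

/-- As `N ^ l` respects the decomposition into types, the component of type `a` of any preimage
already does the job. -/
theorem surj_typeComp (l : ℕ) {a : ℤ} {v : X} (hv : v ∈ typeComp W F F' (a - l) (d - l)) :
    ∃ u ∈ typeComp W F F' a (d + l), v - (N ^ l) u ∈ W (d - l - 1) := by
  obtain ⟨u, hu, huv⟩ := h.surj l v (h.typeComp_le _ _ hv)
  obtain ⟨p₀, hp₀⟩ := h.hodge_top
  obtain ⟨s, f, -, hf, rfl⟩ := h.exists_sum_typeComp (d + l) p₀ (u := u) (by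
    rw [grLayer, hp₀, top_inf_eq]; exact Submodule.mem_sup_left hu)
  let g : ℤ → X := fun x => (if x = a then v else 0) - (N ^ l) (if x ∈ s then f x else 0)
  have hg : ∀ x ∈ insert a s, g x ∈ typeComp W F F' (x - l) (d - l) := by
    intro x _
    refine sub_mem ?_ ?_
    · split_ifs with hx
      · exact hx ▸ hv
      · exact zero_mem _
    · split_ifs with hx
      · have := h.pow_map_typeComp l (hf x)
        rwa [show d + (l : ℤ) - 2 * l = d - l by ring] at this
      · rw [map_zero]; exact zero_mem _
  have hsum : ∑ x ∈ insert a s, g x ∈ W (d - l - 1) := by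
    rw [map_sum] at huv
    rw [Finset.sum_sub_distrib, Finset.sum_ite_eq' (insert a s) a, if_pos (Finset.mem_insert_self _ _)]
    convert huv using 2
    rw [← Finset.sum_subset (Finset.subset_insert a s) (fun x _ hx => by rw [if_neg hx, map_zero])]
    exact Finset.sum_congr rfl fun x hx => by rw [if_pos hx]
  have := h.mem_of_sum_typeComp_mem l (d - l) _ hg hsum a (Finset.mem_insert_self _ _)
  refine ⟨if a ∈ s then f a else 0, ?_, by simpa [g] using this⟩
  split_ifs
  · exact hf a
  · exact zero_mem _

/-- The Lefschetz decomposition of a component of `Gr^W_{d+l}`. -/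
theorem exists_primitive_add (l : ℕ) {a : ℤ} {u : X} (hu : u ∈ typeComp W F F' a (d + l)) :
    ∃ p ∈ typeComp W F F' a (d + l), ∃ u' ∈ typeComp W F F' (a + 1) (d + l + 2),
      (N ^ (l + 1)) p ∈ W (d - l - 3) ∧ u = p + N u' := by
  have h1 := h.pow_map_typeComp (l + 1) hu
  have e1 : a - ((l + 1 : ℕ) : ℤ) = a + 1 - ((l + 2 : ℕ) : ℤ) := by push_cast; ring
  have e2 : d + (l : ℤ) - 2 * ((l + 1 : ℕ) : ℤ) = d - ((l + 2 : ℕ) : ℤ) := by push_cast; ring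
  rw [e1, e2] at h1
  -- `N ^ (l + 1) u` has weight `d - (l + 2)`, hence modulo lower weight it is `N ^ (l + 2) u'` with
  -- `u'` of weight `d + l + 2`. Subtracting `N u'` from `u` makes the class primitive.
  obtain ⟨u', hu', h2⟩ := h.surj_typeComp (l + 2) h1
  have e3 : d + ((l + 2 : ℕ) : ℤ) = d + l + 2 := by push_cast; ring
  rw [e3] at hu'
  refine ⟨u - N u', sub_mem hu ?_, u', hu', ?_, by abel⟩
  · have := h.map_typeComp hu'
    rwa [show a + 1 - 1 = a by ring, show d + (l : ℤ) + 2 - 2 = d + l by ring] at this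
  · rw [map_sub, ← Module.End.mul_apply, ← pow_succ]
    convert h2 using 2
    push_cast; ring

end IsOpposedTriple

/-- A family of lifts `v σ` of bases of the components of the primitive parts of `Gr^W`; `v σ` has
type `(A σ, d + l σ - A σ)`. -/
structure IsStringFamily (N : Module.End ℂ X) (d : ℤ) (W F F' : ℤ → Submodule ℂ X)
    {ι : Type*} [Fintype ι] (A : ι → ℤ) (l : ι → ℕ) (v : ι → X) : Prop where
  mem : ∀ σ, v σ ∈ F (A σ)
  weight : ∀ σ, v σ ∈ W (d + l σ)
  mem' : ∀ σ, v σ ∈ grLayer W (F' (d + l σ - A σ)) (d + l σ)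
  pow : ∀ σ, (N ^ (l σ + 1)) (v σ) ∈ W (d - l σ - 3)
  span : ∀ (a : ℤ) (m : ℕ) (u : X), u ∈ typeComp W F F' a (d + m) →
    (N ^ (m + 1)) u ∈ W (d - m - 3) →
      u ∈ Submodule.span ℂ (v '' {σ | A σ = a ∧ l σ = m}) ⊔ W (d + m - 1)
  indep : ∀ (a : ℤ) (m : ℕ) (c : ι → ℂ),
    ∑ σ with A σ = a ∧ l σ = m, c σ • v σ ∈ W (d + m - 1) → ∀ σ, A σ = a → l σ = m → c σ = 0

namespace IsStringFamily

variable {ι : Type*} [Fintype ι] {A : ι → ℤ} {l : ι → ℕ} {v : ι → X}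

theorem pow_weight (h : IsOpposedTriple N d W F F') (hs : IsStringFamily N d W F F' A l v) (σ : ι)
    (j : ℕ) : (N ^ j) (v σ) ∈ W (d + l σ - 2 * j) :=
  pow_shift h.shift j _ _ (hs.weight σ)

/-- Primitivity holds in the graded space only: past its end a string need not vanish, but it loses
one weight more than expected. That loss makes these terms negligible after rescaling. -/
theorem pow_weight_of_lt (h : IsOpposedTriple N d W F F') (hs : IsStringFamily N d W F F' A l v)
    (σ : ι) {j : ℕ} (hj : l σ < j) : (N ^ j) (v σ) ∈ W (d + l σ - 2 * j - 1) := by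
  obtain ⟨i, rfl⟩ := Nat.exists_eq_add_of_le (Nat.succ_le_of_lt hj)
  have := pow_shift h.shift i _ _ (hs.pow σ)
  rw [Nat.succ_eq_add_one, add_comm (l σ + 1), pow_add, Module.End.mul_apply]
  convert this using 2
  push_cast; ring

theorem pow_hodge (h : IsOpposedTriple N d W F F') (hs : IsStringFamily N d W F F' A l v) (σ : ι)
    (j : ℕ) : (N ^ j) (v σ) ∈ F (A σ - j) := by
  induction j with
  | zero => simpa using hs.mem σ
  | succ j ih =>
    rw [pow_succ', Module.End.mul_apply]
    convert h.hodge _ _ ih using 2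
    push_cast; ring

/-- The vectors `N^j v_σ` of type `(a, k-a)`. -/
def layerVectors (N : Module.End ℂ X) (d : ℤ) (A : ι → ℤ) (l : ι → ℕ) (v : ι → X) (a k : ℤ) :
    Set X :=
  {x | ∃ σ, ∃ j : ℕ, j ≤ l σ ∧ A σ - j = a ∧ d + l σ - 2 * j = k ∧ x = (N ^ j) (v σ)}

/-- The hypothesis `hl` says that `N ^ i` pushes no vector of weight `k'` past the end of its
string, so string vectors go to string vectors. -/
theorem pow_mem_span {a k a' k' : ℤ} {i : ℕ} (hW : ∀ i, ∀ x ∈ W i, N x ∈ W (i - 2))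
    (ha : a' - i = a) (hk : k' - 2 * i = k)
    (hl : ∀ σ, ∀ j : ℕ, j ≤ l σ → d + l σ - 2 * j = k' → j + i ≤ l σ) {u : X}
    (hu : u ∈ Submodule.span ℂ (layerVectors N d A l v a' k') ⊔ W (k' - 1)) :
    (N ^ i) u ∈ Submodule.span ℂ (layerVectors N d A l v a k) ⊔ W (k - 1) := by
  obtain ⟨y, hy, w, hw, rfl⟩ := Submodule.mem_sup.mp hu
  rw [map_add]
  refine Submodule.add_mem_sup ?_ ?_
  · have h1 := Submodule.mem_map_of_mem (f := (N ^ i)) hy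
    rw [Submodule.map_span] at h1
    refine Submodule.span_mono ?_ h1
    rintro _ ⟨_, ⟨σ, j, hj, h2, h3, rfl⟩, rfl⟩
    refine ⟨σ, i + j, by rw [add_comm]; exact hl σ j hj h3, ?_, ?_, ?_⟩
    · push_cast; omega
    · push_cast; omega
    · rw [pow_add, Module.End.mul_apply]
  · have := pow_shift hW i _ _ hw
    rwa [show k' - 1 - 2 * (i : ℤ) = k - 1 by omega] at this

/-- In weights at least `d` this is the Lefschetz decomposition, by descending induction on the
weight. Weights `d - m` are reached from `d + m` by `N ^ m`. -/
theorem typeComp_le_span (h : IsOpposedTriple N d W F F') (hs : IsStringFamily N d W F F' A l v)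
    (a k : ℤ) : typeComp W F F' a k ≤
      Submodule.span ℂ (layerVectors N d A l v a k) ⊔ W (k - 1) := by
  obtain ⟨K, hK⟩ := h.top
  have hpos : ∀ (m : ℕ) (a : ℤ), typeComp W F F' a (d + m) ≤
      Submodule.span ℂ (layerVectors N d A l v a (d + m)) ⊔ W (d + m - 1) := by
    intro m a
    obtain ⟨n, hn⟩ : ∃ n : ℕ, K - (d + m) < n := ⟨(K - (d + m)).toNat + 1, by omega⟩
    induction n generalizing m a with
    | zero =>
      have : W (d + m - 1) = ⊤ := top_le_iff.mp (hK ▸ h.mono (by push_cast at hn; omega))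
      rw [this, sup_top_eq]; exact le_top
    | succ n ih =>
      intro u hu
      obtain ⟨p, hp, u', hu', hpN, rfl⟩ := h.exists_primitive_add m hu
      refine add_mem ?_ ?_
      · refine (sup_le_sup_right (Submodule.span_mono ?_) (W (d + m - 1)) : _ ≤ _)
          (hs.span a m p hp hpN)
        rintro _ ⟨σ, ⟨h1, h2⟩, rfl⟩
        exact ⟨σ, 0, Nat.zero_le _, by simpa using h1, by simp [h2], by simp⟩
      · have e : d + (m : ℤ) + 2 = d + ((m + 2 : ℕ) : ℤ) := by push_cast; ring
        rw [e] at hu'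
        have h1 := ih (m + 2) (a + 1) (by push_cast at hn ⊢; omega) hu'
        have h2 := pow_mem_span (i := 1) (a := a) (k := d + m) h.shift (by simp)
          (by push_cast; ring) (fun σ j _ h3 => by push_cast at h3; omega) h1
        simpa using h2
  rcases le_total d k with hk | hk
  · obtain ⟨m, rfl⟩ := Int.le.dest hk
    exact hpos m a
  · obtain ⟨m, hm⟩ := Int.le.dest hk
    obtain rfl : k = d - m := by omega
    intro u hu
    obtain ⟨u', hu', h1⟩ := h.surj_typeComp (a := a + m) m (by simpa using hu)
    have h2 := pow_mem_span (i := m) (a := a) (k := d - m) h.shift (by ring)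
      (by ring) (fun σ j _ h3 => by omega) (hpos m _ hu')
    have := add_mem h2 (Submodule.mem_sup_right h1)
    rwa [add_sub_cancel] at this

/-- The vectors `N^j v_σ` are adapted to the filtrations `F` and `W`. -/
theorem inf_le_span (h : IsOpposedTriple N d W F F') (hs : IsStringFamily N d W F F' A l v)
    (p k : ℤ) : F p ⊓ W k ≤ Submodule.span ℂ
      {x | ∃ σ, ∃ j : ℕ, j ≤ l σ ∧ p ≤ A σ - j ∧ d + l σ - 2 * j ≤ k ∧ x = (N ^ j) (v σ)} := by
  obtain ⟨K, hK⟩ := h.bot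
  obtain ⟨n, hn⟩ : ∃ n : ℕ, k - K ≤ n := ⟨(k - K).toNat, Int.self_le_toNat _⟩
  induction n generalizing k with
  | zero =>
    have : W k = ⊥ := le_bot_iff.mp (hK ▸ h.mono (by push_cast at hn; omega))
    rw [this, inf_bot_eq]; exact bot_le
  | succ n ih =>
    rintro u ⟨hup, huk⟩
    obtain ⟨s, f, hsp, hf, hu⟩ := h.exists_sum_typeComp k p (u := u)
      (Submodule.mem_sup_left ⟨hup, huk⟩)
    set T := Submodule.span ℂ
      {x | ∃ σ, ∃ j : ℕ, j ≤ l σ ∧ p ≤ A σ - j ∧ d + l σ - 2 * j = k ∧ x = (N ^ j) (v σ)} with hT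
    have h1 : u ∈ T ⊔ W (k - 1) := by
      rw [hu]
      refine Submodule.sum_mem _ fun a ha => ?_
      refine (sup_le_sup_right (Submodule.span_mono ?_) (W (k - 1)) : _ ≤ _)
        (hs.typeComp_le_span h a k (hf a))
      rintro _ ⟨σ, j, hj, h2, h3, rfl⟩
      exact ⟨σ, j, hj, h2 ▸ hsp a ha, h3, rfl⟩
    obtain ⟨y, hy, w, hw, rfl⟩ := Submodule.mem_sup.mp h1
    -- The leading part is in `F p` itself, not only modulo lower weight. So the remainder stays in
    -- `F p` while its weight drops, which gives adaptedness to both filtrations at once.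
    have hTF : T ≤ F p := by
      rw [hT, Submodule.span_le]
      rintro _ ⟨σ, j, hj, h2, h3, rfl⟩
      exact h.anti h2 (hs.pow_hodge h σ j)
    have hwF : w ∈ F p := by
      have := sub_mem hup (hTF hy)
      rwa [add_sub_cancel_left] at this
    refine add_mem ?_ ?_
    · refine Submodule.span_mono ?_ hy
      rintro _ ⟨σ, j, hj, h2, h3, rfl⟩
      exact ⟨σ, j, hj, h2, h3.le, rfl⟩
    · refine Submodule.span_mono ?_ (ih (k - 1) (by push_cast at hn ⊢; omega) ⟨hwF, hw⟩)
      rintro _ ⟨σ, j, hj, h2, h3, rfl⟩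
      exact ⟨σ, j, hj, h2, by omega, rfl⟩

/-- Sorting the strings of length `m` by type reduces to `indep`, since the type components of a
graded piece are independent. -/
theorem indep_weight (h : IsOpposedTriple N d W F F') (hs : IsStringFamily N d W F F' A l v)
    (m : ℕ) (c : ι → ℂ) (hc : ∑ σ with l σ = m, c σ • v σ ∈ W (d + m - 1)) :
    ∀ σ, l σ = m → c σ = 0 := by
  classical
  intro σ hσ
  let s : Finset ℤ := Finset.univ.image A
  let f : ℤ → X := fun a => ∑ σ with A σ = a ∧ l σ = m, c σ • v σ
  have hf : ∀ a ∈ s, f a ∈ typeComp W F F' (a - 0) (d + m) := by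
    intro a _
    rw [sub_zero]
    refine Submodule.sum_mem _ fun τ hτ => Submodule.smul_mem _ _ ?_
    obtain ⟨h1, h2⟩ := (Finset.mem_filter.mp hτ).2
    subst h1 h2
    exact ⟨Submodule.mem_sup_left ⟨hs.mem τ, hs.weight τ⟩, hs.mem' τ⟩
  have hsum : ∑ a ∈ s, f a ∈ W (d + m - 1) := by
    convert hc using 1
    rw [← Finset.sum_fiberwise_of_maps_to (s := Finset.univ.filter fun σ => l σ = m) (t := s)
      (g := A) (fun τ _ => Finset.mem_image_of_mem _ (Finset.mem_univ _))]
    refine Finset.sum_congr rfl fun a _ => ?_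
    rw [Finset.filter_filter]
    exact Finset.sum_congr (Finset.filter_congr fun _ _ => and_comm) fun _ _ => rfl
  have := h.mem_of_sum_typeComp_mem 0 (d + m) s hf hsum (A σ)
    (Finset.mem_image_of_mem _ (Finset.mem_univ _))
  exact hs.indep (A σ) m c this σ rfl hσ

/-- Coefficients vanish by descending induction on the weight and, within one weight, on the
position `J` in the string. For a vector at position `J = L - r` of a string of length `L`, apply `N
^ r` to the relation. Modulo `W (d - L - 1)` only the strings of length `L` survive: in the same
weight, vectors at earlier positions are pushed past the end of their strings, and those at later
positions have been dealt with. Injectivity of `N ^ L` on `Gr^W_(d+L)` then leads back to the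
highest vectors. -/
theorem linearIndependent (h : IsOpposedTriple N d W F F')
    (hs : IsStringFamily N d W F F' A l v) :
    LinearIndependent ℂ fun x : Σ σ, Fin (l σ + 1) => (N ^ (x.2 : ℕ)) (v x.1) := by
  classical
  rw [Fintype.linearIndependent_iff]
  intro c hc
  -- descending induction on the weight
  have key : ∀ n : ℕ, ∀ k : ℤ, (∀ x : Σ σ, Fin (l σ + 1), d + l x.1 - 2 * (x.2 : ℕ) < k + n) →
      ∀ x : Σ σ, Fin (l σ + 1), k ≤ d + l x.1 - 2 * (x.2 : ℕ) → c x = 0 := by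
    intro n
    induction n with
    | zero => intro k hk x hx; have := hk x; push_cast at this; omega
    | succ n ih =>
      intro k hk
      have hgt := ih (k + 1) (fun x => by have := hk x; push_cast at this; omega)
      -- descending induction on the position in the string
      have key2 : ∀ i : ℕ, ∀ J : ℕ, (∀ x : Σ σ, Fin (l σ + 1), (x.2 : ℕ) < J + i) →
          ∀ x : Σ σ, Fin (l σ + 1), d + l x.1 - 2 * (x.2 : ℕ) = k → J ≤ (x.2 : ℕ) → c x = 0 := by
        intro i
        induction i with
        | zero => intro J hJ x _ hx; have := hJ x; omega
        | succ i ih2 =>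
          intro J hJ
          have hJgt := ih2 (J + 1) (fun x => by have := hJ x; omega)
          intro x₀ hx₀ hJx₀
          rcases hJx₀.lt_or_eq with hlt | heq
          · exact hJgt x₀ hx₀ hlt
          have hx₀l := x₀.2.isLt
          set L := l x₀.1 with hL
          obtain ⟨r, hr⟩ : ∃ r : ℕ, L = J + r := ⟨L - J, by omega⟩
          have h1 : ∑ x : Σ σ, Fin (l σ + 1), c x • (N ^ ((x.2 : ℕ) + r)) (v x.1) = 0 := by
            have := congrArg (N ^ r) hc
            rw [map_sum, map_zero] at this
            rw [← this]
            refine Finset.sum_congr rfl fun x _ => ?_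
            rw [map_smul, add_comm, pow_add, Module.End.mul_apply]
          let c' : ι → ℂ := fun σ => if hσ : J < l σ + 1 then c ⟨σ, ⟨J, hσ⟩⟩ else 0
          have hJL : J < L + 1 := by omega
          have h2 : ∑ σ with l σ = L, c' σ • (N ^ L) (v σ) ∈ W (d - L - 1) := by
            have hsplit : ∑ x : Σ σ, Fin (l σ + 1), c x • (N ^ ((x.2 : ℕ) + r)) (v x.1) =
                ∑ σ with l σ = L, c' σ • (N ^ L) (v σ) +
                ∑ x : Σ σ, Fin (l σ + 1), (if l x.1 = L ∧ (x.2 : ℕ) = J then 0 else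
                  c x • (N ^ ((x.2 : ℕ) + r)) (v x.1)) := by
              rw [Finset.sum_filter, Fintype.sum_sigma, Fintype.sum_sigma,
                ← Finset.sum_add_distrib]
              refine Finset.sum_congr rfl fun σ _ => ?_
              by_cases hσ : l σ = L
              · have hJσ : J < l σ + 1 := by omega
                rw [if_pos hσ, ← Finset.add_sum_erase _ _ (Finset.mem_univ (⟨J, hJσ⟩ : Fin _)),
                  ← Finset.add_sum_erase (a := (⟨J, hJσ⟩ : Fin _)) (f := fun j : Fin (l σ + 1) =>
                    if l σ = L ∧ (j : ℕ) = J then (0 : X) else _) _ (Finset.mem_univ _)]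
                rw [if_pos ⟨hσ, rfl⟩, zero_add]
                congr 1
                · simp only [c', dif_pos hJσ]
                  rw [hr]
                · refine Finset.sum_congr rfl fun j hj => ?_
                  rw [if_neg]
                  rintro ⟨-, hj'⟩
                  exact (Finset.mem_erase.mp hj).1 (Fin.ext hj')
              · rw [if_neg hσ, zero_add]
                exact Finset.sum_congr rfl fun j _ => by rw [if_neg (fun h => hσ h.1)]
            rw [h1] at hsplit
            rw [eq_neg_of_add_eq_zero_left hsplit.symm]
            refine neg_mem (Submodule.sum_mem _ fun x _ => ?_)
            split_ifs with hx
            · exact zero_mem _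
            · rcases lt_trichotomy (d + l x.1 - 2 * (x.2 : ℕ)) k with hlt | heq' | hgt'
              · refine Submodule.smul_mem _ _ (h.mono ?_ (hs.pow_weight h x.1 _))
                push_cast; omega
              · rcases lt_trichotomy (x.2 : ℕ) J with hj | hj | hj
                · refine Submodule.smul_mem _ _ (h.mono ?_ (hs.pow_weight_of_lt h x.1 ?_))
                  · push_cast; omega
                  · omega
                · exact absurd ⟨by omega, hj⟩ hx
                · rw [hJgt x heq' hj, zero_smul]; exact zero_mem _
              · rw [hgt x (by omega), zero_smul]; exact zero_mem _
          have h3 : ∑ σ with l σ = L, c' σ • v σ ∈ W (d + L - 1) := by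
            refine h.inj L _ (Submodule.sum_mem _ fun σ hσ => Submodule.smul_mem _ _ ?_) ?_
            · rw [← (Finset.mem_filter.mp hσ).2]; exact hs.weight σ
            · simpa only [map_sum, map_smul] using h2
          have h4 := hs.indep_weight h L c' h3 x₀.1 hL.symm
          simp only [c', ← hL, dif_pos hJL] at h4
          rw [← h4]
          obtain ⟨σ, j⟩ := x₀
          congr 1
          exact congrArg (Sigma.mk σ) (Fin.ext heq.symm)
      intro x hx
      rcases hx.lt_or_eq with hlt | heq
      · exact hgt x (by omega)
      · obtain ⟨M, hM⟩ : ∃ M : ℕ, ∀ x : Σ σ, Fin (l σ + 1), (x.2 : ℕ) < M :=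
          ⟨Finset.univ.sup (fun x : Σ σ, Fin (l σ + 1) => (x.2 : ℕ)) + 1, fun x =>
            Nat.lt_succ_of_le (Finset.le_sup (f := fun x : Σ σ, Fin (l σ + 1) => (x.2 : ℕ))
              (Finset.mem_univ x))⟩
        exact key2 M 0 (by simpa using hM) x heq.symm (Nat.zero_le _)
  intro x
  obtain ⟨M, hM⟩ : ∃ M : ℕ, ∀ σ, l σ < M :=
    ⟨Finset.univ.sup l + 1, fun σ => Nat.lt_succ_of_le (Finset.le_sup (Finset.mem_univ σ))⟩
  refine key (2 * M) (d - M) (fun y => ?_) x ?_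
  · have := hM y.1
    push_cast; omega
  · have := hM x.1
    have := x.2.isLt
    omega

end IsStringFamily

end Strings

end DegenerationHodge

/-! ### Existence of orthogonal string families in a limit mixed Hodge structure. -/

namespace DegenerationHodge

section Existence

variable {X : Type*} [AddCommGroup X] [Module ℂ X]

/-- A Hermitian form on a finite-dimensional complex space can be diagonalized. -/
theorem exists_orthogonal_basis_of_hermitian {K : Type*} [AddCommGroup K] [Module ℂ K]
    [FiniteDimensional ℂ K] (h : K →ₗ[ℂ] K →ₛₗ[starRingEnd ℂ] ℂ)
    (hh : ∀ u v, h v u = starRingEnd ℂ (h u v)) :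
    ∃ b : Module.Basis (Fin (Module.finrank ℂ K)) ℂ K, ∀ i j, i ≠ j → h (b i) (b j) = 0 := by
  let n := Module.finrank ℂ K
  let φ : EuclideanSpace ℂ (Fin n) ≃ₗ[ℂ] K :=
    LinearEquiv.ofFinrankEq _ _ (by simp [n])
  let e : Fin n → EuclideanSpace ℂ (Fin n) := fun j => EuclideanSpace.single j 1
  -- In coordinates the form is `⟨y, T x⟩` with `T` self-adjoint, so an orthonormal eigenbasis of
  -- `T` is orthogonal for the form.
  let T : EuclideanSpace ℂ (Fin n) →ₗ[ℂ] EuclideanSpace ℂ (Fin n) :=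
    { toFun := fun x => WithLp.toLp 2 fun j => h (φ x) (φ (e j))
      map_add' := fun x y => by ext j; simp
      map_smul' := fun a x => by ext j; simp }
  have hT : ∀ x y, inner ℂ y (T x) = h (φ x) (φ y) := by
    intro x y
    have hy : y = ∑ j, y j • e j := by
      ext i
      simp [e, Finset.sum_apply, Pi.single_apply]
    conv_rhs => rw [hy, map_sum, map_sum]
    simp [PiLp.inner_apply, T, mul_comm]
  have hS : T.IsSymmetric := by
    intro x y
    rw [hT y x, ← inner_conj_symm, hT x y, ← hh]
  have hn : Module.finrank ℂ (EuclideanSpace ℂ (Fin n)) = n := by simp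
  refine ⟨(hS.eigenvectorBasis hn).toBasis.map φ, fun i j hij => ?_⟩
  rw [Module.Basis.map_apply, Module.Basis.map_apply, ← hT]
  simp only [OrthonormalBasis.coe_toBasis]
  rw [hS.apply_eigenvectorBasis, inner_smul_right, (hS.eigenvectorBasis hn).orthonormal.2 hij.symm,
    mul_zero]

variable {N : Module.End ℂ X} {d : ℤ} {W F F' : ℤ → Submodule ℂ X}

/-- String families exist, and they can be chosen orthogonal for given Hermitian forms. -/
theorem IsOpposedTriple.exists_isStringFamily [FiniteDimensional ℂ X]
    (ht : IsOpposedTriple N d W F F') (hbot' : ∃ p, F' p = ⊥)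
    (h : ℤ → ℕ → X →ₗ[ℂ] X →ₛₗ[starRingEnd ℂ] ℂ)
    (hh : ∀ a m u v, h a m v u = starRingEnd ℂ (h a m u v)) :
    ∃ (ι : Type) (_ : Fintype ι) (A : ι → ℤ) (l : ι → ℕ) (v : ι → X),
      IsStringFamily N d W F F' A l v ∧
      ∀ σ τ, σ ≠ τ → A σ = A τ → l σ = l τ → h (A σ) (l σ) (v σ) (v τ) = 0 := by
  -- `K a m` consists of the lifts to `F a` of primitive classes of type `(a, d + m - a)`. A basis
  -- of a complement in it of the vectors of lower weight is a family of lifts of a basis of that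
  -- primitive component.
  let K : ℤ → ℕ → Submodule ℂ X := fun a m =>
    F a ⊓ typeComp W F F' a (d + m) ⊓ (W (d - m - 3)).comap (N ^ (m + 1))
  choose C hC using fun (a : ℤ) (m : ℕ) =>
    Submodule.exists_isCompl ((W (d + (m : ℤ) - 1)).submoduleOf (K a m))
  let h' : ∀ a m, C a m →ₗ[ℂ] C a m →ₛₗ[starRingEnd ℂ] ℂ := fun a m =>
    (h a m ∘ₗ (K a m).subtype ∘ₗ (C a m).subtype).compl₂ ((K a m).subtype ∘ₗ (C a m).subtype)
  choose b hb using fun a m => exists_orthogonal_basis_of_hermitian (h' a m)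
    (fun u v => hh a m _ _)
  obtain ⟨p₁, hp₁⟩ := ht.hodge_bot
  obtain ⟨p₂, hp₂⟩ := hbot'
  obtain ⟨w, hw⟩ := ht.top
  let M := (w - d).toNat + 1
  -- Outside this box one of `F a`, `F' (d + m - a)` is zero or `W (d + m - 1)` is everything, so
  -- there are no primitive classes.
  let s : Finset (ℤ × ℕ) := Finset.Icc (d - p₂) p₁ ×ˢ Finset.range M
  let v : (Σ x : s, Fin (Module.finrank ℂ (C x.1.1 x.1.2))) → X := fun x =>
    ((b x.1.1.1 x.1.1.2 x.2 : K x.1.1.1 x.1.1.2) : X)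
  have hv : ∀ x, v x ∈ K x.1.1.1 x.1.1.2 := fun x => SetLike.coe_mem (b x.1.1.1 x.1.1.2 x.2).1
  refine ⟨Σ x : s, Fin (Module.finrank ℂ (C x.1.1 x.1.2)), inferInstance, fun x => x.1.1.1,
    fun x => x.1.1.2, v, ⟨fun x => (hv x).1.1, fun x => ht.typeComp_le _ _ (hv x).1.2,
      fun x => (hv x).1.2.2, fun x => (hv x).2, ?_, ?_⟩, ?_⟩
  · intro a m u hu huN
    by_cases hs : (a, m) ∈ s
    · obtain ⟨f, ⟨hf, hf'⟩, g, hg, rfl⟩ := Submodule.mem_sup.mp hu.1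
      have hgN : (N ^ (m + 1)) g ∈ W (d - m - 3) := by
        have := pow_shift ht.shift (m + 1) _ _ hg
        convert this using 2; push_cast; ring
      have hfK : f ∈ K a m := by
        refine ⟨⟨hf, ?_⟩, ?_⟩
        · have := sub_mem hu (ht.le_typeComp a _ hg)
          rwa [add_sub_cancel_right] at this
        · have := sub_mem huN hgN
          rwa [← map_sub, add_sub_cancel_right] at this
      have h1 : (⟨f, hfK⟩ : K a m) ∈ (W (d + (m : ℤ) - 1)).submoduleOf (K a m) ⊔ C a m := by
        rw [(hC a m).sup_eq_top]; trivial
      obtain ⟨f1, hf1, f2, hf2, h3⟩ := Submodule.mem_sup.mp h1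
      have h4 := congrArg Subtype.val h3
      simp only [Submodule.coe_add] at h4
      rw [← h4]
      refine add_mem (add_mem (Submodule.mem_sup_right hf1) (Submodule.mem_sup_left ?_))
        (Submodule.mem_sup_right hg)
      have h5 := (b a m).mem_span ⟨f2, hf2⟩
      have h6 := Submodule.mem_map_of_mem (f := (K a m).subtype ∘ₗ (C a m).subtype) h5
      rw [Submodule.map_span] at h6
      refine Submodule.span_mono ?_ h6
      rintro _ ⟨_, ⟨i, rfl⟩, rfl⟩
      exact ⟨⟨⟨(a, m), hs⟩, i⟩, ⟨rfl, rfl⟩, rfl⟩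
    · refine Submodule.mem_sup_right ?_
      simp only [s, Finset.mem_product, Finset.mem_Icc, Finset.mem_range, not_and_or, not_le,
        not_lt] at hs
      rcases hs with (hs | hs) | hs
      · have : F' (d + m - a) = ⊥ := le_bot_iff.mp (hp₂ ▸ ht.anti' (by omega))
        have h2 := hu.2
        rwa [grLayer, this, bot_inf_eq, bot_sup_eq] at h2
      · have : F a = ⊥ := le_bot_iff.mp (hp₁ ▸ ht.anti hs.le)
        have h2 := hu.1
        rwa [grLayer, this, bot_inf_eq, bot_sup_eq] at h2
      · have : W (d + m - 1) = ⊤ := top_le_iff.mp (hw ▸ ht.mono (by omega))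
        rw [this]; trivial
  · rintro a m c hc ⟨⟨⟨a', m'⟩, hs⟩, i⟩ rfl rfl
    dsimp only at hc ⊢
    let c' : Fin (Module.finrank ℂ (C a' m')) → ℂ := fun i => c ⟨⟨(a', m'), hs⟩, i⟩
    have h1 : ∑ x with x.1.1.1 = a' ∧ x.1.1.2 = m', c x • v x =
        ((∑ i, c' i • b a' m' i : C a' m') : K a' m') := by
      rw [Finset.sum_filter, Fintype.sum_sigma, Fintype.sum_eq_single (⟨(a', m'), hs⟩ : s)]
      · simp [c', v]
      · intro x hx
        refine Finset.sum_eq_zero fun j _ => if_neg ?_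
        rintro ⟨rfl, rfl⟩
        exact hx rfl
    rw [h1] at hc
    have h2 : ((∑ i, c' i • b a' m' i : C a' m') : K a' m') = 0 :=
      (Submodule.disjoint_def.mp (hC a' m').disjoint) _ hc (Subtype.mem _)
    have h3 : (∑ i, c' i • b a' m' i : C a' m') = 0 := Subtype.ext h2
    exact Fintype.linearIndependent_iff.mp (b a' m').linearIndependent c' h3 i
  · rintro ⟨⟨⟨a, m⟩, hs⟩, i⟩ ⟨⟨⟨a', m'⟩, hs'⟩, j⟩ hne h1 h2
    dsimp only at h1 h2
    subst h1 h2
    exact hb a m i j fun e => hne (by rw [e])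

-- Dictionary between subspaces of `Gr^W_k` and subspaces of `W k` containing `W (k - 1)`; it lets
-- the linear algebra of strings avoid quotients.
variable (W) in
theorem mkQ_mem_grInd_iff {A : Submodule ℂ X} {k : ℤ} (u : W k) :
    ((W (k - 1)).submoduleOf (W k)).mkQ u ∈ grInd W k A ↔ (u : X) ∈ grLayer W A k := by
  constructor
  · rintro ⟨w, hw, hwu⟩
    have h1 := (Submodule.Quotient.eq _).mp hwu
    have h2 : (w : X) - u ∈ W (k - 1) := h1
    have h3 := sub_mem (show (w : X) ∈ grLayer W A k from Submodule.mem_sup_left ⟨hw, w.2⟩)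
      (le_grLayer W A k h2)
    rwa [sub_sub_cancel] at h3
  · intro hu
    obtain ⟨f, ⟨hf, hf'⟩, g, hg, h1⟩ := Submodule.mem_sup.mp hu
    refine ⟨⟨f, hf'⟩, hf, ?_⟩
    refine (Submodule.Quotient.eq _).mpr ?_
    change f - (u : X) ∈ W (k - 1)
    rw [← h1, sub_add_cancel_left]
    exact neg_mem hg

theorem mem_conjSub_iff {c : X →ₛₗ[starRingEnd ℂ] X} (hc : ∀ x, c (c x) = x)
    (A : Submodule ℂ X) (x : X) : x ∈ conjSub c A ↔ c x ∈ A := by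
  constructor
  · rintro ⟨y, hy, rfl⟩
    rwa [hc]
  · intro hx
    exact ⟨c x, hx, hc x⟩

theorem grPow_mkQ (hN : ∀ i, ∀ x ∈ W i, N x ∈ W (i - 2)) (m : ℕ) (k : ℤ) (u : W k) :
    grPow N W hN m k (((W (k - 1)).submoduleOf (W k)).mkQ u) =
      ((W (k - 2 * m - 1)).submoduleOf (W (k - 2 * m))).mkQ
        ⟨(N ^ m) u, pow_shift hN m k u u.2⟩ := rfl

theorem mkQ_eq_zero_iff (k : ℤ) (u : W k) :
    ((W (k - 1)).submoduleOf (W k)).mkQ u = 0 ↔ (u : X) ∈ W (k - 1) :=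
  Submodule.Quotient.mk_eq_zero _

/-- The conjugation enters only through the second filtration. In this form the hypotheses are
symmetric in the two filtrations, so that results on strings also apply to the conjugate one. -/
theorem IsLimitMHS.isOpposedTriple {c : X →ₛₗ[starRingEnd ℂ] X} {d : ℕ}
    (hA : IsLimitMHS c N d W F) : IsOpposedTriple N d W F fun p => conjSub c (F p) where
  mono := hA.mixed.weight_mono
  bot := hA.mixed.weight_bot
  top := hA.mixed.weight_top
  anti := hA.mixed.hodge_anti
  hodge_top := hA.mixed.hodge_top
  hodge_bot := hA.mixed.hodge_bot
  anti' _ _ h := Submodule.map_mono (hA.mixed.hodge_anti h)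
  sup := by
    intro k p u hu
    have h1 : ((W (k - 1)).submoduleOf (W k)).mkQ ⟨u, hu⟩ ∈
        grInd W k (F p) ⊔ grInd W k (conjSub c (F (k - p + 1))) := by
      rw [(hA.mixed.opposed k p).sup_eq_top]; trivial
    obtain ⟨y, hy, z, hz, h2⟩ := Submodule.mem_sup.mp h1
    obtain ⟨y, rfl⟩ := Submodule.mkQ_surjective _ y
    obtain ⟨z, rfl⟩ := Submodule.mkQ_surjective _ z
    rw [mkQ_mem_grInd_iff W] at hy hz
    rw [← map_add] at h2
    have h3 : (y : X) + z - u ∈ W (k - 1) :=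
      (Submodule.Quotient.eq ((W (k - 1)).submoduleOf (W k)) (x := y + z) (y := ⟨u, hu⟩)).mp h2
    have h4 := sub_mem (Submodule.add_mem_sup hy hz) (Submodule.mem_sup_left (le_grLayer W (F p) k h3))
    rwa [sub_sub_cancel] at h4
  inf := by
    rintro k p u ⟨hu, hu'⟩
    have huk := grLayer_le hA.mixed.weight_mono _ _ hu
    rw [← mkQ_eq_zero_iff k ⟨u, huk⟩]
    exact Submodule.disjoint_def.mp (hA.mixed.opposed k p).disjoint _
      ((mkQ_mem_grInd_iff W ⟨u, huk⟩).mpr hu) ((mkQ_mem_grInd_iff W ⟨u, huk⟩).mpr hu')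
  shift := hA.weight.shift
  hodge := hA.hodge
  hodge' := by
    rintro p _ ⟨x, hx, rfl⟩
    exact ⟨N x, hA.hodge p x hx, (hA.real x).symm⟩
  inj := by
    intro l u hu huN
    rw [← mkQ_eq_zero_iff (d + l) ⟨u, hu⟩]
    apply (hA.weight.iso l).1
    rw [map_zero, grPow_mkQ, mkQ_eq_zero_iff]
    convert huN using 2
    ring
  surj := by
    intro l v hv
    have e : (d : ℤ) - l = d + l - 2 * l := by ring
    rw [e] at hv
    obtain ⟨y, hy⟩ := (hA.weight.iso l).2 (Submodule.mkQ _ ⟨v, hv⟩)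
    obtain ⟨u, rfl⟩ := Submodule.mkQ_surjective _ y
    rw [grPow_mkQ] at hy
    refine ⟨u, u.2, ?_⟩
    have h3 : v - (N ^ l) u ∈ W (d + l - 2 * l - 1) :=
      (Submodule.Quotient.eq ((W (d + l - 2 * l - 1)).submoduleOf (W (d + l - 2 * l)))
        (x := ⟨v, hv⟩)).mp hy.symm
    rwa [e]

end Existence

end DegenerationHodge

/-! ### Limits of subspaces and stability of inertia indices. -/

namespace DegenerationHodge

section Convergence

set_option linter.unusedSectionVars false

variable {α κ : Type*} [Fintype κ] {f : Filter α}

/-- Every vector of `A₀` is a limit of vectors of the subspaces `A z`. -/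
def LowConv (f : Filter α) (A : α → Submodule ℂ (κ → ℂ)) (A₀ : Submodule ℂ (κ → ℂ)) : Prop :=
  ∀ a ∈ A₀, ∃ s : α → κ → ℂ, (∀ᶠ z in f, s z ∈ A z) ∧ Tendsto s f (𝓝 a)

theorem lowConv_span {A : α → Submodule ℂ (κ → ℂ)} {s : Set (κ → ℂ)}
    (h : ∀ a ∈ s, ∃ t : α → κ → ℂ, (∀ᶠ z in f, t z ∈ A z) ∧ Tendsto t f (𝓝 a)) :
    LowConv f A (Submodule.span ℂ s) := by
  intro a ha
  induction ha using Submodule.span_induction with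
  | mem x hx => exact h x hx
  | zero => exact ⟨fun _ => 0, .of_forall fun z => zero_mem _, tendsto_const_nhds⟩
  | add x y _ _ hx hy =>
    obtain ⟨s, hs, hs'⟩ := hx
    obtain ⟨t, ht, ht'⟩ := hy
    exact ⟨fun z => s z + t z, hs.mp (ht.mono fun z h1 h2 => add_mem h2 h1), hs'.add ht'⟩
  | smul r x _ hx =>
    obtain ⟨s, hs, hs'⟩ := hx
    exact ⟨fun z => r • s z, hs.mono fun z h1 => Submodule.smul_mem _ _ h1, hs'.const_smul r⟩

/-- Hermitian matrices close to a positive diagonal matrix are positive definite. -/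
theorem eventually_pos_of_tendsto_diagonal {G : α → κ → κ → ℂ} {D : κ → κ → ℂ}
    (hG : ∀ i j, Tendsto (fun z => G z i j) f (𝓝 (D i j))) (hD : ∀ i j, i ≠ j → D i j = 0)
    (hpos : ∀ i, 0 < (D i i).re) :
    ∀ᶠ z in f, ∀ x : κ → ℂ, x ≠ 0 →
      0 < (∑ i, ∑ j, x i * (starRingEnd ℂ (x j) * G z i j)).re := by
  classical
  obtain ⟨m, hm, hm'⟩ : ∃ m > 0, ∀ i, m ≤ (D i i).re := by
    rcases isEmpty_or_nonempty κ with h | h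
    · exact ⟨1, one_pos, fun i => h.elim i⟩
    · obtain ⟨i, hi⟩ := Finite.exists_min fun i => (D i i).re
      exact ⟨_, hpos i, hi⟩
  set n : ℝ := (Fintype.card κ : ℝ) with hn
  have hn0 : 0 ≤ n := Nat.cast_nonneg _
  -- With this entrywise error the form changes by at most `m n / (n + 1)` times the squared norm,
  -- less than the lower bound `m` of the diagonal.
  have hε : 0 < m / (n + 1) := by positivity
  have h1 : ∀ᶠ z in f, ∀ i j, ‖G z i j - D i j‖ < m / (n + 1) :=
    eventually_all.mpr fun i => eventually_all.mpr fun j =>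
      (Metric.tendsto_nhds.mp (hG i j) _ hε).mono fun z hz => by rwa [dist_eq_norm] at hz
  filter_upwards [h1] with z hz x hx
  set Q : ℝ := ∑ i, ‖x i‖ ^ 2 with hQ
  have hQpos : 0 < Q := by
    obtain ⟨i, hi⟩ := Function.ne_iff.mp hx
    exact Finset.sum_pos' (fun i _ => by positivity) ⟨i, Finset.mem_univ _, by
      have := norm_pos_iff.mpr hi; positivity⟩
  have h2 : ∀ i j, x i * (starRingEnd ℂ (x j) * G z i j) =
      x i * (starRingEnd ℂ (x j) * D i j) + x i * (starRingEnd ℂ (x j) * (G z i j - D i j)) := by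
    intro i j; ring
  have h3 : m * Q ≤ (∑ i, ∑ j, x i * (starRingEnd ℂ (x j) * D i j)).re := by
    have : ∀ i, ∑ j, x i * (starRingEnd ℂ (x j) * D i j) = ((‖x i‖ ^ 2 : ℝ) : ℂ) * D i i := by
      intro i
      rw [Fintype.sum_eq_single i fun j hj => by rw [hD i j hj.symm, mul_zero, mul_zero],
        ← mul_assoc, Complex.mul_conj, Complex.normSq_eq_norm_sq]
    rw [Finset.sum_congr rfl fun i _ => this i, Complex.re_sum, hQ, Finset.mul_sum]
    refine Finset.sum_le_sum fun i _ => ?_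
    rw [Complex.re_ofReal_mul, mul_comm]
    exact mul_le_mul_of_nonneg_left (hm' i) (by positivity)
  have h4 : ‖∑ i, ∑ j, x i * (starRingEnd ℂ (x j) * (G z i j - D i j))‖ ≤
      m / (n + 1) * (n * Q) := by
    have h5 : ∀ i j, ‖x i * (starRingEnd ℂ (x j) * (G z i j - D i j))‖ ≤
        m / (n + 1) * ((‖x i‖ ^ 2 + ‖x j‖ ^ 2) / 2) := by
      intro i j
      rw [norm_mul, norm_mul, RCLike.norm_conj]
      calc ‖x i‖ * (‖x j‖ * ‖G z i j - D i j‖) = ‖G z i j - D i j‖ * (‖x i‖ * ‖x j‖) := by ring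
        _ ≤ m / (n + 1) * ((‖x i‖ ^ 2 + ‖x j‖ ^ 2) / 2) := by
          refine mul_le_mul (hz i j).le ?_ (by positivity) hε.le
          nlinarith [sq_nonneg (‖x i‖ - ‖x j‖)]
    calc _ ≤ ∑ i, ∑ j, m / (n + 1) * ((‖x i‖ ^ 2 + ‖x j‖ ^ 2) / 2) :=
          (norm_sum_le _ _).trans (Finset.sum_le_sum fun i _ => (norm_sum_le _ _).trans
            (Finset.sum_le_sum fun j _ => h5 i j))
      _ = m / (n + 1) * (n * Q) := by
          simp only [← Finset.mul_sum, ← Finset.sum_div, Finset.sum_add_distrib, Finset.sum_const,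
            Finset.card_univ, nsmul_eq_mul, ← hn, ← hQ]
          ring
  have h6 : m / (n + 1) * (n * Q) < m * Q := by
    have : n / (n + 1) < 1 := (div_lt_one (by positivity)).mpr (by linarith)
    calc m / (n + 1) * (n * Q) = n / (n + 1) * (m * Q) := by ring
      _ < 1 * (m * Q) := mul_lt_mul_of_pos_right this (by positivity)
      _ = m * Q := one_mul _
  simp only [h2, Finset.sum_add_distrib, Complex.add_re]
  have h7 := (Complex.abs_re_le_norm _).trans h4
  have h8 := (abs_le.mp h7).1
  linarith

variable [DecidableEq κ] {A B : α → Submodule ℂ (κ → ℂ)} {A₀ B₀ : Submodule ℂ (κ → ℂ)}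

/-- Each standard basis vector splits along `A₀` and `B₀`, and the two parts are approximated
separately. The resulting sums form a matrix tending to the identity, hence eventually invertible:
transversality is open, and with bounds. -/
theorem LowConv.exists_frames (hA : LowConv f A A₀) (hB : LowConv f B B₀) (h : A₀ ⊔ B₀ = ⊤) :
    ∃ (a b : κ → α → κ → ℂ) (a₀ : κ → κ → ℂ), (∀ i, ∀ᶠ z in f, a i z ∈ A z) ∧
      (∀ i, ∀ᶠ z in f, b i z ∈ B z) ∧ (∀ i, Tendsto (a i) f (𝓝 (a₀ i))) ∧
      Tendsto (fun z => (Matrix.of fun i j => a i z j + b i z j : Matrix κ κ ℂ)) f (𝓝 1) := by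
  have h1 : ∀ i : κ, ∃ a₀ ∈ A₀, ∃ b₀ ∈ B₀, a₀ + b₀ = Pi.single i (1 : ℂ) := fun i =>
    Submodule.mem_sup.mp (h ▸ Submodule.mem_top)
  choose a₀ ha₀ b₀ hb₀ hab using h1
  choose a ha ha' using fun i => hA (a₀ i) (ha₀ i)
  choose b hb hb' using fun i => hB (b₀ i) (hb₀ i)
  refine ⟨a, b, a₀, ha, hb, ha', ?_⟩
  refine tendsto_pi_nhds.mpr fun i => ?_
  have h2 := (ha' i).add (hb' i)
  rw [hab i] at h2
  have h3 : (1 : Matrix κ κ ℂ) i = Pi.single i 1 := by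
    ext j; simp [Matrix.one_apply, Pi.single_apply, eq_comm]
  rw [h3]
  exact h2

theorem tendsto_matrix_inv {G : α → Matrix κ κ ℂ} (hG : Tendsto G f (𝓝 1)) :
    (∀ᶠ z in f, IsUnit (G z).det) ∧ Tendsto (fun z => (G z)⁻¹) f (𝓝 1) := by
  have h1 : Tendsto (fun z => (G z).det) f (𝓝 1) := by
    have := ((continuous_id (X := Matrix κ κ ℂ)).matrix_det.tendsto 1).comp hG
    simpa [Function.comp_def] using this
  refine ⟨(h1.eventually_ne one_ne_zero).mono fun z hz => hz.isUnit, ?_⟩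
  have h2 : Tendsto (fun z => (G z).adjugate) f (𝓝 1) := by
    have := ((continuous_id (X := Matrix κ κ ℂ)).matrix_adjugate.tendsto 1).comp hG
    simpa [Function.comp_def] using this
  have h3 := (h1.inv₀ one_ne_zero).smul h2
  simp only [inv_one, one_smul] at h3
  refine h3.congr fun z => ?_
  rw [Matrix.inv_def, Ring.inverse_eq_inv']

theorem LowConv.eventually_sup_eq_top (hA : LowConv f A A₀) (hB : LowConv f B B₀)
    (h : A₀ ⊔ B₀ = ⊤) : ∀ᶠ z in f, A z ⊔ B z = ⊤ := by
  obtain ⟨a, b, a₀, ha, hb, -, hG⟩ := hA.exists_frames hB h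
  filter_upwards [(tendsto_matrix_inv hG).1, eventually_all.mpr ha, eventually_all.mpr hb]
    with z hz ha hb
  rw [eq_top_iff]
  intro x _
  set G : Matrix κ κ ℂ := Matrix.of fun i j => a i z j + b i z j with hGdef
  have h1 : x = Matrix.vecMul (Matrix.vecMul x G⁻¹) G := by
    rw [Matrix.vecMul_vecMul, Matrix.nonsing_inv_mul _ hz, Matrix.vecMul_one]
  rw [h1, Matrix.vecMul_eq_sum]
  exact Submodule.sum_mem _ fun i _ => Submodule.smul_mem _ _
    (Submodule.add_mem_sup (ha i) (hb i))

/-- A null sequence is the sum of null sequences in two families of subspaces whose limits span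
everything. -/
theorem LowConv.exists_decomposition (hA : LowConv f A A₀) (hB : LowConv f B B₀)
    (h : A₀ ⊔ B₀ = ⊤) {x : α → κ → ℂ} (hx : Tendsto x f (𝓝 0)) :
    ∃ y : α → κ → ℂ, Tendsto y f (𝓝 0) ∧ ∀ᶠ z in f, y z ∈ A z ∧ x z - y z ∈ B z := by
  obtain ⟨a, b, a₀, ha, hb, ha', hG⟩ := hA.exists_frames hB h
  let G : α → Matrix κ κ ℂ := fun z => Matrix.of fun i j => a i z j + b i z j
  let y : α → κ → ℂ := fun z => Matrix.vecMul (x z) (G z)⁻¹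
  have hy : Tendsto y f (𝓝 0) := by
    have h1 : Continuous fun p : (κ → ℂ) × Matrix κ κ ℂ => Matrix.vecMul p.1 p.2 :=
      continuous_fst.matrix_vecMul continuous_snd
    have h2 := (h1.tendsto (0, 1)).comp (hx.prodMk_nhds (tendsto_matrix_inv hG).2)
    rw [Matrix.zero_vecMul] at h2
    exact h2
  refine ⟨fun z => ∑ i, y z i • a i z, ?_, ?_⟩
  · have h1 : Tendsto (fun z => ∑ i, y z i • a i z) f (𝓝 (∑ i, (0 : κ → ℂ) i • a₀ i)) :=
      tendsto_finsetSum _ fun i _ => ((tendsto_pi_nhds.mp hy i).smul (ha' i))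
    simpa using h1
  · filter_upwards [(tendsto_matrix_inv hG).1, eventually_all.mpr ha, eventually_all.mpr hb]
      with z hz ha hb
    refine ⟨Submodule.sum_mem _ fun i _ => Submodule.smul_mem _ _ (ha i), ?_⟩
    have h1 : x z = Matrix.vecMul (y z) (G z) := by
      rw [Matrix.vecMul_vecMul, Matrix.nonsing_inv_mul _ hz, Matrix.vecMul_one]
    have h2 : x z - ∑ i, y z i • a i z = ∑ i, y z i • b i z := by
      rw [h1, Matrix.vecMul_eq_sum, ← Finset.sum_sub_distrib]
      refine Finset.sum_congr rfl fun i _ => ?_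
      ext j
      simp only [G, Pi.sub_apply, Pi.smul_apply, Matrix.of_apply, smul_eq_mul]
      ring
    rw [h2]
    exact Submodule.sum_mem _ fun i _ => Submodule.smul_mem _ _ (hb i)

/-- Approximations of a common limit from `A z` and from `B z` differ by a null family. By
transversality the difference is a null correction in `A z` plus an element of `B z`, and
subtracting the correction gives an approximation in both. -/
theorem LowConv.inf (hA : LowConv f A A₀) (hB : LowConv f B B₀) (h : A₀ ⊔ B₀ = ⊤) :
    LowConv f (fun z => A z ⊓ B z) (A₀ ⊓ B₀) := by
  rintro w ⟨hwA, hwB⟩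
  obtain ⟨a, ha, ha'⟩ := hA w hwA
  obtain ⟨b, hb, hb'⟩ := hB w hwB
  have h0 : Tendsto (fun z => a z - b z) f (𝓝 0) := by simpa using ha'.sub hb'
  obtain ⟨y, hy, hy'⟩ := hA.exists_decomposition hB h h0
  refine ⟨fun z => a z - y z, ?_, by simpa using ha'.sub hy⟩
  filter_upwards [ha, hb, hy'] with z h1 h2 h3
  refine ⟨sub_mem h1 h3.1, ?_⟩
  have := add_mem h3.2 h2
  rwa [show a z - b z - y z + b z = a z - y z by abel] at this

end Convergence

section Index

variable {X : Type*} [AddCommGroup X] [Module ℂ X]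

/-- Sylvester's law: a positive definite subspace meets the negative definite `L'` trivially, so its
dimension is at most `dim K - dim L'`. -/
theorem posIndex_eq {h : X → X → ℂ} {K L L' : Submodule ℂ X} [FiniteDimensional ℂ K]
    (hL : L ≤ K) (hL' : L' ≤ K) (hpos : ∀ x ∈ L, x ≠ 0 → 0 < (h x x).re)
    (hneg : ∀ x ∈ L', x ≠ 0 → (h x x).re < 0)
    (hdim : Module.finrank ℂ K ≤ Module.finrank ℂ L + Module.finrank ℂ L') :
    posIndex h K = Module.finrank ℂ L := by
  refine IsGreatest.csSup_eq ⟨⟨L, hL, rfl, hpos⟩, ?_⟩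
  rintro n ⟨M, hM, rfl, hMpos⟩
  have h1 : Disjoint M L' := Submodule.disjoint_def.mpr fun x hx hx' => by
    by_contra h0
    exact lt_asymm (hMpos x hx h0) (hneg x hx' h0)
  have := Submodule.finiteDimensional_of_le hM
  have := Submodule.finiteDimensional_of_le hL'
  have h2 := Submodule.finrank_sup_add_finrank_inf_eq M L'
  rw [h1.eq_bot, finrank_bot] at h2
  have h3 := Submodule.finrank_mono (sup_le hM hL')
  omega

theorem negIndex_eq {h : X → X → ℂ} {K L L' : Submodule ℂ X} [FiniteDimensional ℂ K]
    (hL : L ≤ K) (hL' : L' ≤ K) (hpos : ∀ x ∈ L, x ≠ 0 → 0 < (h x x).re)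
    (hneg : ∀ x ∈ L', x ≠ 0 → (h x x).re < 0)
    (hdim : Module.finrank ℂ K ≤ Module.finrank ℂ L + Module.finrank ℂ L') :
    negIndex h K = Module.finrank ℂ L' :=
  posIndex_eq hL' hL (fun x hx h0 => by simpa using hneg x hx h0)
    (fun x hx h0 => by simpa using hpos x hx h0) (by rwa [add_comm])

theorem posIndex_map {Y : Type*} [AddCommGroup Y] [Module ℂ Y] (g : X ≃ₗ[ℂ] Y) {h : X → X → ℂ}
    {h' : Y → Y → ℂ} (hh : ∀ u, h' (g u) (g u) = h u u) (K : Submodule ℂ X) :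
    posIndex h' (K.map (g : X →ₗ[ℂ] Y)) = posIndex h K := by
  unfold posIndex
  congr 1
  ext n
  constructor
  · rintro ⟨L, hL, rfl, hpos⟩
    refine ⟨L.map (g.symm : Y →ₗ[ℂ] X), ?_, LinearEquiv.finrank_map_eq g.symm L, ?_⟩
    · rintro _ ⟨y, hy, rfl⟩
      obtain ⟨x, hx, rfl⟩ := hL hy
      simpa using hx
    · rintro _ ⟨y, hy, rfl⟩ h0
      have := hpos y hy (fun e => h0 (by simp [e]))
      rw [← g.apply_symm_apply y, hh] at this
      exact this
  · rintro ⟨L, hL, rfl, hpos⟩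
    refine ⟨L.map (g : X →ₗ[ℂ] Y), Submodule.map_mono hL, LinearEquiv.finrank_map_eq g L, ?_⟩
    rintro _ ⟨x, hx, rfl⟩ h0
    have := hpos x hx (fun e => h0 (by simp [e]))
    rw [← hh] at this
    exact this

end Index

end DegenerationHodge

/-! ### The model: one Jordan block as a space of polynomials. -/

namespace DegenerationHodge

section StringModel

open Polynomial

/-- Vectors of a Jordan block as polynomials: `X^k / k!` corresponds to the basis vector with index
`l - k`, so that the nilpotent operator becomes the derivative. -/
noncomputable def polyVec (l : ℕ) : ℂ[X] →ₗ[ℂ] (Fin (l + 1) → ℂ) where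
  toFun g i := ((l - i : ℕ).factorial : ℂ) * g.coeff (l - i)
  map_add' f g := by ext i; simp [mul_add]
  map_smul' a g := by ext i; simp; ring

/-- The exponential of `s` times the nilpotent operator, applied to the `j`-th basis vector of a
Jordan block. -/
noncomputable def blockExp (l : ℕ) (s : ℂ) (j : ℕ) : Fin (l + 1) → ℂ := fun i =>
  if j ≤ i then s ^ ((i : ℕ) - j) / (((i : ℕ) - j).factorial : ℂ) else 0

/-- The exponential of `s` times the derivative is translation by `s`, by Taylor's formula; so the
image of the `j`-th basis vector is `(X + s)^(l-j) / (l-j)!`. -/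
theorem polyVec_X_add_C_pow {l : ℕ} (s : ℂ) {j : ℕ} (hj : j ≤ l) :
    polyVec l ((X + C s) ^ (l - j)) = ((l - j).factorial : ℂ) • blockExp l s j := by
  ext i
  have hi : (i : ℕ) ≤ l := Nat.lt_succ_iff.mp i.2
  simp only [polyVec, LinearMap.coe_mk, AddHom.coe_mk, coeff_X_add_C_pow, blockExp, Pi.smul_apply,
    smul_eq_mul]
  split_ifs with h
  · have h1 : l - i ≤ l - j := by omega
    have h2 : l - j - (l - i) = i - j := by omega
    have h3 := Nat.choose_mul_factorial_mul_factorial h1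
    rw [h2] at h3
    have h4 : (((i : ℕ) - j).factorial : ℂ) ≠ 0 := by exact_mod_cast Nat.factorial_ne_zero _
    rw [h2, ← h3]
    push_cast
    field_simp
  · rw [Nat.choose_eq_zero_of_lt (by omega)]
    simp

/-- The span on the right corresponds to the multiples of `(X + s)^(l-m)` of degree at most `l`, as
one sees by expanding the second factor in powers of `X + s`. -/
theorem polyVec_mem_span {l : ℕ} (s r : ℂ) {m : ℕ} (hm : m ≤ l) :
    polyVec l ((X + C s) ^ (l - m) * (X + C r) ^ m) ∈
      Submodule.span ℂ (blockExp l s '' {j | j ≤ m}) := by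
  have h1 : (X + C r : ℂ[X]) = (X + C s) + C (r - s) := by rw [C_sub]; ring
  rw [h1, add_pow (X + C s) (C (r - s)) m, Finset.mul_sum, map_sum]
  refine Submodule.sum_mem _ fun n hn => ?_
  have hn' : n ≤ m := Nat.lt_succ_iff.mp (Finset.mem_range.mp hn)
  have h2 : (X + C s) ^ (l - m) * ((X + C s) ^ n * C (r - s) ^ (m - n) * ((m.choose n : ℕ) : ℂ[X]))
      = ((r - s) ^ (m - n) * (m.choose n : ℂ)) • (X + C s) ^ (l - (m - n)) := by
    rw [smul_eq_C_mul, show l - (m - n) = (l - m) + n by omega, pow_add]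
    simp only [C_mul, C_pow, C_eq_natCast]
    ring
  rw [h2, map_smul, polyVec_X_add_C_pow s (by omega)]
  exact Submodule.smul_mem _ _ (Submodule.smul_mem _ _ (Submodule.subset_span ⟨m - n, by simp, rfl⟩))

/-- The pairing of polynomials of degree at most `l` invariant under translations. -/
noncomputable def transvectant (l : ℕ) (f g : ℂ[X]) : ℂ[X] :=
  ∑ k ∈ Finset.range (l + 1), (-1) ^ k * (derivative^[l - k] f * derivative^[k] g)

/-- The derivative telescopes, and the two boundary terms contain a derivative of order `l + 1`. So
the pairing is a constant that may be evaluated at any convenient point; this is invariance under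
`exp(sN)`. -/
theorem derivative_transvectant {l : ℕ} {f g : ℂ[X]} (hf : f.natDegree ≤ l) (hg : g.natDegree ≤ l) :
    derivative (transvectant l f g) = 0 := by
  let a : ℕ → ℂ[X] := fun k => (-1) ^ k * (derivative^[l + 1 - k] f * derivative^[k] g)
  have h1 : derivative (transvectant l f g) = ∑ k ∈ Finset.range (l + 1), (a k - a (k + 1)) := by
    rw [transvectant, derivative_sum]
    refine Finset.sum_congr rfl fun k hk => ?_
    have hk' : k ≤ l := Nat.lt_succ_iff.mp (Finset.mem_range.mp hk)
    have h2 : derivative ((-1 : ℂ[X]) ^ k) = 0 := by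
      rw [show (-1 : ℂ[X]) ^ k = C ((-1) ^ k) by simp, derivative_C]
    rw [derivative_mul, h2, derivative_mul, ← Function.iterate_succ_apply' derivative,
      ← Function.iterate_succ_apply' derivative]
    simp only [a]
    rw [show l + 1 - k = (l - k).succ by omega, show l + 1 - (k + 1) = l - k by omega, pow_succ,
      Nat.succ_eq_add_one, Nat.succ_eq_add_one]
    ring
  rw [h1, Finset.sum_range_sub']
  simp only [a]
  rw [iterate_derivative_eq_zero (by omega : f.natDegree < l + 1 - 0),
    iterate_derivative_eq_zero (by omega : g.natDegree < l + 1)]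
  simp

theorem eval_iterate_derivative (r : ℂ) (k : ℕ) (f : ℂ[X]) :
    (derivative^[k] f).eval r = (k.factorial : ℂ) * (taylor r f).coeff k := by
  rw [taylor_coeff, ← factorial_smul_hasseDeriv]
  simp

theorem eval_transvectant (l : ℕ) (f g : ℂ[X]) (r : ℂ) :
    (transvectant l f g).eval r = ∑ k ∈ Finset.range (l + 1), (-1) ^ k *
      (((l - k).factorial : ℂ) * (taylor r f).coeff (l - k) *
        ((k.factorial : ℂ) * (taylor r g).coeff k)) := by
  rw [transvectant, eval_finsetSum]
  refine Finset.sum_congr rfl fun k _ => ?_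
  rw [eval_mul, eval_mul, eval_iterate_derivative, eval_iterate_derivative]
  simp

theorem eval_transvectant_eq {l : ℕ} {f g : ℂ[X]} (hf : f.natDegree ≤ l) (hg : g.natDegree ≤ l)
    (r r' : ℂ) : (transvectant l f g).eval r = (transvectant l f g).eval r' := by
  have h := derivative_eq_zero.mp (derivative_transvectant hf hg)
  obtain ⟨a, ha⟩ := natDegree_eq_zero.mp h
  rw [← ha, eval_C, eval_C]

/-- The vectors of a Jordan block spanning the components of the limiting Hodge decomposition. -/
noncomputable def hodgeVec (l m : ℕ) : Fin (l + 1) → ℂ :=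
  polyVec l ((X + C Complex.I) ^ (l - m) * (X + C (-Complex.I)) ^ m)

/-- The polynomial of `hodgeVec l m` is divisible by `(X + i)^(l-m)` and by `(X - i)^m`. So this
vector lies in the `m`-th step of the filtration twisted by `exp(iN)` and in the `(l - m)`-th step
of its conjugate. -/
theorem hodgeVec_mem_span {l m : ℕ} (hm : m ≤ l) :
    hodgeVec l m ∈ Submodule.span ℂ (blockExp l Complex.I '' {j | j ≤ m}) :=
  polyVec_mem_span _ _ hm

theorem hodgeVec_mem_span_neg {l m : ℕ} (hm : m ≤ l) :
    hodgeVec l m ∈ Submodule.span ℂ (blockExp l (-Complex.I) '' {j | j ≤ l - m}) := by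
  have := polyVec_mem_span (-Complex.I) Complex.I (Nat.sub_le l m)
  rwa [Nat.sub_sub_self hm, mul_comm] at this

theorem coeff_X_pow_mul_of_lt {n k : ℕ} (h : k < n) (f : ℂ[X]) : (X ^ n * f).coeff k = 0 := by
  rw [coeff_X_pow_mul', if_neg (by omega)]

/-- The sum is the transvectant of the `m`-th polynomial and the conjugate of the `m'`-th one.
Expanded at `-i` if `m ≤ m'` and at `i` otherwise, both are divisible by powers of the local
coordinate so high that no term survives, except a single one when `m = m'`. -/
theorem sum_hodgeVec {l m m' : ℕ} (hm : m ≤ l) (hm' : m' ≤ l) :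
    ∑ i : Fin (l + 1), (-1) ^ (i : ℕ) * (hodgeVec l m i * starRingEnd ℂ (hodgeVec l m' i.rev)) =
      if m = m' then (-1) ^ m * ((l - m).factorial * m.factorial) * (-2 * Complex.I) ^ l else 0 := by
  set I := Complex.I with hI
  let f : ℂ[X] := (X + C I) ^ (l - m) * (X + C (-I)) ^ m
  let g : ℂ[X] := (X + C (-I)) ^ (l - m') * (X + C I) ^ m'
  have hdeg : ∀ (a b : ℕ) (s r : ℂ), ((X + C s) ^ a * (X + C r) ^ b : ℂ[X]).natDegree ≤ a + b := by
    intro a b s r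
    refine natDegree_mul_le.trans (add_le_add ?_ ?_) <;>
    · refine natDegree_pow_le.trans ?_
      rw [natDegree_X_add_C, mul_one]
  have hf : f.natDegree ≤ l := (hdeg _ _ _ _).trans (by omega)
  have hg : g.natDegree ≤ l := (hdeg _ _ _ _).trans (by omega)
  have hconj : ∀ k, starRingEnd ℂ
      (((X + C I) ^ (l - m') * (X + C (-I)) ^ m' : ℂ[X]).coeff k) = g.coeff k := by
    intro k
    rw [← coeff_map]
    simp [g, Polynomial.map_mul, Polynomial.map_pow, hI]
  have h0 : ∑ i : Fin (l + 1), (-1) ^ (i : ℕ) *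
      (hodgeVec l m i * starRingEnd ℂ (hodgeVec l m' i.rev)) = (transvectant l f g).eval 0 := by
    rw [eval_transvectant, ← Fin.sum_univ_eq_sum_range (fun k => (-1) ^ k *
      (((l - k).factorial : ℂ) * (taylor 0 f).coeff (l - k) *
        ((k.factorial : ℂ) * (taylor 0 g).coeff k))) (l + 1)]
    refine Finset.sum_congr rfl fun i _ => ?_
    have hi : l - (i.rev : ℕ) = i := by rw [Fin.val_rev]; omega
    simp only [hodgeVec, polyVec, LinearMap.coe_mk, AddHom.coe_mk, hi, map_mul, map_natCast, taylor_zero]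
    rw [← hconj]
  have ht : ∀ (a b : ℕ) (s r t : ℂ), taylor t ((X + C s) ^ a * (X + C r) ^ b : ℂ[X]) =
      (X + C (t + s)) ^ a * (X + C (t + r)) ^ b := by
    intro a b s r t
    simp [taylor_mul, taylor_pow, add_assoc]
  rw [h0]
  rcases lt_trichotomy m m' with h | rfl | h
  · rw [if_neg h.ne, eval_transvectant_eq hf hg 0 (-I), eval_transvectant]
    refine Finset.sum_eq_zero fun k hk => ?_
    have hk' : k ≤ l := Nat.lt_succ_iff.mp (Finset.mem_range.mp hk)
    simp only [f, g, ht, neg_add_cancel, C_0, add_zero]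
    rcases lt_or_ge k m' with hkm | hkm
    · rw [mul_comm ((X + C (-I + -I)) ^ (l - m')), coeff_X_pow_mul_of_lt hkm]
      simp
    · rw [coeff_X_pow_mul_of_lt (by omega)]
      simp
  · rw [if_pos rfl, eval_transvectant_eq hf hg 0 (-I), eval_transvectant,
      Finset.sum_eq_single_of_mem m (Finset.mem_range.mpr (by omega))]
    · simp only [f, g, ht, neg_add_cancel, C_0, add_zero]
      rw [mul_comm ((X + C (-I + -I)) ^ (l - m)), coeff_X_pow_mul', coeff_X_pow_mul', if_pos le_rfl,
        if_pos le_rfl, Nat.sub_self, Nat.sub_self, coeff_zero_eq_eval_zero, coeff_zero_eq_eval_zero]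
      simp only [eval_pow, eval_add, eval_X, eval_C, zero_add]
      have : (-2 * I) ^ l = (-I + -I) ^ m * (-I + -I) ^ (l - m) := by
        rw [← pow_add, show m + (l - m) = l by omega]
        ring
      rw [this]
      ring
    · intro k hk hkm
      have hk' : k ≤ l := Nat.lt_succ_iff.mp (Finset.mem_range.mp hk)
      simp only [f, g, ht, neg_add_cancel, C_0, add_zero]
      rcases lt_or_gt_of_ne hkm with hlt | hlt
      · rw [mul_comm ((X + C (-I + -I)) ^ (l - m)), coeff_X_pow_mul_of_lt hlt]
        simp
      · rw [coeff_X_pow_mul_of_lt (by omega)]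
        simp
  · rw [if_neg h.ne', eval_transvectant_eq hf hg 0 I, eval_transvectant]
    refine Finset.sum_eq_zero fun k hk => ?_
    have hk' : k ≤ l := Nat.lt_succ_iff.mp (Finset.mem_range.mp hk)
    simp only [f, g, ht, add_neg_cancel, C_0, add_zero]
    rcases lt_or_ge k (l - m') with hkm | hkm
    · rw [coeff_X_pow_mul_of_lt hkm]
      simp
    · rw [mul_comm ((X + C (I + I)) ^ (l - m)), coeff_X_pow_mul_of_lt (show l - k < m by omega)]
      simp

/-- The vectors `hodgeVec l m` form a basis of a Jordan block. -/
theorem linearIndependent_hodgeVec (l : ℕ) :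
    LinearIndependent ℂ fun m : Fin (l + 1) => hodgeVec l m := by
  rw [Fintype.linearIndependent_iff]
  intro c hc m'
  have hle : ∀ m : Fin (l + 1), (m : ℕ) ≤ l := fun m => Nat.lt_succ_iff.mp m.2
  have h1 : ∑ m : Fin (l + 1), c m * ∑ i : Fin (l + 1), (-1) ^ (i : ℕ) *
      (hodgeVec l m i * starRingEnd ℂ (hodgeVec l m' i.rev)) = 0 := by
    simp only [Finset.mul_sum]
    rw [Finset.sum_comm]
    refine Finset.sum_eq_zero fun i _ => ?_
    have h2 := congrFun hc i
    simp only [Finset.sum_apply, Pi.smul_apply, smul_eq_mul, Pi.zero_apply] at h2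
    have h3 : ∑ m : Fin (l + 1), c m * ((-1) ^ (i : ℕ) *
        (hodgeVec l m i * starRingEnd ℂ (hodgeVec l m' i.rev))) =
        (∑ m : Fin (l + 1), c m * hodgeVec l m i) *
          ((-1) ^ (i : ℕ) * starRingEnd ℂ (hodgeVec l m' i.rev)) := by
      rw [Finset.sum_mul]
      exact Finset.sum_congr rfl fun m _ => by ring
    rw [h3, h2, zero_mul]
  rw [Fintype.sum_eq_single m'] at h1
  · rw [sum_hodgeVec (hle m') (hle m'), if_pos rfl] at h1
    have h4 : (-1 : ℂ) ^ (m' : ℕ) * ((l - m').factorial * (m' : ℕ).factorial) *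
        (-2 * Complex.I) ^ l ≠ 0 := by
      have := Nat.factorial_ne_zero (l - m')
      have := Nat.factorial_ne_zero m'
      simp_all [Complex.I_ne_zero]
    exact (mul_eq_zero.mp h1).resolve_right h4
  · intro m hm
    rw [sum_hodgeVec (hle m) (hle m'), if_neg (fun e => hm (Fin.ext e)), mul_zero]

end StringModel

end DegenerationHodge

/-! ### Rescaling by weight and the limits of twisted filtrations. -/

namespace DegenerationHodge

noncomputable section Scaling

set_option linter.unusedSectionVars false

variable {X : Type*} [AddCommGroup X] [Module ℂ X]
  {N : Module.End ℂ X} {d : ℤ} {W F F' : ℤ → Submodule ℂ X}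
  {ι : Type*} [Fintype ι] {A : ι → ℤ} {l : ι → ℕ} {v : ι → X}

/-- The basis of the vectors `N^j v_σ`, `j ≤ l σ`. -/
def IsStringFamily.basis (h : IsOpposedTriple N d W F F')
    (hs : IsStringFamily N d W F F' A l v) : Module.Basis (Σ σ, Fin (l σ + 1)) ℂ X :=
  .mk (hs.linearIndependent h) (by
    obtain ⟨p, hp⟩ := h.hodge_top
    obtain ⟨k, hk⟩ := h.top
    have h1 := hs.inf_le_span h p k
    rw [hp, hk, top_inf_eq] at h1
    refine h1.trans (Submodule.span_mono ?_)
    rintro _ ⟨σ, j, hj, -, -, rfl⟩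
    exact ⟨⟨σ, ⟨j, Nat.lt_succ_of_le hj⟩⟩, rfl⟩)

theorem IsStringFamily.basis_apply (h : IsOpposedTriple N d W F F')
    (hs : IsStringFamily N d W F F' A l v) (x : Σ σ, Fin (l σ + 1)) :
    hs.basis h x = (N ^ (x.2 : ℕ)) (v x.1) := by
  rw [IsStringFamily.basis, Module.Basis.mk_apply]

theorem IsStringFamily.repr_eq_zero (h : IsOpposedTriple N d W F F')
    (hs : IsStringFamily N d W F F' A l v) {p k : ℤ} {u : X} (hu : u ∈ F p ⊓ W k)
    (x : Σ σ, Fin (l σ + 1)) (hx : A x.1 - (x.2 : ℕ) < p ∨ k < d + l x.1 - 2 * (x.2 : ℕ)) :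
    (hs.basis h).repr u x = 0 := by
  classical
  have h1 := hs.inf_le_span h p k hu
  clear hu
  induction h1 using Submodule.span_induction with
  | mem y hy =>
    obtain ⟨σ, j, hj, h1, h2, rfl⟩ := hy
    have h3 : (N ^ j) (v σ) = hs.basis h ⟨σ, ⟨j, Nat.lt_succ_of_le hj⟩⟩ := by
      rw [basis_apply]
    rw [h3, Module.Basis.repr_self, Finsupp.single_apply, if_neg]
    rintro rfl
    dsimp only at hx
    omega
  | zero => simp
  | add y z _ _ hy hz => simp [hy, hz]
  | smul a y _ hy => simp [hy]

/-- Rescaled coordinates with respect to the basis `N^j v_σ`. -/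
def scaleEquiv {κ : Type*} [Fintype κ] (b : Module.Basis κ ℂ X) (w : κ → ℤ) (t : ℝ) (ht : t ≠ 0) :
    X ≃ₗ[ℂ] (κ → ℂ) :=
  b.equivFun ≪≫ₗ LinearEquiv.piCongrRight fun x =>
    LinearEquiv.smulOfNeZero ℂ ℂ ((t : ℂ) ^ w x) (zpow_ne_zero _ (Complex.ofReal_ne_zero.mpr ht))

theorem scaleEquiv_apply {κ : Type*} [Fintype κ] (b : Module.Basis κ ℂ X) (w : κ → ℤ) (t : ℝ)
    (ht : t ≠ 0) (u : X) (x : κ) : scaleEquiv b w t ht u x = (t : ℂ) ^ w x * b.repr u x := rfl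

theorem scaleEquiv_symm_single {κ : Type*} [Fintype κ] [DecidableEq κ] (b : Module.Basis κ ℂ X)
    (w : κ → ℤ) (t : ℝ) (ht : t ≠ 0) (x : κ) :
    (scaleEquiv b w t ht).symm (Pi.single x 1) = (t : ℂ) ^ (-w x) • b x := by
  have ht' : (t : ℂ) ≠ 0 := Complex.ofReal_ne_zero.mpr ht
  rw [LinearEquiv.symm_apply_eq]
  ext y
  rw [scaleEquiv_apply, map_smul, Module.Basis.repr_self, Finsupp.smul_apply, smul_eq_mul,
    Finsupp.single_apply, Pi.single_apply]
  by_cases hxy : x = y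
  · subst hxy
    rw [if_pos rfl, mul_one, ← zpow_add₀ ht']
    simp
  · rw [if_neg hxy, if_neg (Ne.symm hxy)]
    simp

/-- The inclusion of the coordinates of one string. -/
def stringIncl [DecidableEq ι] (l : ι → ℕ) (σ : ι) :
    (Fin (l σ + 1) → ℂ) →ₗ[ℂ] ((Σ σ, Fin (l σ + 1)) → ℂ) :=
  Fintype.linearCombination ℂ fun i => Pi.single ⟨σ, i⟩ (1 : ℂ)

theorem stringIncl_apply_self [DecidableEq ι] (σ : ι) (g : Fin (l σ + 1) → ℂ) (i : Fin (l σ + 1)) :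
    stringIncl l σ g ⟨σ, i⟩ = g i := by
  rw [stringIncl, Fintype.linearCombination_apply, Finset.sum_apply, Fintype.sum_eq_single i]
  · simp
  · intro j hj
    have : (⟨σ, i⟩ : Σ σ, Fin (l σ + 1)) ≠ ⟨σ, j⟩ := by
      rintro e; cases e; exact hj rfl
    simp [this]

theorem stringIncl_apply_of_ne [DecidableEq ι] {σ τ : ι} (hτ : τ ≠ σ) (g : Fin (l σ + 1) → ℂ)
    (i : Fin (l τ + 1)) : stringIncl l σ g ⟨τ, i⟩ = 0 := by
  rw [stringIncl, Fintype.linearCombination_apply, Finset.sum_apply]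
  refine Finset.sum_eq_zero fun j _ => ?_
  have : (⟨τ, i⟩ : Σ σ, Fin (l σ + 1)) ≠ ⟨σ, j⟩ := by
    rintro e; cases e; exact hτ rfl
  simp [this]

variable {α : Type*} {f : Filter α} {t : α → ℝ}

/-- The vectors `r z` tend to zero faster than all powers of `t z`. -/
def RapidDecay (f : Filter α) (t : α → ℝ) (r : α → X) : Prop :=
  ∀ (ℓ : Module.Dual ℂ X) (n : ℤ), Tendsto (fun z => (t z : ℂ) ^ n * ℓ (r z)) f (𝓝 0)

/-- Every vector of `G₀` is the limit, approached rapidly, of vectors of the subspaces `G z`. -/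
def RapidConv (f : Filter α) (t : α → ℝ) (G : α → Submodule ℂ X) (G₀ : Submodule ℂ X) : Prop :=
  ∀ u ∈ G₀, ∃ r : α → X, RapidDecay f t r ∧ ∀ᶠ z in f, u + r z ∈ G z

theorem tendsto_zpow_mul_of_neg (ht : Tendsto t f atTop) {n : ℤ} (hn : n < 0) (a : ℂ) :
    Tendsto (fun z => (t z : ℂ) ^ n * a) f (𝓝 0) := by
  have h1 : Tendsto (fun z => (t z) ^ n) f (𝓝 0) := (tendsto_zpow_atTop_zero hn).comp ht
  have h2 := ((Complex.continuous_ofReal.tendsto 0).comp h1).mul_const a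
  simpa [Function.comp_def] using h2

section

variable (h : IsOpposedTriple N d W F F') (hs : IsStringFamily N d W F F' A l v)

/-- The coordinates rescaled by the weight. -/
def IsStringFamily.scale (t : ℝ) (ht : t ≠ 0) : X ≃ₗ[ℂ] ((Σ σ, Fin (l σ + 1)) → ℂ) :=
  scaleEquiv (hs.basis h) (fun x => (l x.1 : ℤ) - 2 * (x.2 : ℕ)) t ht

/-- A coordinate of weight `w` is multiplied by `t^(w-d)`, so after normalizing by `t^(d-k)` all
weights below `k` carry negative powers of `t`. Errors of lower weight disappear in this way. -/
theorem IsStringFamily.tendsto_scale_of_mem (ht : Tendsto t f atTop) (ht0 : ∀ z, t z ≠ 0) {k : ℤ}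
    {u : X} (hu : u ∈ W (k - 1)) :
    Tendsto (fun z => (t z : ℂ) ^ (d - k) • hs.scale h (t z) (ht0 z) u) f (𝓝 0) := by
  refine tendsto_pi_nhds.mpr fun x => ?_
  obtain ⟨p, hp⟩ := h.hodge_top
  simp only [Pi.smul_apply, IsStringFamily.scale, scaleEquiv_apply, smul_eq_mul, Pi.zero_apply]
  by_cases hx : k - 1 < d + l x.1 - 2 * (x.2 : ℕ)
  · rw [hs.repr_eq_zero h (p := p) (k := k - 1) ⟨hp ▸ trivial, hu⟩ x (Or.inr hx)]
    simpa using tendsto_const_nhds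
  · refine (tendsto_zpow_mul_of_neg ht (n := d - k + (l x.1 - 2 * (x.2 : ℕ))) (by omega)
      ((hs.basis h).repr u x)).congr fun z => ?_
    rw [zpow_add₀ (Complex.ofReal_ne_zero.mpr (ht0 z)), mul_assoc]

theorem IsStringFamily.zpow_smul_scale_pow (t : ℝ) (ht : t ≠ 0) [DecidableEq ι] {σ : ι} {j : ℕ}
    (hj : j < l σ + 1) : (t : ℂ) ^ (2 * j - l σ : ℤ) • hs.scale h t ht ((N ^ j) (v σ)) =
      Pi.single ⟨σ, ⟨j, hj⟩⟩ 1 := by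
  have h1 := scaleEquiv_symm_single (hs.basis h) (fun x => (l x.1 : ℤ) - 2 * (x.2 : ℕ)) t ht
    ⟨σ, ⟨j, hj⟩⟩
  rw [LinearEquiv.symm_apply_eq, map_smul, basis_apply, neg_sub] at h1
  exact h1.symm

/-- Only the class of `u` in the graded space matters for the limit. This covers both the lifts in
`F` and those in the conjugate filtration. -/
theorem IsStringFamily.tendsto_scale_pow (ht : Tendsto t f atTop) (ht0 : ∀ z, t z ≠ 0)
    [DecidableEq ι] {σ : ι} {u : X} (hu : u - v σ ∈ W (d + l σ - 1)) (j : ℕ) :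
    Tendsto (fun z => (t z : ℂ) ^ (2 * j - l σ : ℤ) • hs.scale h (t z) (ht0 z) ((N ^ j) u)) f
      (𝓝 (if hj : j < l σ + 1 then Pi.single ⟨σ, ⟨j, hj⟩⟩ 1 else 0)) := by
  have h1 : Tendsto (fun z => (t z : ℂ) ^ (2 * j - l σ : ℤ) •
      hs.scale h (t z) (ht0 z) ((N ^ j) (u - v σ))) f (𝓝 0) := by
    have := pow_shift h.shift j _ _ hu
    rw [show d + (l σ : ℤ) - 1 - 2 * j = (d + l σ - 2 * j) - 1 by ring] at this
    have h2 := hs.tendsto_scale_of_mem h ht ht0 this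
    rwa [show d - (d + (l σ : ℤ) - 2 * j) = 2 * j - l σ by ring] at h2
  have h2 : Tendsto (fun z => (t z : ℂ) ^ (2 * j - l σ : ℤ) •
      hs.scale h (t z) (ht0 z) ((N ^ j) (v σ))) f
      (𝓝 (if hj : j < l σ + 1 then Pi.single ⟨σ, ⟨j, hj⟩⟩ 1 else 0)) := by
    split_ifs with hj
    · exact tendsto_const_nhds.congr fun z => (hs.zpow_smul_scale_pow h _ _ hj).symm
    · have := hs.pow_weight_of_lt h σ (j := j) (by omega)
      have h2 := hs.tendsto_scale_of_mem h ht ht0 this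
      rwa [show d - (d + (l σ : ℤ) - 2 * j) = 2 * j - l σ by ring] at h2
  have h3 := h2.add h1
  rw [add_zero] at h3
  refine h3.congr fun z => ?_
  rw [← smul_add, ← map_add, ← map_add, add_sub_cancel]

theorem IsStringFamily.tendsto_scale_rapidDecay (ht0 : ∀ z, t z ≠ 0) {r : α → X}
    (hr : RapidDecay f t r) (n : ℤ) (L : X →ₗ[ℂ] X) :
    Tendsto (fun z => (t z : ℂ) ^ n • hs.scale h (t z) (ht0 z) (L (r z))) f (𝓝 0) := by
  refine tendsto_pi_nhds.mpr fun x => ?_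
  refine (hr ((hs.basis h).coord x ∘ₗ L) (n + (l x.1 - 2 * (x.2 : ℕ)))).congr fun z => ?_
  rw [zpow_add₀ (Complex.ofReal_ne_zero.mpr (ht0 z)), mul_assoc]
  rfl

/-- The rescaled exponential orbit of a vector close to `N^j v_σ` converges to the exponential orbit
in the corresponding Jordan block. -/
theorem IsStringFamily.tendsto_scale_nilExp [DecidableEq ι] (hN : IsNilpotent N)
    (ht : Tendsto t f atTop) (ht0 : ∀ z, t z ≠ 0) {σ : ι} {u : X}
    (hu : u - v σ ∈ W (d + l σ - 1)) (j : ℕ) {r : α → X} (hr : RapidDecay f t r) (s : ℂ) :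
    Tendsto (fun z => (t z : ℂ) ^ (2 * j - l σ : ℤ) • hs.scale h (t z) (ht0 z)
      (nilExp ((s * (t z : ℂ) ^ 2) • N) ((N ^ j) u + r z))) f
      (𝓝 (stringIncl l σ (blockExp (l σ) s j))) := by
  obtain ⟨K₀, hK₀⟩ := hN
  -- `K` exceeds the nilpotency order of `N`, so that the exponential is a finite sum with a fixed
  -- number of terms, and the length of the string, so that this sum covers the whole block.
  obtain ⟨K, hK, hKl⟩ : ∃ K, N ^ K = 0 ∧ l σ < K :=
    ⟨K₀ + (l σ + 1), by rw [pow_add, hK₀, zero_mul], by omega⟩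
  have h1 : ∀ n ∈ Finset.range K, Tendsto (fun z => (s ^ n / (n.factorial : ℂ)) •
      ((t z : ℂ) ^ (2 * ((j + n : ℕ) : ℤ) - l σ : ℤ) • hs.scale h (t z) (ht0 z) ((N ^ (j + n)) u) +
        (t z : ℂ) ^ (2 * ((j + n : ℕ) : ℤ) - l σ : ℤ) •
          hs.scale h (t z) (ht0 z) ((N ^ n) (r z)))) f
      (𝓝 ((s ^ n / (n.factorial : ℂ)) • ((if hj : j + n < l σ + 1 then
        Pi.single ⟨σ, ⟨j + n, hj⟩⟩ 1 else 0) + 0))) := fun n _ =>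
    ((hs.tendsto_scale_pow h ht ht0 hu (j + n)).add
      (hs.tendsto_scale_rapidDecay h ht0 hr _ (N ^ n))).const_smul _
  have h2 := tendsto_finsetSum _ h1
  have h3 : ∑ n ∈ Finset.range K, (s ^ n / (n.factorial : ℂ)) • ((if hj : j + n < l σ + 1 then
        (Pi.single (⟨σ, ⟨j + n, hj⟩⟩ : Σ σ, Fin (l σ + 1)) (1 : ℂ) : (Σ σ, Fin (l σ + 1)) → ℂ)
          else 0) + 0) = stringIncl l σ (blockExp (l σ) s j) := by
    ext ⟨τ, i⟩
    rw [Finset.sum_apply]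
    by_cases hτ : τ = σ
    · subst hτ
      rw [stringIncl_apply_self, blockExp]
      have hi := i.2
      have h5 : ∀ n, ((s ^ n / (n.factorial : ℂ)) • ((if hj : j + n < l τ + 1 then
        (Pi.single (⟨τ, ⟨j + n, hj⟩⟩ : Σ σ, Fin (l σ + 1)) (1 : ℂ) : (Σ σ, Fin (l σ + 1)) → ℂ)
          else 0) + 0)) ⟨τ, i⟩ = if j + n = i then s ^ n / (n.factorial : ℂ) else 0 := by
        intro n
        split_ifs with h6 h7 h7
        · have : (⟨τ, ⟨j + n, h6⟩⟩ : Σ σ, Fin (l σ + 1)) = ⟨τ, i⟩ :=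
            congrArg (Sigma.mk τ) (Fin.ext h7)
          rw [this]
          simp
        · have : (⟨τ, i⟩ : Σ σ, Fin (l σ + 1)) ≠ ⟨τ, ⟨j + n, h6⟩⟩ := by
            intro e; cases e; exact h7 rfl
          simp [this]
        · omega
        · simp
      simp only [h5]
      split_ifs with hji
      · rw [Finset.sum_eq_single_of_mem ((i : ℕ) - j) (Finset.mem_range.mpr (by omega)),
          if_pos (by omega)]
        intro n _ hn
        rw [if_neg (by omega)]
      · exact Finset.sum_eq_zero fun n _ => if_neg (by omega)
    · rw [stringIncl_apply_of_ne hτ]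
      refine Finset.sum_eq_zero fun n _ => ?_
      split_ifs with h6
      · have : (⟨τ, i⟩ : Σ σ, Fin (l σ + 1)) ≠ ⟨σ, ⟨j + n, h6⟩⟩ := by
          intro e; cases e; exact hτ rfl
        simp [this]
      · simp
  rw [h3] at h2
  refine h2.congr fun z => ?_
  have htz : (t z : ℂ) ≠ 0 := Complex.ofReal_ne_zero.mpr (ht0 z)
  rw [nilExp_eq_sum (k := K) (by rw [smul_pow, hK, smul_zero]), LinearMap.sum_apply, map_sum,
    Finset.smul_sum]
  refine Finset.sum_congr rfl fun n _ => ?_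
  rw [smul_pow, LinearMap.smul_apply, LinearMap.smul_apply, map_smul, map_smul, map_add, map_add,
    ← Module.End.mul_apply (N ^ n) (N ^ j), ← pow_add, add_comm n j, ← smul_add, smul_smul,
    smul_smul, smul_smul]
  congr 1
  -- The factor `(t²)^n` from the exponential is exactly the ratio of the normalizations of `N^(j+n)
  -- v` and `N^j v`; hence the choice of `t²` as the size of the twist.
  have h4 : (t z : ℂ) ^ (2 * ((j + n : ℕ) : ℤ) - l σ : ℤ) =
      (t z : ℂ) ^ (2 * j - l σ : ℤ) * ((t z : ℂ) ^ 2) ^ n := by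
    rw [← pow_mul, ← zpow_natCast, ← zpow_add₀ htz]
    congr 1
    push_cast; ring
  rw [h4, mul_pow]
  ring

/-- Filtrations that converge rapidly to a filtration `G` adapted to the strings: after twisting by
an exponential and rescaling they converge to the corresponding filtration of the Jordan blocks. -/
theorem IsStringFamily.lowConv_scale [DecidableEq ι] (hN : IsNilpotent N)
    (ht : Tendsto t f atTop) (ht0 : ∀ z, t z ≠ 0) {G : ℤ → Submodule ℂ X} {B : ι → ℤ}
    (hGanti : Antitone G) (hGN : ∀ p, ∀ x ∈ G p, N x ∈ G (p - 1))
    (hG : ∀ σ, ∃ u ∈ G (B σ), u - v σ ∈ W (d + l σ - 1)) {p : ℤ} {G' : α → Submodule ℂ X}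
    (hG' : RapidConv f t G' (G p)) (s : ℂ) :
    LowConv f (fun z => (G' z).map ((hs.scale h (t z) (ht0 z)).toLinearMap ∘ₗ
        nilExp ((s * (t z : ℂ) ^ 2) • N)))
      (Submodule.span ℂ {x | ∃ σ, ∃ j : ℕ, p ≤ B σ - j ∧
        x = stringIncl l σ (blockExp (l σ) s j)}) := by
  refine lowConv_span ?_
  rintro _ ⟨σ, j, hj, rfl⟩
  obtain ⟨u, hu, huv⟩ := hG σ
  have h1 : (N ^ j) u ∈ G p := by
    refine hGanti hj ?_
    clear hj
    induction j with
    | zero => simpa using hu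
    | succ j ih =>
      rw [pow_succ', Module.End.mul_apply]
      convert hGN _ _ ih using 2
      push_cast; ring
  obtain ⟨r, hr, hr'⟩ := hG' _ h1
  refine ⟨_, ?_, hs.tendsto_scale_nilExp h hN ht ht0 huv j hr s⟩
  filter_upwards [hr'] with z hz
  exact Submodule.smul_mem _ _ ⟨_, hz, rfl⟩

end

end Scaling

end DegenerationHodge

/-! ### Opposedness of the twisted filtrations near the cusp. -/

namespace DegenerationHodge

noncomputable section Opposed

set_option linter.unusedSectionVars false

variable {X : Type*} [AddCommGroup X] [Module ℂ X]
  {N : Module.End ℂ X} {d : ℤ} {W F F' : ℤ → Submodule ℂ X}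
  {ι : Type*} [Fintype ι] {A : ι → ℤ} {l : ι → ℕ} {v : ι → X}

theorem IsOpposedTriple.swap (h : IsOpposedTriple N d W F F') (htop : ∃ p, F' p = ⊤)
    (hbot : ∃ p, F' p = ⊥) : IsOpposedTriple N d W F' F where
  mono := h.mono
  bot := h.bot
  top := h.top
  anti := h.anti'
  hodge_top := htop
  hodge_bot := hbot
  anti' := h.anti
  sup k p := by
    have := h.sup k (k - p + 1)
    rwa [show k - (k - p + 1) + 1 = p by ring, sup_comm] at this
  inf k p := by
    have := h.inf k (k - p + 1)
    rwa [show k - (k - p + 1) + 1 = p by ring, inf_comm] at this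
  shift := h.shift
  hodge := h.hodge'
  hodge' := h.hodge
  inj := h.inj
  surj := h.surj

/-- The class of `v σ` in the graded space also has a representative in `F'`. All conditions on
strings except membership in the first filtration depend on that class only. -/
theorem IsStringFamily.exists_swap (h : IsOpposedTriple N d W F F')
    (hs : IsStringFamily N d W F F' A l v) :
    ∃ v' : ι → X, IsStringFamily N d W F' F (fun σ => d + l σ - A σ) l v' ∧
      ∀ σ, v' σ - v σ ∈ W (d + l σ - 1) := by
  have h1 : ∀ σ, ∃ u ∈ F' (d + l σ - A σ) ⊓ W (d + l σ), u - v σ ∈ W (d + l σ - 1) := by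
    intro σ
    obtain ⟨u, hu, w, hw, huw⟩ := Submodule.mem_sup.mp (hs.mem' σ)
    refine ⟨u, hu, ?_⟩
    rw [← huw, sub_add_cancel_left]
    exact neg_mem hw
  choose v' hv' hvv using h1
  refine ⟨v', ⟨fun σ => (hv' σ).1, fun σ => (hv' σ).2, ?_, ?_, ?_, ?_⟩, hvv⟩
  · intro σ
    rw [show d + (l σ : ℤ) - (d + l σ - A σ) = A σ by ring]
    have h2 : v σ ∈ grLayer W (F (A σ)) (d + l σ) :=
      Submodule.mem_sup_left ⟨hs.mem σ, hs.weight σ⟩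
    have := add_mem h2 (le_grLayer W (F (A σ)) _ (hvv σ))
    rwa [add_sub_cancel] at this
  · intro σ
    have h2 := pow_shift h.shift (l σ + 1) _ _ (hvv σ)
    rw [show d + (l σ : ℤ) - 1 - 2 * ((l σ + 1 : ℕ) : ℤ) = d - l σ - 3 by push_cast; ring] at h2
    have := add_mem (hs.pow σ) h2
    rwa [← map_add, add_sub_cancel] at this
  · intro a m u hu huN
    have hu' : u ∈ typeComp W F F' (d + m - a) (d + m) := by
      refine ⟨hu.2, ?_⟩
      rw [show d + (m : ℤ) - (d + m - a) = a by ring]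
      exact hu.1
    have h2 := hs.span _ _ u hu' huN
    have h5 : Submodule.span ℂ (v '' {σ | A σ = d + m - a ∧ l σ = m}) ⊔ W (d + m - 1) ≤
        Submodule.span ℂ (v' '' {σ | d + l σ - A σ = a ∧ l σ = m}) ⊔ W (d + m - 1) := by
      refine sup_le (Submodule.span_le.mpr ?_) le_sup_right
      rintro _ ⟨σ, ⟨h3, rfl⟩, rfl⟩
      have h4 : v σ = v' σ - (v' σ - v σ) := by abel
      rw [h4]
      exact sub_mem (Submodule.mem_sup_left (Submodule.subset_span
        ⟨σ, ⟨by omega, rfl⟩, rfl⟩)) (Submodule.mem_sup_right (hvv σ))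
    exact h5 h2
  · intro a m c hc σ hσ hσ'
    refine hs.indep (d + m - a) m c ?_ σ (by omega) hσ'
    have h2 : ∑ σ with d + l σ - A σ = a ∧ l σ = m, c σ • (v' σ - v σ) ∈ W (d + m - 1) :=
      Submodule.sum_mem _ fun τ hτ => Submodule.smul_mem _ _ (by
        have := (Finset.mem_filter.mp hτ).2.2
        rw [← this]; exact hvv τ)
    have h3 := sub_mem hc h2
    rw [← Finset.sum_sub_distrib] at h3
    convert h3 using 1
    refine Finset.sum_congr (Finset.filter_congr fun τ _ => ?_) fun τ _ => ?_
    · constructor <;> rintro ⟨h4, rfl⟩ <;> exact ⟨by omega, rfl⟩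
    · rw [smul_sub, sub_sub_cancel]

theorem IsStringFamily.finrank_eq (h : IsOpposedTriple N d W F F')
    (hs : IsStringFamily N d W F F' A l v) (p : ℤ) :
    Module.finrank ℂ (F p) =
      Nat.card {x : Σ σ, Fin (l σ + 1) // p ≤ A x.1 - (x.2 : ℕ)} := by
  classical
  have h1 : F p = Submodule.span ℂ (Set.range fun x : {x : Σ σ, Fin (l σ + 1) //
      p ≤ A x.1 - (x.2 : ℕ)} => (N ^ (x.1.2 : ℕ)) (v x.1.1)) := by
    apply le_antisymm
    · obtain ⟨k, hk⟩ := h.top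
      have h2 := hs.inf_le_span h p k
      rw [hk, inf_top_eq] at h2
      refine h2.trans (Submodule.span_mono ?_)
      rintro _ ⟨σ, j, hj, h3, -, rfl⟩
      exact ⟨⟨⟨σ, ⟨j, Nat.lt_succ_of_le hj⟩⟩, h3⟩, rfl⟩
    · rw [Submodule.span_le]
      rintro _ ⟨x, rfl⟩
      exact h.anti x.2 (hs.pow_hodge h _ _)
  rw [h1, Nat.card_eq_fintype_card]
  exact finrank_span_eq_card ((hs.linearIndependent h).comp _ Subtype.val_injective)

/-- The reflection of all strings. -/
def stringRev (l : ι → ℕ) : (Σ σ, Fin (l σ + 1)) ≃ Σ σ, Fin (l σ + 1) :=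
  Equiv.sigmaCongrRight fun _ => Fin.revPerm

/-- Position `j` in the conjugate strings corresponds to position `l - j` in the given ones, and
under this reflection the two conditions are complementary when `p + q = d + 1`. -/
theorem card_stringRev (p q : ℤ) (hpq : p + q = d + 1) :
    Nat.card {x : Σ σ, Fin (l σ + 1) // q ≤ d + l x.1 - A x.1 - (x.2 : ℕ)} =
      Nat.card {x : Σ σ, Fin (l σ + 1) // ¬ p ≤ A x.1 - (x.2 : ℕ)} := by
  refine Nat.card_congr ((stringRev l).subtypeEquiv ?_)
  rintro ⟨σ, j⟩
  have := j.2
  change _ ↔ ¬ p ≤ A σ - ((Fin.rev j : Fin (l σ + 1)) : ℕ)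
  rw [Fin.val_rev]
  dsimp only
  omega

section Limit

variable [DecidableEq ι]

theorem stringIncl_hodgeVec_mem {p : ℤ} {σ : ι} {m : ℕ} (hm : m ≤ l σ) {B : ι → ℤ}
    (hp : p ≤ B σ - m) : stringIncl l σ (hodgeVec (l σ) m) ∈
      Submodule.span ℂ {x | ∃ σ, ∃ j : ℕ, p ≤ B σ - j ∧
        x = stringIncl l σ (blockExp (l σ) Complex.I j)} := by
  have h1 := Submodule.mem_map_of_mem (f := stringIncl l σ) (hodgeVec_mem_span hm)
  rw [Submodule.map_span] at h1
  refine Submodule.span_mono ?_ h1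
  rintro _ ⟨_, ⟨j, hj, rfl⟩, rfl⟩
  have : j ≤ m := hj
  exact ⟨σ, j, by omega, rfl⟩

theorem stringIncl_hodgeVec_mem_neg {q : ℤ} {σ : ι} {m : ℕ} (hm : m ≤ l σ) {B : ι → ℤ}
    (hq : q ≤ B σ - (l σ - m)) : stringIncl l σ (hodgeVec (l σ) m) ∈
      Submodule.span ℂ {x | ∃ σ, ∃ j : ℕ, q ≤ B σ - j ∧
        x = stringIncl l σ (blockExp (l σ) (-Complex.I) j)} := by
  have h1 := Submodule.mem_map_of_mem (f := stringIncl l σ) (hodgeVec_mem_span_neg hm)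
  rw [Submodule.map_span] at h1
  refine Submodule.span_mono ?_ h1
  rintro _ ⟨_, ⟨j, hj, rfl⟩, rfl⟩
  have : j ≤ l σ - m := hj
  exact ⟨σ, j, by omega, rfl⟩

theorem span_stringIncl_hodgeVec : Submodule.span ℂ (Set.range fun x : Σ σ, Fin (l σ + 1) =>
    stringIncl l x.1 (hodgeVec (l x.1) x.2)) = ⊤ := by
  apply LinearIndependent.span_eq_top_of_card_eq_finrank'
  · rw [Fintype.linearIndependent_iff]
    rintro c hc ⟨τ, m⟩
    have h1 : ∑ m : Fin (l τ + 1), c ⟨τ, m⟩ • hodgeVec (l τ) m = 0 := by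
      ext i
      have h2 := congrFun hc ⟨τ, i⟩
      rw [Fintype.sum_sigma, Finset.sum_apply, Fintype.sum_eq_single τ] at h2
      · rw [Finset.sum_apply] at h2 ⊢
        refine Eq.trans ?_ h2
        refine Finset.sum_congr rfl fun m _ => ?_
        rw [Pi.smul_apply, Pi.smul_apply, stringIncl_apply_self]
      · intro σ hσ
        rw [Finset.sum_apply]
        refine Finset.sum_eq_zero fun m _ => ?_
        rw [Pi.smul_apply, stringIncl_apply_of_ne hσ.symm, smul_zero]
    exact Fintype.linearIndependent_iff.mp (linearIndependent_hodgeVec (l τ)) _ h1 m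
  · simp

/-- Each basis vector `hodgeVec` of a string lies in one of the two filtrations: in the first if `p
≤ A σ - m`, and otherwise in the second, because then `A σ - m ≤ p - 1 ≤ d - q`. -/
theorem limit_sup_eq_top (d : ℤ) (p q : ℤ) (hpq : p + q ≤ d + 1) :
    Submodule.span ℂ {x | ∃ σ, ∃ j : ℕ, p ≤ A σ - j ∧
        x = stringIncl l σ (blockExp (l σ) Complex.I j)} ⊔
      Submodule.span ℂ {x | ∃ σ, ∃ j : ℕ, q ≤ d + l σ - A σ - j ∧
        x = stringIncl l σ (blockExp (l σ) (-Complex.I) j)} = ⊤ := by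
  rw [eq_top_iff, ← span_stringIncl_hodgeVec, Submodule.span_le]
  rintro _ ⟨⟨σ, m⟩, rfl⟩
  have hm : (m : ℕ) ≤ l σ := Nat.lt_succ_iff.mp m.2
  rcases le_or_gt p (A σ - (m : ℕ)) with hp | hp
  · exact Submodule.mem_sup_left (stringIncl_hodgeVec_mem hm hp)
  · exact Submodule.mem_sup_right
      (stringIncl_hodgeVec_mem_neg (B := fun σ => d + l σ - A σ) hm (by omega))

end Limit

variable {α : Type*} {f : Filter α} {t : α → ℝ}

/-- A family of filtrations of constant dimensions converging rapidly to `F`. -/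
structure IsRapidFamily (f : Filter α) (t : α → ℝ) (F : ℤ → Submodule ℂ X)
    (G : ℤ → α → Submodule ℂ X) : Prop where
  anti : ∀ z, Antitone fun p => G p z
  conv : ∀ p, RapidConv f t (G p) (F p)
  finrank : ∀ p, ∀ᶠ z in f, Module.finrank ℂ (G p z) = Module.finrank ℂ (F p)

/-- The twist of a filtration by `exp(i t² N)`. -/
def twist (N : Module.End ℂ X) (t : α → ℝ) (G : ℤ → α → Submodule ℂ X) (z : α) (p : ℤ) :
    Submodule ℂ X :=
  (G p z).map (nilExp ((Complex.I * (t z : ℂ) ^ 2) • N))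

theorem nilExp_injective {A : Module.End ℂ X} (hA : IsNilpotent A) :
    Function.Injective (nilExp A) :=
  Function.LeftInverse.injective (g := nilExp (-A)) fun u => nilExp_neg_apply hA u

theorem finrank_twist (hN : IsNilpotent N) (G : ℤ → α → Submodule ℂ X) (z : α) (p : ℤ) :
    Module.finrank ℂ (twist N t G z p) = Module.finrank ℂ (G p z) :=
  (Submodule.equivMapOfInjective _ (nilExp_injective (hN.smul_end _)) _).finrank_eq.symm

variable {c : X →ₛₗ[starRingEnd ℂ] X}

theorem conjSub_twist (hN : IsNilpotent N) (hcN : ∀ x, N (c x) = c (N x))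
    (G : ℤ → α → Submodule ℂ X) (z : α) (p : ℤ) :
    conjSub c (twist N t G z p) =
      (conjSub c (G p z)).map (nilExp ((-Complex.I * (t z : ℂ) ^ 2) • N)) := by
  have h1 : starRingEnd ℂ (Complex.I * (t z : ℂ) ^ 2) = -Complex.I * (t z : ℂ) ^ 2 := by simp
  ext x
  constructor
  · rintro ⟨_, ⟨u, hu, rfl⟩, rfl⟩
    rw [conj_nilExp_smul hN hcN, h1]
    exact ⟨c u, ⟨u, hu, rfl⟩, rfl⟩
  · rintro ⟨_, ⟨u, hu, rfl⟩, rfl⟩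
    rw [← h1, ← conj_nilExp_smul hN hcN]
    exact ⟨_, ⟨u, hu, rfl⟩, rfl⟩

theorem finrank_conjSub [FiniteDimensional ℂ X] (hc : ∀ x, c (c x) = x) (B : Submodule ℂ X) :
    Module.finrank ℂ (conjSub c B) = Module.finrank ℂ B := by
  have key : ∀ B : Submodule ℂ X, Module.finrank ℂ (conjSub c B) ≤ Module.finrank ℂ B := by
    intro B
    let b := Module.finBasis ℂ B
    have h1 : conjSub c B ≤ Submodule.span ℂ (Set.range fun i => c (b i)) := by
      rintro _ ⟨u, hu, rfl⟩
      have h2 := congrArg (fun x : B => c x) (b.sum_repr ⟨u, hu⟩)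
      simp only [Submodule.coe_sum, Submodule.coe_smul, map_sum, map_smulₛₗ] at h2
      rw [← h2]
      exact Submodule.sum_mem _ fun i _ => Submodule.smul_mem _ _
        (Submodule.subset_span ⟨i, rfl⟩)
    exact (Submodule.finrank_mono h1).trans ((finrank_range_le_card _).trans (by simp))
  refine le_antisymm (key B) ?_
  have h1 := key (conjSub c B)
  have h2 : conjSub c (conjSub c B) = B := by
    ext x
    rw [mem_conjSub_iff hc, mem_conjSub_iff hc, hc]
  rwa [h2] at h1

theorem RapidDecay.conj {r : α → X} (hr : RapidDecay f t r) (c : X →ₛₗ[starRingEnd ℂ] X) :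
    RapidDecay f t fun z => c (r z) := by
  intro ℓ n
  let ℓ' : Module.Dual ℂ X :=
    { toFun := fun u => starRingEnd ℂ (ℓ (c u))
      map_add' := fun u w => by simp
      map_smul' := fun a u => by simp }
  have h1 := (Complex.continuous_conj.tendsto 0).comp (hr ℓ' n)
  rw [map_zero] at h1
  refine h1.congr fun z => ?_
  simp [ℓ']

theorem RapidConv.conj {G : α → Submodule ℂ X} {G₀ : Submodule ℂ X} (h : RapidConv f t G G₀)
    (c : X →ₛₗ[starRingEnd ℂ] X) :
    RapidConv f t (fun z => conjSub c (G z)) (conjSub c G₀) := by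
  rintro _ ⟨u, hu, rfl⟩
  obtain ⟨r, hr, hr'⟩ := h u hu
  refine ⟨_, hr.conj c, hr'.mono fun z hz => ?_⟩
  rw [← map_add]
  exact ⟨_, hz, rfl⟩

theorem conjSub_top (hc : ∀ x, c (c x) = x) : conjSub c ⊤ = ⊤ :=
  eq_top_iff.mpr fun x _ => ⟨c x, trivial, hc x⟩

theorem conjSub_bot : conjSub c ⊥ = ⊥ := Submodule.map_bot c

section

variable (h : IsOpposedTriple N d W F fun p => conjSub c (F p))
  (hs : IsStringFamily N d W F (fun p => conjSub c (F p)) A l v)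
  (hc : ∀ x, c (c x) = x) (hcN : ∀ x, N (c x) = c (N x)) (hN : IsNilpotent N)
  (ht : Tendsto t f atTop) (ht0 : ∀ z, t z ≠ 0) {G : ℤ → α → Submodule ℂ X}
  (hG : IsRapidFamily f t F G)

include hG hN ht in
theorem IsStringFamily.lowConv_twist [DecidableEq ι] (p : ℤ) :
    LowConv f (fun z => (twist N t G z p).map (hs.scale h (t z) (ht0 z)).toLinearMap)
      (Submodule.span ℂ {x | ∃ σ, ∃ j : ℕ, p ≤ A σ - j ∧
        x = stringIncl l σ (blockExp (l σ) Complex.I j)}) := by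
  have h1 := hs.lowConv_scale h hN ht ht0 h.anti h.hodge (B := A)
    (fun σ => ⟨v σ, hs.mem σ, by simp⟩) (hG.conv p) Complex.I
  simpa only [Submodule.map_comp, twist] using h1

-- Conjugation turns `exp(i t² N)` into `exp(-i t² N)`. The strings that start in the conjugate
-- filtration differ from the `v σ` by lower weight, so the same rescaled coordinates give the
-- limit.
include hG hN ht hcN in
theorem IsStringFamily.lowConv_conj_twist [DecidableEq ι] (p : ℤ) :
    LowConv f (fun z => (conjSub c (twist N t G z p)).map (hs.scale h (t z) (ht0 z)).toLinearMap)
      (Submodule.span ℂ {x | ∃ σ, ∃ j : ℕ, p ≤ d + l σ - A σ - j ∧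
        x = stringIncl l σ (blockExp (l σ) (-Complex.I) j)}) := by
  obtain ⟨v', hv', hvv⟩ := hs.exists_swap h
  have h1 := hs.lowConv_scale h hN ht ht0 h.anti' h.hodge' (B := fun σ => d + l σ - A σ)
    (fun σ => ⟨v' σ, hv'.mem σ, hvv σ⟩) ((hG.conv p).conj c) (-Complex.I)
  simpa only [Submodule.map_comp, conjSub_twist hN hcN] using h1

include hs h hG hN ht ht0 hcN in
theorem IsStringFamily.eventually_sup_eq_top (p q : ℤ) (hpq : p + q ≤ d + 1) :
    ∀ᶠ z in f, twist N t G z p ⊔ conjSub c (twist N t G z q) = ⊤ := by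
  classical
  filter_upwards [(hs.lowConv_twist h hN ht ht0 hG p).eventually_sup_eq_top
    (hs.lowConv_conj_twist h hcN hN ht ht0 hG q) (limit_sup_eq_top d p q hpq)] with z hz
  rw [← Submodule.map_sup] at hz
  apply Submodule.map_injective_of_injective (hs.scale h (t z) (ht0 z)).injective
  rw [hz, Submodule.map_top, LinearEquiv.range]

include hs h hc in
theorem IsStringFamily.finrank_add (p q : ℤ) (hpq : p + q = d + 1) :
    Module.finrank ℂ (F p) + Module.finrank ℂ (F q) = Module.finrank ℂ X := by
  classical
  have := Module.Finite.of_basis (hs.basis h)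
  obtain ⟨p₀, hp₀⟩ := h.hodge_top
  obtain ⟨p₁, hp₁⟩ := h.hodge_bot
  have hsw := h.swap ⟨p₀, by rw [hp₀, conjSub_top hc]⟩ ⟨p₁, by rw [hp₁, conjSub_bot]⟩
  obtain ⟨v', hv', -⟩ := hs.exists_swap h
  rw [← finrank_conjSub hc (F q), hs.finrank_eq h, hv'.finrank_eq hsw, card_stringRev p q hpq,
    Module.finrank_eq_card_basis (hs.basis h), Nat.card_eq_fintype_card, Nat.card_eq_fintype_card,
    Fintype.card_subtype_compl]
  have := Fintype.card_subtype_le fun x : Σ σ, Fin (l σ + 1) => p ≤ A x.1 - (x.2 : ℕ)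
  omega

include hs h hG hN ht ht0 hcN hc in
/-- The twisted filtrations are eventually opposed to their conjugates. -/
theorem IsStringFamily.eventually_isPureHodge :
    ∀ᶠ z in f, IsPureHodge c (twist N t G z) d ∧ ∀ p,
      Module.finrank ℂ (hodgeComp c (twist N t G z) d p) =
        Nat.card {x : Σ σ, Fin (l σ + 1) // A x.1 - (x.2 : ℕ) = p} := by
  classical
  have := Module.Finite.of_basis (hs.basis h)
  obtain ⟨p₀, hp₀⟩ := h.hodge_top
  obtain ⟨p₁, hp₁⟩ := h.hodge_bot
  -- Limits can be used for finitely many `p` only. Beyond this range the conditions are trivial,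
  -- because `F p₀ = ⊤` and `F p₁ = ⊥` persist by constancy of dimension.
  let s : Finset ℤ := Finset.Icc (min p₀ (d - p₁)) (max p₁ (d + 1 - p₀))
  have e1 : ∀ᶠ z in f, ∀ p ∈ s, Module.finrank ℂ (G p z) = Module.finrank ℂ (F p) :=
    (Filter.eventually_all_finset s).mpr fun p _ => hG.finrank p
  have e2 : ∀ᶠ z in f, ∀ p ∈ s, twist N t G z p ⊔ conjSub c (twist N t G z (d - p + 1)) = ⊤ :=
    (Filter.eventually_all_finset s).mpr fun p _ =>
      hs.eventually_sup_eq_top h hcN hN ht ht0 hG p _ (by omega)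
  filter_upwards [e1, e2, hG.finrank p₀, hG.finrank p₁] with z e1 e2 e3 e4
  have hanti : Antitone (twist N t G z) := fun p q hpq => Submodule.map_mono (hG.anti z hpq)
  have htop : twist N t G z p₀ = ⊤ := by
    apply Submodule.eq_top_of_finrank_eq
    rw [finrank_twist hN, e3, hp₀, finrank_top]
  have hbot : twist N t G z p₁ = ⊥ := by
    apply Submodule.finrank_eq_zero.mp
    rw [finrank_twist hN, e4, hp₁, finrank_bot]
  have hfin : ∀ p, Module.finrank ℂ (twist N t G z p) = Module.finrank ℂ (F p) := by
    intro p
    rcases le_or_gt p p₀ with hp | hp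
    · rw [top_le_iff.mp (htop.ge.trans (hanti hp)), top_le_iff.mp (hp₀.ge.trans (h.anti hp))]
    rcases le_or_gt p₁ p with hp' | hp'
    · rw [le_bot_iff.mp ((hanti hp').trans hbot.le), le_bot_iff.mp ((h.anti hp').trans hp₁.le)]
    · rw [finrank_twist hN, e1 p (Finset.mem_Icc.mpr ⟨by omega, by omega⟩)]
  have hsup : ∀ p, twist N t G z p ⊔ conjSub c (twist N t G z (d - p + 1)) = ⊤ := by
    intro p
    rcases le_or_gt p p₀ with hp | hp
    · rw [top_le_iff.mp (htop.ge.trans (hanti hp)), top_sup_eq]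
    rcases le_or_gt (d - p + 1) p₀ with hp' | hp'
    · rw [top_le_iff.mp (htop.ge.trans (hanti hp')), conjSub_top hc, sup_top_eq]
    · exact e2 p (Finset.mem_Icc.mpr ⟨by omega, by omega⟩)
  have hop : ∀ p, IsCompl (twist N t G z p) (conjSub c (twist N t G z (d - p + 1))) := by
    intro p
    refine ⟨?_, codisjoint_iff.mpr (hsup p)⟩
    -- The limit argument yields only that the sum is everything; directness follows because the
    -- dimensions add up.
    rw [disjoint_iff, ← Submodule.finrank_eq_zero]
    have h1 := Submodule.finrank_sup_add_finrank_inf_eq (twist N t G z p)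
      (conjSub c (twist N t G z (d - p + 1)))
    rw [hsup, finrank_top, finrank_conjSub hc, hfin, hfin,
      hs.finrank_add h hc p (d - p + 1) (by ring)] at h1
    omega
  refine ⟨⟨hanti, ⟨p₀, htop⟩, ⟨p₁, hbot⟩, hop⟩, fun p => ?_⟩
  have h1 := Submodule.finrank_sup_add_finrank_inf_eq (twist N t G z p)
    (conjSub c (twist N t G z (d - p)))
  have h2 : twist N t G z p ⊔ conjSub c (twist N t G z (d - p)) = ⊤ := by
    rw [eq_top_iff, ← hsup p]
    exact sup_le_sup_left (Submodule.map_mono (hanti (by omega))) _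
  have h3 := hs.finrank_add h hc (p + 1) (d - p) (by ring)
  rw [h2, finrank_top, finrank_conjSub hc, hfin, hfin, ← h3, hs.finrank_eq h p,
    hs.finrank_eq h (p + 1)] at h1
  have h4 : Nat.card {x : Σ σ, Fin (l σ + 1) // p ≤ A x.1 - (x.2 : ℕ)} =
      Nat.card {x : Σ σ, Fin (l σ + 1) // p + 1 ≤ A x.1 - (x.2 : ℕ)} +
      Nat.card {x : Σ σ, Fin (l σ + 1) // A x.1 - (x.2 : ℕ) = p} := by
    rw [Nat.card_eq_fintype_card, Nat.card_eq_fintype_card, Nat.card_eq_fintype_card,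
      ← Fintype.card_subtype_or_disjoint]
    · exact Fintype.card_congr (Equiv.subtypeEquivRight fun x => by omega)
    · rw [Pi.disjoint_iff]
      intro x
      rw [Prop.disjoint_iff]
      omega
  rw [hodgeComp]
  omega

end

end Opposed

end DegenerationHodge

namespace DegenerationHodge

/-! ### The form `S` on strings and its rescaled limit. -/

noncomputable section Forms

set_option linter.unusedSectionVars false

variable {X : Type*} [AddCommGroup X] [Module ℂ X]
  {N : Module.End ℂ X} {d : ℕ} {W F F' : ℤ → Submodule ℂ X}
  {ι : Type*} [Fintype ι] {A : ι → ℤ} {l : ι → ℕ} {v : ι → X}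
  {c : X →ₛₗ[starRingEnd ℂ] X} {S : LinearMap.BilinForm ℂ X}

theorem IsCompatibleForm.pow_left (hS : IsCompatibleForm c N d S) (i : ℕ) (u v : X) :
    S ((N ^ i) u) v = (-1) ^ i * S u ((N ^ i) v) := form_pow hS.isometry i u v

theorem IsCompatibleForm.pow_right (hS : IsCompatibleForm c N d S) (i : ℕ) (u v : X) :
    S u ((N ^ i) v) = (-1) ^ i * S ((N ^ i) u) v := by
  rw [hS.pow_left, ← mul_assoc, ← pow_add, Even.neg_one_pow ⟨i, rfl⟩, one_mul]

/-- The monodromy weight filtration is self-dual. -/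
theorem IsStringFamily.form_weight (h : IsOpposedTriple N d W F F')
    (hs : IsStringFamily N d W F F' A l v) (hS : IsCompatibleForm c N d S) {a b : ℤ}
    (hab : a + b < 2 * d) {u w : X} (hu : u ∈ W a) (hw : w ∈ W b) : S u w = 0 := by
  obtain ⟨K, hK⟩ := h.bot
  obtain ⟨p, hp⟩ := h.hodge_top
  have hKle : ∀ k ≤ K, W k = ⊥ := fun k hk => le_bot_iff.mp ((h.mono hk).trans hK.le)
  obtain ⟨n, hn⟩ : ∃ n : ℕ, a + b ≤ 2 * K + n := ⟨(a + b - 2 * K).toNat, by omega⟩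
  induction n generalizing a b u w with
  | zero =>
    rcases le_or_gt a K with ha | ha
    · rw [hKle a ha, Submodule.mem_bot] at hu
      simp [hu]
    · rw [hKle b (by push_cast at hn; omega), Submodule.mem_bot] at hw
      simp [hw]
  | succ n ih =>
    have h1 := hs.inf_le_span h p a
    have h2 := hs.inf_le_span h p b
    rw [hp, top_inf_eq] at h1 h2
    have hu' := h1 hu
    have hw' := h2 hw
    clear hu hw
    induction hu', hw' using Submodule.span_induction₂ with
    | mem_mem x y hx hy =>
      obtain ⟨σ, i, hi, -, hi', rfl⟩ := hx
      obtain ⟨τ, j, hj, -, hj', rfl⟩ := hy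
      rw [hS.pow_left, ← Module.End.mul_apply, ← pow_add]
      -- Here `l σ + l τ < 2 (i + j)`, so `N^(i+j)` exceeds the length of one of the two strings.
      -- Applied to that one it loses an extra weight, and induction on `a + b` applies.
      have key : S (v σ) ((N ^ (i + j)) (v τ)) = 0 := by
        rcases lt_or_ge (l τ) (i + j) with hlt | hge
        · refine ih ?_ (hs.weight σ) (hs.pow_weight_of_lt h τ hlt) ?_ <;> push_cast at hn ⊢ <;> omega
        · rw [hS.pow_right]
          rw [ih ?_ (hs.pow_weight_of_lt h σ (j := i + j) (by omega)) (hs.weight τ) ?_, mul_zero] <;>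
            push_cast at hn ⊢ <;> omega
      rw [key, mul_zero]
    | zero_left => simp
    | zero_right => simp
    | add_left x y z _ _ _ hx hy => simp [hx, hy]
    | add_right x y z _ _ _ hx hy => simp [hx, hy]
    | smul_left r x y _ _ hx => simp [hx]
    | smul_right r x y _ _ hx => simp [hx]

section

variable (h : IsOpposedTriple N d W F fun p => conjSub c (F p))
  (hs : IsStringFamily N d W F (fun p => conjSub c (F p)) A l v)
  (hc : ∀ x, c (c x) = x) (hcN : ∀ x, N (c x) = c (N x)) (hcW : ∀ k, ∀ x ∈ W k, c x ∈ W k)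
  (hS : IsCompatibleForm c N d S)
  (hS0 : ∀ p, ∀ u ∈ F p, ∀ w ∈ F (d - p + 1), S u w = 0)
  (ho : ∀ σ τ, σ ≠ τ → A σ = A τ → l σ = l τ → S (v σ) ((N ^ l σ) (c (v τ))) = 0)

include hcN in
theorem pow_conj (i : ℕ) (x : X) : (N ^ i) (c x) = c ((N ^ i) x) := by
  induction i with
  | zero => simp
  | succ i ih => rw [pow_succ', Module.End.mul_apply, ih, hcN, Module.End.mul_apply]

/-- The form `S(·, conj ·)` on two vectors of strings. -/
theorem IsStringFamily.form_pow_pow (hcN : ∀ x, N (c x) = c (N x)) (hS : IsCompatibleForm c N d S)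
    (σ τ : ι) (i j : ℕ) : S ((N ^ i) (v σ)) (c ((N ^ j) (v τ))) =
      (-1) ^ i * S (v σ) ((N ^ (i + j)) (c (v τ))) := by
  rw [hS.pow_left, ← pow_conj hcN, ← Module.End.mul_apply, ← pow_add]

include h hs hcN hcW hS hc in
theorem IsStringFamily.form_eq_zero_of_lt {σ τ : ι} {n : ℕ} (hn : l σ + l τ < 2 * n) :
    S (v σ) ((N ^ n) (c (v τ))) = 0 := by
  refine hs.form_weight h hS (a := d + l σ) (b := d + l τ - 2 * n) (by omega)
    (hs.weight σ) ?_
  rw [pow_conj hcN]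
  exact hcW _ _ (hs.pow_weight h τ n)

-- The exponent `n` is at least the mean of two different lengths, so it exceeds the shorter one.
-- Moved onto the shorter string, `N ^ n` loses the extra weight needed for orthogonality.
include h hs hcN hcW hS hc in
theorem IsStringFamily.form_eq_zero_of_length_ne {σ τ : ι} {n : ℕ} (hn : l σ + l τ ≤ 2 * n)
    (hne : l σ ≠ l τ) : S (v σ) ((N ^ n) (c (v τ))) = 0 := by
  rcases lt_or_gt_of_ne hne with hlt | hlt
  · rw [hS.pow_right, hs.form_weight h hS (a := d + l σ - 2 * n - 1) (b := d + l τ)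
      (by omega) (hs.pow_weight_of_lt h σ (by omega)) (hcW _ _ (hs.weight τ)), mul_zero]
  · refine hs.form_weight h hS (a := d + l σ) (b := d + l τ - 2 * n - 1) (by omega)
      (hs.weight σ) ?_
    rw [pow_conj hcN]
    exact hcW _ _ (hs.pow_weight_of_lt h τ (by omega))

-- Modulo lower weight `c (v τ)` lies in `F (d + l τ - A τ)`. Applying `N ^ l` lands in `F (d - A
-- τ)`, which is contained in `F (d - A σ + 1)` and hence orthogonal to `v σ`.
include h hs hcN hcW hS hc hS0 in
theorem IsStringFamily.form_eq_zero_of_type_lt {σ τ : ι} (hl : l σ = l τ) (hA : A τ < A σ) :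
    S (v σ) ((N ^ l σ) (c (v τ))) = 0 := by
  obtain ⟨u, ⟨hu, hu'⟩, w, hw, huw⟩ := Submodule.mem_sup.mp (hs.mem' τ)
  have hu2 : c u ∈ F (d + l τ - A τ) := (mem_conjSub_iff hc _ _).mp hu
  rw [← huw, map_add, map_add, map_add]
  have h1 : (N ^ l σ) (c u) ∈ F (d - A σ + 1) := by
    have key : ∀ j : ℕ, (N ^ j) (c u) ∈ F (d + l τ - A τ - j) := by
      intro j
      induction j with
      | zero => simpa using hu2
      | succ j ih =>
        rw [pow_succ', Module.End.mul_apply]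
        convert h.hodge _ _ ih using 2
        push_cast; ring
    exact h.anti (by omega) (key (l σ))
  rw [hS0 _ _ (hs.mem σ) _ h1, zero_add]
  refine hs.form_weight h hS (a := d + l σ) (b := d + l τ - 1 - 2 * l σ) (by omega)
    (hs.weight σ) (pow_shift h.shift _ _ _ (hcW _ _ hw))

theorem IsCompatibleForm.form_pow_conj_comm (hS : IsCompatibleForm c N d S)
    (hcN : ∀ x, N (c x) = c (N x)) (hc : ∀ x, c (c x) = x) (n : ℕ) (u w : X) :
    S w ((N ^ n) (c u)) = (-1) ^ (d + n) * starRingEnd ℂ (S u ((N ^ n) (c w))) := by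
  rw [← hS.real, pow_conj hcN, pow_conj hcN, hc, hS.symm ((N ^ n) w) (c u), hS.pow_left,
    pow_conj hcN]
  rw [← mul_assoc, ← pow_add, ← mul_assoc, ← pow_add, show d + n + d + n = 2 * (d + n) by ring,
    pow_mul, neg_one_sq, one_pow, one_mul]

include h hs hcN hcW hS hc hS0 ho in
theorem IsStringFamily.form_eq_zero_of_ne {σ τ : ι} {n : ℕ} (hn : l σ + l τ ≤ 2 * n)
    (hne : σ ≠ τ) : S (v σ) ((N ^ n) (c (v τ))) = 0 := by
  rcases hn.lt_or_eq with hlt | heq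
  · exact hs.form_eq_zero_of_lt h hc hcN hcW hS hlt
  by_cases hl : l σ = l τ
  · obtain rfl : n = l σ := by omega
    rcases lt_trichotomy (A σ) (A τ) with hA | hA | hA
    · rw [hS.form_pow_conj_comm hcN hc, hl,
        hs.form_eq_zero_of_type_lt h hc hcN hcW hS hS0 hl.symm hA]
      simp
    · exact ho σ τ hne hA hl
    · exact hs.form_eq_zero_of_type_lt h hc hcN hcW hS hS0 hl hA
  · exact hs.form_eq_zero_of_length_ne h hc hcN hcW hS heq.le hl

variable [DecidableEq ι]

/-- The limit of the Gram matrices of `S(·, conj ·)`. -/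
def limitGram (l : ι → ℕ) (H : ι → ℂ) (a b : Σ σ, Fin (l σ + 1)) : ℂ :=
  if a.1 = b.1 ∧ (a.2 : ℕ) + b.2 = l a.1 then (-1) ^ (a.2 : ℕ) * H a.1 else 0

variable {α : Type*} {f : Filter α} {t : α → ℝ}

-- The entry at `(σ, i)`, `(τ, j)` scales with the exponent `2(i + j) - (l σ + l τ)`. Negative
-- exponents die in the limit and positive ones have coefficient zero. For exponent zero, pairings
-- between different strings vanish, by length, type or the chosen orthogonality.
include h hs hcN hcW hS hc hS0 ho in
theorem IsStringFamily.tendsto_gram (ht : Tendsto t f atTop) (ht0 : ∀ z, t z ≠ 0)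
    (a b : Σ σ, Fin (l σ + 1)) :
    Tendsto (fun z => S ((hs.scale h (t z) (ht0 z)).symm (Pi.single a 1))
        (c ((hs.scale h (t z) (ht0 z)).symm (Pi.single b 1)))) f
      (𝓝 (limitGram l (fun σ => S (v σ) ((N ^ l σ) (c (v σ)))) a b)) := by
  obtain ⟨σ, i⟩ := a
  obtain ⟨τ, j⟩ := b
  have h1 : ∀ z, S ((hs.scale h (t z) (ht0 z)).symm (Pi.single ⟨σ, i⟩ 1))
      (c ((hs.scale h (t z) (ht0 z)).symm (Pi.single ⟨τ, j⟩ 1))) =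
      (t z : ℂ) ^ (2 * (i + j : ℕ) - (l σ + l τ : ℕ) : ℤ) *
        ((-1) ^ (i : ℕ) * S (v σ) ((N ^ (i + j : ℕ)) (c (v τ)))) := by
    intro z
    have htz : (t z : ℂ) ≠ 0 := Complex.ofReal_ne_zero.mpr (ht0 z)
    have e : (2 * (i + j : ℕ) - (l σ + l τ : ℕ) : ℤ) =
        -((l σ : ℤ) - 2 * (i : ℕ)) + -((l τ : ℤ) - 2 * (j : ℕ)) := by push_cast; ring
    rw [scale, scaleEquiv_symm_single, scaleEquiv_symm_single, basis_apply, basis_apply,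
      ← form_pow_pow hcN hS, e, zpow_add₀ htz]
    simp
    ring
  simp only [h1]
  unfold limitGram
  dsimp only
  by_cases hle : l σ + l τ ≤ 2 * (i + j : ℕ)
  · by_cases hστ : σ = τ
    · subst hστ
      by_cases hij : (i : ℕ) + j = l σ
      · rw [if_pos ⟨rfl, hij⟩, hij, show (2 * (l σ : ℕ) - (l σ + l σ : ℕ) : ℤ) = 0 by
          push_cast; ring]
        simpa using tendsto_const_nhds
      · rw [if_neg fun e => hij e.2, hs.form_eq_zero_of_lt h hc hcN hcW hS (by omega)]
        simpa using tendsto_const_nhds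
    · rw [if_neg fun e => hστ e.1, hs.form_eq_zero_of_ne h hc hcN hcW hS hS0 ho hle hστ]
      simpa using tendsto_const_nhds
  · rw [if_neg]
    · exact tendsto_zpow_mul_of_neg ht (by omega) _
    · rintro ⟨rfl, hij⟩
      omega

theorem sum_stringWeight : ∑ x : Σ σ, Fin (l σ + 1), ((l x.1 : ℤ) - 2 * (x.2 : ℕ)) = 0 := by
  have h1 := Equiv.sum_comp (stringRev l) fun x => ((l x.1 : ℤ) - 2 * (x.2 : ℕ))
  have h2 : ∀ x : Σ σ, Fin (l σ + 1), (l ((stringRev l) x).1 : ℤ) - 2 * ((stringRev l x).2 : ℕ) =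
      -((l x.1 : ℤ) - 2 * (x.2 : ℕ)) := by
    rintro ⟨σ, j⟩
    change (l σ : ℤ) - 2 * ((Fin.rev j : Fin (l σ + 1)) : ℕ) = _
    rw [Fin.val_rev]
    have := j.2
    dsimp only
    omega
  simp only [h2, Finset.sum_neg_distrib] at h1
  omega

-- The rescaling exponents sum to zero, so the Gram determinant does not depend on `t` and equals
-- that of the limit. If the self-pairing of a string vanished, the limit matrix would have a zero
-- row, contradicting nondegeneracy of `S`.
include h hs hcN hcW hS hc hS0 ho in
theorem IsStringFamily.form_self_ne_zero (σ : ι) : S (v σ) ((N ^ l σ) (c (v σ))) ≠ 0 := by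
  intro hσ
  let b := hs.basis h
  let t : ℕ → ℝ := fun n => n + 1
  have ht : Tendsto t atTop atTop :=
    tendsto_atTop_add_const_right _ _ tendsto_natCast_atTop_atTop
  have ht0 : ∀ n, t n ≠ 0 := fun n => by positivity
  let G : Matrix (Σ σ, Fin (l σ + 1)) (Σ σ, Fin (l σ + 1)) ℂ := Matrix.of fun x y =>
    S (b x) (c (b y))
  let w : (Σ σ, Fin (l σ + 1)) → ℤ := fun x => (l x.1 : ℤ) - 2 * (x.2 : ℕ)
  let Gt : ℕ → Matrix (Σ σ, Fin (l σ + 1)) (Σ σ, Fin (l σ + 1)) ℂ := fun n => Matrix.of fun x y =>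
    S ((hs.scale h (t n) (ht0 n)).symm (Pi.single x 1))
        (c ((hs.scale h (t n) (ht0 n)).symm (Pi.single y 1)))
  have h1 : Tendsto Gt atTop (𝓝 (Matrix.of (limitGram l
      fun σ => S (v σ) ((N ^ l σ) (c (v σ)))))) :=
    tendsto_pi_nhds.mpr fun x => tendsto_pi_nhds.mpr fun y =>
      hs.tendsto_gram h hc hcN hcW hS hS0 ho ht ht0 x y
  have h2 : ∀ n, (Gt n).det = G.det := by
    intro n
    have htz : (t n : ℂ) ≠ 0 := Complex.ofReal_ne_zero.mpr (ht0 n)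
    have h3 : Gt n = Matrix.diagonal (fun x => (t n : ℂ) ^ (-w x)) * G *
        Matrix.diagonal (fun x => (t n : ℂ) ^ (-w x)) := by
      ext x y
      rw [Matrix.mul_diagonal, Matrix.diagonal_mul]
      simp only [Gt, G, Matrix.of_apply, scale, scaleEquiv_symm_single, map_smul, map_smulₛₗ,
        LinearMap.smul_apply, smul_eq_mul, w, b, map_zpow₀, Complex.conj_ofReal]
      ring
    have h4 : ∏ x, (t n : ℂ) ^ (-w x) = 1 := by
      have h5 : ∀ s : Finset (Σ σ, Fin (l σ + 1)), ∏ x ∈ s, (t n : ℂ) ^ (-w x) =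
          (t n : ℂ) ^ (-∑ x ∈ s, w x) := by
        intro s
        induction s using Finset.induction_on with
        | empty => simp
        | insert x s hx ih =>
          rw [Finset.prod_insert hx, Finset.sum_insert hx, ih, ← zpow_add₀ htz, neg_add]
      rw [h5, sum_stringWeight, neg_zero, zpow_zero]
    rw [h3, Matrix.det_mul, Matrix.det_mul, Matrix.det_diagonal, h4, one_mul, mul_one]
  have h3 : (Matrix.of (limitGram l fun σ => S (v σ) ((N ^ l σ) (c (v σ))))).det = G.det := by
    have h4 := ((continuous_id (X := Matrix (Σ σ, Fin (l σ + 1)) (Σ σ, Fin (l σ + 1)) ℂ)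
      ).matrix_det.tendsto _).comp h1
    refine tendsto_nhds_unique h4 (tendsto_const_nhds.congr fun n => (h2 n).symm)
  have h4 : G.det = 0 := by
    rw [← h3]
    refine Matrix.det_eq_zero_of_row_eq_zero ⟨σ, 0⟩ fun y => ?_
    simp [limitGram, hσ]
  obtain ⟨x, hx, hxG⟩ := Matrix.exists_vecMul_eq_zero_iff.mpr h4
  have h5 : ∀ y, S (∑ a, x a • b a) (c (b y)) = 0 := by
    intro y
    have := congrFun hxG y
    simpa [Matrix.vecMul, dotProduct, G] using this
  have h6 : ∀ y, S (∑ a, x a • b a) y = 0 := by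
    intro y
    rw [← hc y, ← b.sum_repr (c y), map_sum c, map_sum (S _)]
    refine Finset.sum_eq_zero fun i _ => ?_
    rw [map_smulₛₗ, map_smul, h5, smul_zero]
  have h7 := hS.nondegenerate.1 _ h6
  exact hx (funext (Fintype.linearIndependent_iff.mp b.linearIndependent x h7))

end

end Forms

end DegenerationHodge

/-! ### The signature of the twisted filtrations. -/

namespace DegenerationHodge

noncomputable section Signature

set_option linter.unusedSectionVars false

/-- A Gram matrix close to a positive diagonal one is positive definite, which gives linear
independence of the vectors and positivity on their span together. -/
theorem exists_span_pos {X κ α : Type*} [AddCommGroup X] [Module ℂ X] [Fintype κ] {f : Filter α}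
    (Q : X →ₗ[ℂ] X →ₛₗ[starRingEnd ℂ] ℂ) (y : κ → α → X) {D : κ → κ → ℂ}
    (hG : ∀ i j, Tendsto (fun z => Q (y i z) (y j z)) f (𝓝 (D i j)))
    (hD : ∀ i j, i ≠ j → D i j = 0) (hpos : ∀ i, 0 < (D i i).re) :
    ∀ᶠ z in f, Module.finrank ℂ (Submodule.span ℂ (Set.range fun i => y i z)) = Fintype.card κ ∧
      ∀ u ∈ Submodule.span ℂ (Set.range fun i => y i z), u ≠ 0 → 0 < (Q u u).re := by
  filter_upwards [eventually_pos_of_tendsto_diagonal hG hD hpos] with z hz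
  have key : ∀ x : κ → ℂ, x ≠ 0 → 0 < (Q (∑ i, x i • y i z) (∑ i, x i • y i z)).re := by
    intro x hx
    have h1 := hz x hx
    convert h1 using 2
    simp only [map_sum, LinearMap.sum_apply, map_smul, LinearMap.smul_apply, map_smulₛₗ,
      smul_eq_mul, Finset.mul_sum]
    rw [Finset.sum_comm]
    exact Finset.sum_congr rfl fun i _ => Finset.sum_congr rfl fun j _ => by ring
  refine ⟨finrank_span_eq_card (Fintype.linearIndependent_iff.mpr fun x hx => ?_), ?_⟩
  · by_contra hne
    have h1 := key x fun e => hne fun i => congrFun e i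
    rw [hx] at h1
    simp at h1
  · intro u hu hu0
    obtain ⟨x, rfl⟩ := (Submodule.mem_span_range_iff_exists_fun ℂ).mp hu
    refine key x fun e => hu0 ?_
    simp [e]

variable {X : Type*} [AddCommGroup X] [Module ℂ X]
  {N : Module.End ℂ X} {d : ℕ} {W F : ℤ → Submodule ℂ X}
  {ι : Type*} [Fintype ι] {A : ι → ℤ} {l : ι → ℕ} {v : ι → X}
  {c : X →ₛₗ[starRingEnd ℂ] X} {S : LinearMap.BilinForm ℂ X}

/-- The sesquilinear form with Gram matrix `limitGram`. -/
def limitForm [DecidableEq ι] (l : ι → ℕ) (H : ι → ℂ) (x y : (Σ σ, Fin (l σ + 1)) → ℂ) : ℂ :=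
  ∑ a, ∑ b, x a * (starRingEnd ℂ (y b) * limitGram l H a b)

theorem limitForm_of_ne [DecidableEq ι] (H : ι → ℂ) {σ τ : ι} (hστ : σ ≠ τ)
    (g : Fin (l σ + 1) → ℂ) (g' : Fin (l τ + 1) → ℂ) :
    limitForm l H (stringIncl l σ g) (stringIncl l τ g') = 0 := by
  refine Finset.sum_eq_zero fun a _ => Finset.sum_eq_zero fun b _ => ?_
  obtain ⟨σ', i⟩ := a
  obtain ⟨τ', j⟩ := b
  by_cases h1 : σ' = σ
  · by_cases h2 : τ' = τ
    · subst h1 h2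
      rw [limitGram, if_neg fun e => hστ e.1]
      simp
    · rw [stringIncl_apply_of_ne h2]
      simp
  · rw [stringIncl_apply_of_ne h1]
    simp

theorem limitForm_self [DecidableEq ι] (H : ι → ℂ) (σ : ι) (g g' : Fin (l σ + 1) → ℂ) :
    limitForm l H (stringIncl l σ g) (stringIncl l σ g') =
      H σ * ∑ i : Fin (l σ + 1), (-1) ^ (i : ℕ) * (g i * starRingEnd ℂ (g' i.rev)) := by
  rw [limitForm, Fintype.sum_sigma, Fintype.sum_eq_single σ, Finset.mul_sum]
  · refine Finset.sum_congr rfl fun i _ => ?_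
    rw [Fintype.sum_eq_single ⟨σ, i.rev⟩]
    · rw [stringIncl_apply_self, stringIncl_apply_self, limitGram, if_pos]
      · ring
      · refine ⟨rfl, ?_⟩
        have := i.2
        simp only [Fin.val_rev]
        omega
    · rintro ⟨τ, j⟩ hne
      by_cases hτ : τ = σ
      · subst hτ
        rw [limitGram, if_neg]
        · simp
        · rintro ⟨-, e⟩
          apply hne
          congr 1
          apply Fin.ext
          rw [Fin.val_rev]
          dsimp only at e
          omega
      · rw [stringIncl_apply_of_ne hτ]
        simp
  · intro τ hτ
    refine Finset.sum_eq_zero fun i _ => Finset.sum_eq_zero fun b _ => ?_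
    rw [stringIncl_apply_of_ne hτ, zero_mul]

theorem sesq_pi_expand {κ : Type*} [Fintype κ] [DecidableEq κ]
    (Q : X →ₗ[ℂ] X →ₛₗ[starRingEnd ℂ] ℂ) (g : (κ → ℂ) →ₗ[ℂ] X) (x y : κ → ℂ) :
    Q (g x) (g y) = ∑ a, ∑ b, x a * (starRingEnd ℂ (y b) *
      Q (g (Pi.single a 1)) (g (Pi.single b 1))) := by
  have h1 : ∀ x : κ → ℂ, x = ∑ a, x a • Pi.single a (1 : ℂ) := by
    intro x; ext i; simp [Finset.sum_apply, Pi.single_apply]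
  conv_lhs => rw [h1 x, h1 y]
  simp only [map_sum, LinearMap.sum_apply, map_smul, LinearMap.smul_apply, map_smulₛₗ,
      smul_eq_mul, Finset.mul_sum]
  rw [Finset.sum_comm]
  exact Finset.sum_congr rfl fun i _ => Finset.sum_congr rfl fun j _ => by ring

variable {α : Type*} {f : Filter α} {t : α → ℝ}

/-- The sign of a string. -/
def stringSign (c : X →ₛₗ[starRingEnd ℂ] X) (N : Module.End ℂ X) (d : ℕ)
    (S : LinearMap.BilinForm ℂ X) (A : ι → ℤ) (l : ι → ℕ) (v : ι → X) (σ : ι) : ℝ :=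
  (Complex.I ^ (2 * A σ - d - l σ) * S (v σ) ((N ^ l σ) (c (v σ)))).re

theorem I_zpow_two_mul (n : ℤ) : Complex.I ^ (2 * n) = (-1) ^ n := by
  rw [zpow_mul, show (2 : ℤ) = (2 : ℕ) by rfl, zpow_natCast, Complex.I_sq]

section

variable (h : IsOpposedTriple N d W F fun p => conjSub c (F p))
  (hs : IsStringFamily N d W F (fun p => conjSub c (F p)) A l v)
  (hc : ∀ x, c (c x) = x) (hcN : ∀ x, N (c x) = c (N x)) (hcW : ∀ k, ∀ x ∈ W k, c x ∈ W k)
  (hS : IsCompatibleForm c N d S)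
  (hS0 : ∀ p, ∀ u ∈ F p, ∀ w ∈ F (d - p + 1), S u w = 0)
  (ho : ∀ σ τ, σ ≠ τ → A σ = A τ → l σ = l τ → S (v σ) ((N ^ l σ) (c (v τ))) = 0)

-- The self-pairing of a string is nonzero, and by its `(-1)^(d+l)`-symmetry the power of `i` in
-- `stringSign` makes it real. So nothing is lost in taking the real part.
include h hs hcN hcW hS hc hS0 ho in
theorem IsStringFamily.stringSign_ne_zero (σ : ι) : stringSign c N d S A l v σ ≠ 0 := by
  classical
  have h1 := hs.form_self_ne_zero h hc hcN hcW hS hS0 ho σ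
  have h2 := hS.form_pow_conj_comm hcN hc (l σ) (v σ) (v σ)
  set H := S (v σ) ((N ^ l σ) (c (v σ))) with hH
  set C := Complex.I ^ (2 * A σ - d - l σ) * H with hC
  have h3 : starRingEnd ℂ C = C := by
    have h4 : starRingEnd ℂ H = (-1) ^ (d + l σ) * H := by
      conv_rhs => rw [h2]
      rw [← mul_assoc, ← pow_add, Even.neg_one_pow ⟨_, rfl⟩, one_mul]
    have h5 : starRingEnd ℂ Complex.I = Complex.I ^ (-1 : ℤ) := by simp
    have h6 : ((-1 : ℂ)) ^ (d + l σ) = Complex.I ^ (2 * ((d + l σ : ℕ) : ℤ)) := by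
      rw [I_zpow_two_mul, zpow_natCast]
    rw [hC, map_mul, map_zpow₀, h5, h4, h6, ← zpow_mul, ← mul_assoc,
      ← zpow_add₀ Complex.I_ne_zero]
    congr 1
    have h7 : -1 * (2 * A σ - d - l σ) + 2 * ((d + l σ : ℕ) : ℤ) =
        (2 * A σ - d - l σ) + 2 * (2 * (d + l σ - A σ)) := by push_cast; ring
    rw [h7, zpow_add₀ Complex.I_ne_zero, I_zpow_two_mul, zpow_mul]
    simp
  intro h0
  have h4 : C ≠ 0 := mul_ne_zero (zpow_ne_zero _ Complex.I_ne_zero) h1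
  apply h4
  apply Complex.ext
  · exact h0
  · exact Complex.conj_eq_iff_im.mp h3

variable (ht : Tendsto t f atTop) (ht0 : ∀ z, t z ≠ 0)

include h hs hcN hcW hS hc hS0 ho ht in
theorem IsStringFamily.tendsto_form [DecidableEq ι] {s s' : α → (Σ σ, Fin (l σ + 1)) → ℂ}
    {s₀ s₀' : (Σ σ, Fin (l σ + 1)) → ℂ} (hs₀ : Tendsto s f (𝓝 s₀)) (hs₀' : Tendsto s' f (𝓝 s₀')) :
    Tendsto (fun z => S ((hs.scale h (t z) (ht0 z)).symm (s z))
        (c ((hs.scale h (t z) (ht0 z)).symm (s' z)))) f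
      (𝓝 (limitForm l (fun σ => S (v σ) ((N ^ l σ) (c (v σ)))) s₀ s₀')) := by
  have h1 := fun z => sesq_pi_expand (LinearMap.compl₂ S c)
    (hs.scale h (t z) (ht0 z)).symm.toLinearMap (s z) (s' z)
  simp only [LinearMap.compl₂_apply, LinearEquiv.coe_coe] at h1
  simp only [h1]
  exact tendsto_finsetSum _ fun a _ => tendsto_finsetSum _ fun b _ =>
    (tendsto_pi_nhds.mp hs₀ a).mul
      (((Complex.continuous_conj.tendsto _).comp (tendsto_pi_nhds.mp hs₀' b)).mul
        (hs.tendsto_gram h hc hcN hcW hS hS0 ho ht ht0 a b))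

variable (hN : IsNilpotent N) {G : ℤ → α → Submodule ℂ X} (hG : IsRapidFamily f t F G)

-- The `hodgeVec`s with `A σ - m = p` lie in both limit filtrations, so by transversality they are
-- limits of vectors in the Hodge components. Two of them with the same `p` belong to different
-- strings, so their limit Gram matrix is diagonal. Its entries are positive multiples of `e *
-- stringSign`; `e = 1` and `e = -1` give the two halves of the signature.
include h hs hcN hcW hS hc hS0 ho ht ht0 hN hG in
theorem IsStringFamily.eventually_exists_pos (p : ℤ) (e : ℝ) :
    ∀ᶠ z in f, ∃ L ≤ hodgeComp c (twist N t G z) d p,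
      Module.finrank ℂ L = Nat.card {x : Σ σ, Fin (l σ + 1) //
        A x.1 - (x.2 : ℕ) = p ∧ 0 < e * stringSign c N d S A l v x.1} ∧
      ∀ u ∈ L, u ≠ 0 → 0 < e * (weilForm c S p (d - p) u u).re := by
  classical
  let J := {x : Σ σ, Fin (l σ + 1) //
        A x.1 - (x.2 : ℕ) = p ∧ 0 < e * stringSign c N d S A l v x.1}
  have hJ : ∀ x : J, (x.1.2 : ℕ) ≤ l x.1.1 := fun x => Nat.lt_succ_iff.mp x.1.2.2
  have h1 : ∀ x : J, ∃ s : α → (Σ σ, Fin (l σ + 1)) → ℂ,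
      (∀ᶠ z in f, s z ∈ (twist N t G z p).map (hs.scale h (t z) (ht0 z)).toLinearMap ⊓
        (conjSub c (twist N t G z (d - p))).map (hs.scale h (t z) (ht0 z)).toLinearMap) ∧
      Tendsto s f (𝓝 (stringIncl l x.1.1 (hodgeVec (l x.1.1) x.1.2))) := by
    intro x
    refine (hs.lowConv_twist h hN ht ht0 hG p).inf
      (hs.lowConv_conj_twist h hcN hN ht ht0 hG (d - p))
      (limit_sup_eq_top d p (d - p) (by omega)) _ ⟨?_, ?_⟩
    · exact stringIncl_hodgeVec_mem (hJ x) x.2.1.ge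
    · have := x.2.1
      exact stringIncl_hodgeVec_mem_neg (B := fun σ => d + l σ - A σ) (hJ x) (by omega)
  choose s hs1 hs2 using h1
  let H : ι → ℂ := fun σ => S (v σ) ((N ^ l σ) (c (v σ)))
  let y : J → α → X := fun x z => (hs.scale h (t z) (ht0 z)).symm (s x z)
  let Q : X →ₗ[ℂ] X →ₛₗ[starRingEnd ℂ] ℂ :=
    ((e : ℂ) * Complex.I ^ (p - (d - p) : ℤ)) • LinearMap.compl₂ S c
  let D : J → J → ℂ := fun x x' => ((e : ℂ) * Complex.I ^ (p - (d - p) : ℤ)) *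
    limitForm l H (stringIncl l x.1.1 (hodgeVec (l x.1.1) x.1.2))
      (stringIncl l x'.1.1 (hodgeVec (l x'.1.1) x'.1.2))
  have hQ : ∀ x x', Tendsto (fun z => Q (y x z) (y x' z)) f (𝓝 (D x x')) := fun x x' =>
    (hs.tendsto_form h hc hcN hcW hS hS0 ho ht ht0 (hs2 x) (hs2 x')).const_mul _
  have hD : ∀ x x', x ≠ x' → D x x' = 0 := by
    rintro ⟨⟨σ, m⟩, hx, hx'⟩ ⟨⟨τ, m'⟩, hy, hy'⟩ hne
    have hστ : σ ≠ τ := by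
      rintro rfl
      apply hne
      apply Subtype.ext
      refine congrArg (Sigma.mk σ) (Fin.ext ?_)
      dsimp only at hx hy
      omega
    simp only [D]
    rw [limitForm_of_ne _ hστ, mul_zero]
  have hpos : ∀ x, 0 < (D x x).re := by
    rintro ⟨⟨σ, m⟩, hx, hx'⟩
    have hm : (m : ℕ) ≤ l σ := Nat.lt_succ_iff.mp m.2
    dsimp only at hx hx'
    have h3 : D ⟨⟨σ, m⟩, hx, hx'⟩ ⟨⟨σ, m⟩, hx, hx'⟩ =
        ((2 ^ l σ * ((l σ - m).factorial * (m : ℕ).factorial) * e : ℝ) : ℂ) *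
          (Complex.I ^ (2 * A σ - d - l σ) * H σ) := by
      -- With `p = A σ - m`, the Weil factor cancels the dependence on `m` of the sign found in
      -- `sum_hodgeVec`. All vectors of a string therefore contribute the sign of its highest
      -- vector.
      have h4 : Complex.I ^ (p - (d - p) : ℤ) * ((-1) ^ (m : ℕ) * (-2 * Complex.I) ^ l σ) =
          2 ^ l σ * Complex.I ^ (2 * A σ - d - l σ) := by
        have h5 : (-1 : ℂ) ^ (m : ℕ) = Complex.I ^ (2 * ((m : ℕ) : ℤ)) := by
          rw [I_zpow_two_mul, zpow_natCast]
        have h6 : (-2 * Complex.I) ^ l σ = 2 ^ l σ * Complex.I ^ (-(l σ : ℤ)) := by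
          rw [show -2 * Complex.I = 2 * Complex.I⁻¹ by rw [Complex.inv_I]; ring, mul_pow, inv_pow,
            zpow_neg, zpow_natCast]
        have h7 : (2 * A σ - d - l σ : ℤ) = (p - (d - p)) + 2 * ((m : ℕ) : ℤ) + -(l σ : ℤ) := by
          rw [← hx]; ring
        rw [h5, h6, h7, zpow_add₀ Complex.I_ne_zero, zpow_add₀ Complex.I_ne_zero]
        ring
      simp only [D]
      rw [limitForm_self, sum_hodgeVec hm hm, if_pos rfl]
      push_cast
      linear_combination ((e : ℂ) * H σ * ((l σ - m).factorial * (m : ℕ).factorial)) * h4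
    rw [h3, Complex.re_ofReal_mul]
    have h8 : 0 < 2 ^ l σ * (((l σ - m).factorial : ℝ) * (m : ℕ).factorial) := by positivity
    have := mul_pos h8 hx'
    rw [← mul_assoc] at this
    exact this
  have hmem : ∀ᶠ z in f, ∀ x, y x z ∈ hodgeComp c (twist N t G z) d p :=
    eventually_all.mpr fun x => (hs1 x).mono fun z hz => by
      rw [← Submodule.map_inf _ (hs.scale h (t z) (ht0 z)).injective] at hz
      obtain ⟨u, hu, huz⟩ := hz
      have : y x z = u := by
        simp only [y]
        rw [← huz]
        exact (hs.scale h (t z) (ht0 z)).symm_apply_apply u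
      rw [this]
      exact hu
  filter_upwards [exists_span_pos Q y hQ hD hpos, hmem] with z ⟨hz1, hz2⟩ hz3
  refine ⟨_, Submodule.span_le.mpr ?_, by rw [Nat.card_eq_fintype_card]; exact hz1, ?_⟩
  · rintro _ ⟨x, rfl⟩
    exact hz3 x
  · intro u hu hu0
    have := hz2 u hu hu0
    simp only [Q, LinearMap.smul_apply, LinearMap.compl₂_apply, smul_eq_mul] at this
    rw [mul_assoc, Complex.re_ofReal_mul] at this
    exact this

include h hs hcN hcW hS hc hS0 ho ht ht0 hN hG in
/-- The signature of the twisted filtrations. -/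
theorem IsStringFamily.eventually_index :
    ∀ᶠ z in f, ∀ p, posIndex (weilForm c S p (d - p)) (hodgeComp c (twist N t G z) d p) =
        Nat.card {x : Σ σ, Fin (l σ + 1) //
          A x.1 - (x.2 : ℕ) = p ∧ 0 < stringSign c N d S A l v x.1} ∧
      negIndex (weilForm c S p (d - p)) (hodgeComp c (twist N t G z) d p) =
        Nat.card {x : Σ σ, Fin (l σ + 1) //
          A x.1 - (x.2 : ℕ) = p ∧ stringSign c N d S A l v x.1 < 0} := by
  classical
  have := Module.Finite.of_basis (hs.basis h)
  let s : Finset ℤ := Finset.univ.image fun x : Σ σ, Fin (l σ + 1) => A x.1 - (x.2 : ℕ)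
  have e1 := (Filter.eventually_all_finset s).mpr fun p _ =>
    hs.eventually_exists_pos h hc hcN hcW hS hS0 ho ht ht0 hN hG p 1
  have e2 := (Filter.eventually_all_finset s).mpr fun p _ =>
    hs.eventually_exists_pos h hc hcN hcW hS hS0 ho ht ht0 hN hG p (-1)
  filter_upwards [e1, e2, hs.eventually_isPureHodge h hc hcN hN ht ht0 hG]
    with z e1 e2 e3' p
  have e3 := e3'.2
  by_cases hp : p ∈ s
  · obtain ⟨L, hL, hLc, hLpos⟩ := e1 p hp
    obtain ⟨L', hL', hLc', hLpos'⟩ := e2 p hp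
    -- No string has sign zero, so the positive and the negative strings together exhaust the
    -- dimension.
    have hdim : Module.finrank ℂ (hodgeComp c (twist N t G z) d p) ≤
        Module.finrank ℂ L + Module.finrank ℂ L' := by
      rw [e3 p, hLc, hLc', Nat.card_eq_fintype_card, Nat.card_eq_fintype_card,
        Nat.card_eq_fintype_card, ← Fintype.card_subtype_or_disjoint]
      · refine Fintype.card_subtype_mono _ _ fun x hx => ?_
        rcases lt_or_gt_of_ne (hs.stringSign_ne_zero h hc hcN hcW hS hS0 ho x.1) with h1 | h1
        · exact Or.inr ⟨hx, by linarith⟩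
        · exact Or.inl ⟨hx, by linarith⟩
      · rw [Pi.disjoint_iff]
        intro x
        rw [Prop.disjoint_iff]
        rintro ⟨⟨-, h1⟩, ⟨-, h2⟩⟩
        linarith
    simp only [one_mul] at hLc hLpos
    simp only [neg_one_mul, Left.neg_pos_iff] at hLc' hLpos'
    exact ⟨(posIndex_eq hL hL' hLpos hLpos' hdim).trans hLc,
      (negIndex_eq hL hL' hLpos hLpos' hdim).trans hLc'⟩
  · have hempty : ∀ x : Σ σ, Fin (l σ + 1), A x.1 - (x.2 : ℕ) ≠ p := fun x hx =>
      hp (Finset.mem_image.mpr ⟨x, Finset.mem_univ _, hx⟩)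
    have h0 : Module.finrank ℂ (hodgeComp c (twist N t G z) d p) = 0 := by
      rw [e3 p, Nat.card_eq_zero]
      exact Or.inl ⟨fun x => hempty x.1 x.2⟩
    have h1 : ∀ P : (Σ σ, Fin (l σ + 1)) → Prop, Nat.card {x : Σ σ, Fin (l σ + 1) //
        A x.1 - (x.2 : ℕ) = p ∧ P x} = 0 := fun P =>
      Nat.card_eq_zero.mpr (Or.inl ⟨fun x => hempty x.1 x.2.1⟩)
    rw [h1, h1]
    have hb : ∀ x ∈ (⊥ : Submodule ℂ X), x ≠ 0 → 0 < (weilForm c S p (d - p) x x).re :=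
      fun x hx h0 => absurd hx h0
    have hb' : ∀ x ∈ (⊥ : Submodule ℂ X), x ≠ 0 → (weilForm c S p (d - p) x x).re < 0 :=
      fun x hx h0 => absurd hx h0
    have hdim : Module.finrank ℂ (hodgeComp c (twist N t G z) d p) ≤
        Module.finrank ℂ (⊥ : Submodule ℂ X) + Module.finrank ℂ (⊥ : Submodule ℂ X) := by
      rw [h0]; exact Nat.zero_le _
    exact ⟨(posIndex_eq bot_le bot_le hb hb' hdim).trans (finrank_bot ℂ X),
      (negIndex_eq bot_le bot_le hb hb' hdim).trans (finrank_bot ℂ X)⟩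

end

end Signature

end DegenerationHodge

/-! ### Asymptotics at the cusp, and transport of Hodge structures along isomorphisms. -/

namespace DegenerationHodge

section Cusp

open UpperHalfPlane (atImInfty)

theorem norm_unif (z : UpperHalfPlane) : ‖(unif z : ℂ)‖ = Real.exp (-(2 * Real.pi * z.im)) := by
  change ‖Complex.exp _‖ = _
  rw [Complex.norm_exp]
  congr 1
  have : (2 * Real.pi * Complex.I * z : ℂ) = ((2 * Real.pi : ℝ) : ℂ) * (Complex.I * z) := by
    push_cast; ring
  rw [this, Complex.re_ofReal_mul, Complex.I_mul_re]
  simp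

theorem tendsto_im_atImInfty : Tendsto UpperHalfPlane.im atImInfty atTop := tendsto_comap

theorem tendsto_sqrt_im : Tendsto (fun z : UpperHalfPlane => √z.im) atImInfty atTop :=
  Real.tendsto_sqrt_atTop.comp tendsto_im_atImInfty

theorem tendsto_unif : Tendsto (fun z => (unif z : ℂ)) atImInfty (𝓝 0) := by
  rw [tendsto_zero_iff_norm_tendsto_zero]
  simp only [norm_unif]
  refine Real.tendsto_exp_neg_atTop_nhds_zero.comp ?_
  exact tendsto_im_atImInfty.const_mul_atTop (by positivity)

/-- The coordinate `q` decays faster than all powers of `Im z`. -/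
theorem tendsto_zpow_mul_norm_unif (n : ℤ) :
    Tendsto (fun z => ‖((√z.im : ℝ) : ℂ) ^ n‖ * ‖(unif z : ℂ)‖) atImInfty (𝓝 0) := by
  have h1 : Tendsto (fun z : UpperHalfPlane => z.im ^ n.natAbs * Real.exp (-z.im)) atImInfty
      (𝓝 0) := (Real.tendsto_pow_mul_exp_neg_atTop_nhds_zero _).comp tendsto_im_atImInfty
  refine squeeze_zero' (.of_forall fun z => by positivity) ?_ h1
  filter_upwards [tendsto_im_atImInfty.eventually_ge_atTop 1] with z hz
  have hs : 1 ≤ √z.im := Real.one_le_sqrt.mpr hz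
  rw [norm_unif, norm_zpow, Complex.norm_real, Real.norm_of_nonneg (Real.sqrt_nonneg _)]
  refine mul_le_mul ?_ ?_ (Real.exp_nonneg _) (by positivity)
  · calc √z.im ^ n ≤ √z.im ^ ((n.natAbs : ℕ) : ℤ) := zpow_le_zpow_right₀ hs (by omega)
      _ = √z.im ^ n.natAbs := zpow_natCast _ _
      _ ≤ (√z.im ^ 2) ^ n.natAbs :=
        pow_le_pow_left₀ (Real.sqrt_nonneg _) (le_self_pow₀ hs two_ne_zero) _
      _ = z.im ^ n.natAbs := by rw [Real.sq_sqrt (by linarith)]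
  · apply Real.exp_le_exp.mpr
    have := Real.pi_gt_three
    nlinarith

variable {X : Type*} [AddCommGroup X] [Module ℂ X]

/-- A holomorphic subbundle over the disc converges rapidly at the cusp to its fiber at the
origin. -/
theorem IsHolSubbundleOfTrivial.rapidConv {F : ℂ → Submodule ℂ X}
    (hF : IsHolSubbundleOfTrivial F) :
    RapidConv atImInfty (fun z => √z.im) (fun z => F (unif z)) (F 0) ∧
      ∀ᶠ z in atImInfty, Module.finrank ℂ (F (unif z)) = Module.finrank ℂ (F 0) := by
  obtain ⟨U, -, hU, h0, n, φ, hφ, hφU⟩ := hF 0 (by simp)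
  have hev : ∀ᶠ z in atImInfty, (unif z : ℂ) ∈ U := tendsto_unif.eventually (hU.mem_nhds h0)
  constructor
  · intro u hu
    rw [← (hφU 0 h0).2] at hu
    obtain ⟨a, rfl⟩ := (Submodule.mem_span_range_iff_exists_fun ℂ).mp hu
    refine ⟨fun z => ∑ i, a i • (φ i (unif z) - φ i 0), ?_, ?_⟩
    · intro ℓ m
      let g : ℂ → ℂ := fun q => ∑ i, a i * ℓ (φ i q)
      have hg : DifferentiableAt ℂ g 0 := DifferentiableAt.fun_sum fun i _ =>
        ((hφ i ℓ).differentiableAt (hU.mem_nhds h0)).const_mul _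
      have h1 : (fun q => g q - g 0) =O[𝓝 0] fun q => q := by simpa using hg.isBigO_sub
      obtain ⟨C, hC⟩ := h1.bound
      have h2 := tendsto_unif.eventually hC
      have h3 := (tendsto_zpow_mul_norm_unif m).const_mul C
      rw [mul_zero] at h3
      refine squeeze_zero_norm' ?_ h3
      filter_upwards [h2] with z hz
      have h4 : ℓ (∑ i, a i • (φ i (unif z) - φ i 0)) = g (unif z) - g 0 := by
        simp [g, mul_sub]
      rw [norm_mul, h4]
      calc _ ≤ ‖((√z.im : ℝ) : ℂ) ^ m‖ * (C * ‖(unif z : ℂ)‖) :=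
            mul_le_mul_of_nonneg_left hz (norm_nonneg _)
        _ = _ := by ring
    · filter_upwards [hev] with z hz
      rw [← Finset.sum_add_distrib, ← (hφU _ hz).2]
      refine Submodule.sum_mem _ fun i _ => ?_
      rw [← smul_add, add_sub_cancel]
      exact Submodule.smul_mem _ _ (Submodule.subset_span ⟨i, rfl⟩)
  · filter_upwards [hev] with z hz
    rw [← (hφU _ hz).2, ← (hφU _ h0).2, finrank_span_eq_card (hφU _ hz).1,
      finrank_span_eq_card (hφU _ h0).1]

/-- A bilinear form that vanishes on rapidly convergent subspaces vanishes on the limits. -/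
theorem RapidConv.form_eq_zero [FiniteDimensional ℂ X] {α : Type*} {f : Filter α} [f.NeBot]
    {t : α → ℝ} {G G' : α → Submodule ℂ X} {G₀ G₀' : Submodule ℂ X} (h : RapidConv f t G G₀)
    (h' : RapidConv f t G' G₀') {S : LinearMap.BilinForm ℂ X}
    (hS : ∀ᶠ z in f, ∀ u ∈ G z, ∀ v ∈ G' z, S u v = 0) :
    ∀ u ∈ G₀, ∀ v ∈ G₀', S u v = 0 := by
  intro u hu v hv
  obtain ⟨r, hr, hrG⟩ := h u hu
  obtain ⟨r', hr', hrG'⟩ := h' v hv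
  have key : ∀ {r : α → X}, RapidDecay f t r → ∀ ℓ : Module.Dual ℂ X,
      Tendsto (fun z => ℓ (r z)) f (𝓝 0) := fun hr ℓ => by simpa using hr ℓ 0
  have h1 : Tendsto (fun z => S (r z) (r' z)) f (𝓝 0) := by
    let b := Module.finBasis ℂ X
    have h2 : ∀ z, S (r z) (r' z) = ∑ i, b.coord i (r z) * S (b i) (r' z) := by
      intro z
      conv_lhs => rw [← b.sum_repr (r z)]
      simp only [map_sum, LinearMap.sum_apply, map_smul, LinearMap.smul_apply, smul_eq_mul,
        Module.Basis.coord_apply]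
    simp only [h2]
    have h3 := tendsto_finsetSum Finset.univ fun i (_ : i ∈ Finset.univ) =>
      (key hr (b.coord i)).mul (key hr' (S (b i)))
    simpa using h3
  have h4 : Tendsto (fun z => S (u + r z) (v + r' z)) f (𝓝 (S u v)) := by
    have h5 := ((tendsto_const_nhds (x := S u v)).add (key hr' (S u))).add
      ((key hr (LinearMap.flip S v)).add h1)
    simp only [add_zero] at h5
    refine h5.congr fun z => ?_
    simp only [map_add, LinearMap.add_apply, LinearMap.flip_apply]
    ring
  refine tendsto_nhds_unique h4 (tendsto_const_nhds.congr' ?_)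
  filter_upwards [hS, hrG, hrG'] with z h6 h7 h8
  exact (h6 _ h7 _ h8).symm

end Cusp

section Transport

variable {X Y : Type*} [AddCommGroup X] [Module ℂ X] [AddCommGroup Y] [Module ℂ Y]
  {c : X →ₛₗ[starRingEnd ℂ] X} {c' : Y →ₛₗ[starRingEnd ℂ] Y} (g : X ≃ₗ[ℂ] Y)
  (hg : ∀ u, c' (g u) = g (c u))

include hg in
theorem conjSub_map_equiv (A : Submodule ℂ X) :
    conjSub c' (A.map g.toLinearMap) = (conjSub c A).map g.toLinearMap := by
  ext x
  constructor
  · rintro ⟨_, ⟨u, hu, rfl⟩, rfl⟩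
    exact ⟨c u, ⟨u, hu, rfl⟩, (hg u).symm⟩
  · rintro ⟨_, ⟨u, hu, rfl⟩, rfl⟩
    exact ⟨g u, ⟨u, hu, rfl⟩, hg u⟩

include hg in
theorem IsPureHodge.map_equiv {F : ℤ → Submodule ℂ X} {d : ℤ} (h : IsPureHodge c F d) :
    IsPureHodge c' (fun p => (F p).map g.toLinearMap) d where
  anti p q hpq := Submodule.map_mono (h.anti hpq)
  top := by
    obtain ⟨p, hp⟩ := h.top
    exact ⟨p, by rw [hp, Submodule.map_top, LinearEquiv.range]⟩
  bot := by
    obtain ⟨p, hp⟩ := h.bot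
    exact ⟨p, by rw [hp, Submodule.map_bot]⟩
  opposed p := by
    rw [conjSub_map_equiv g hg]
    have h1 := h.opposed p
    refine ⟨?_, ?_⟩
    · rw [disjoint_iff, ← Submodule.map_inf _ g.injective, h1.inf_eq_bot, Submodule.map_bot]
    · rw [codisjoint_iff, ← Submodule.map_sup, h1.sup_eq_top, Submodule.map_top, LinearEquiv.range]

include hg in
theorem hodgeComp_map_equiv (F : ℤ → Submodule ℂ X) (d p : ℤ) :
    hodgeComp c' (fun p => (F p).map g.toLinearMap) d p =
      (hodgeComp c F d p).map g.toLinearMap := by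
  rw [hodgeComp, hodgeComp, conjSub_map_equiv g hg, Submodule.map_inf _ g.injective]

include hg in
theorem posIndex_weilForm_map_equiv {S : LinearMap.BilinForm ℂ X} {S' : LinearMap.BilinForm ℂ Y}
    (hS : ∀ u v, S' (g u) (g v) = S u v) (F : ℤ → Submodule ℂ X) (d p p' q' : ℤ) :
    posIndex (weilForm c' S' p' q') (hodgeComp c' (fun p => (F p).map g.toLinearMap) d p) =
      posIndex (weilForm c S p' q') (hodgeComp c F d p) ∧
    negIndex (weilForm c' S' p' q') (hodgeComp c' (fun p => (F p).map g.toLinearMap) d p) =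
      negIndex (weilForm c S p' q') (hodgeComp c F d p) := by
  rw [hodgeComp_map_equiv g hg]
  constructor
  · refine posIndex_map g (fun u => ?_) _
    rw [weilForm, weilForm, hg, hS]
  · refine posIndex_map g (fun u => ?_) _
    rw [weilForm, weilForm, hg, hS]

end Transport

end DegenerationHodge

/-! ### Identification of the fibers with the space of horizontal sections. -/

namespace DegenerationHodge

noncomputable section FlatBundle

open UpperHalfPlane (atImInfty)

set_option linter.unusedSectionVars false

theorem isNilpotent_neg_end {X : Type*} [AddCommGroup X] [Module ℂ X] {A : Module.End ℂ X}
    (hA : IsNilpotent A) : IsNilpotent (-A) := hA.neg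

theorem nilExp_bijective {X : Type*} [AddCommGroup X] [Module ℂ X] {A : Module.End ℂ X}
    (hA : IsNilpotent A) : Function.Bijective (nilExp A) :=
  ⟨nilExp_injective hA, fun u => ⟨_, nilExp_apply_neg hA u⟩⟩

variable {V : Type*} [NormedAddCommGroup V] [NormedSpace ℂ V] [FiniteDimensional ℂ V]
  {E : puncturedDisc → Type*}
  [∀ q, AddCommGroup (E q)] [∀ q, Module ℂ (E q)] [∀ q, TopologicalSpace (E q)]
  [∀ q, IsTopologicalAddGroup (E q)] [∀ q, ContinuousSMul ℂ (E q)]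
  [TopologicalSpace (TotalSpace V E)] [FiberBundle V E] [VectorBundle ℂ V E]
  [ContMDiffVectorBundle ω V E 𝓘(ℂ, ℂ)]

theorem unif_surjective : Function.Surjective unif := by
  intro q
  have hq0 : (q : ℂ) ≠ 0 := norm_pos_iff.mp q.2.1
  have hpi : (2 * Real.pi * Complex.I : ℂ) ≠ 0 := Complex.two_pi_I_ne_zero
  let w : ℂ := Complex.log q / (2 * Real.pi * Complex.I)
  have hw : 2 * Real.pi * Complex.I * w = Complex.log q := mul_div_cancel₀ _ hpi
  have him : 0 < w.im := by
    have h1 := congrArg Complex.re hw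
    have h2 : (2 * Real.pi * Complex.I * w : ℂ) = ((2 * Real.pi : ℝ) : ℂ) * (Complex.I * w) := by
      push_cast; ring
    rw [h2, Complex.re_ofReal_mul, Complex.I_mul_re, Complex.log_re] at h1
    have h3 : Real.log ‖(q : ℂ)‖ < 0 := Real.log_neg q.2.1 q.2.2
    have := Real.pi_pos
    nlinarith
  refine ⟨⟨w, him⟩, Subtype.ext ?_⟩
  change Complex.exp (2 * Real.pi * Complex.I * w) = q
  rw [hw, Complex.exp_log hq0]

/-- What holds at the cusp of the upper half plane holds near the puncture. -/
theorem exists_norm_lt_of_eventually {P : puncturedDisc → Prop}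
    (h : ∀ᶠ z in atImInfty, P (unif z)) :
    ∃ ε > 0, ∀ q : puncturedDisc, ‖(q : ℂ)‖ < ε → P q := by
  obtain ⟨A, hA⟩ := (UpperHalfPlane.atImInfty_mem _).mp h
  refine ⟨Real.exp (-(2 * Real.pi * A)), Real.exp_pos _, fun q hq => ?_⟩
  obtain ⟨z, rfl⟩ := unif_surjective q
  rw [norm_unif, Real.exp_lt_exp] at hq
  refine hA z ?_
  have := Real.pi_pos
  by_contra hlt
  push Not at hlt
  nlinarith

variable (D : RealFlatConnection V E)

theorem conjH_conjH (s : horizontalSections D) : conjH D (conjH D s) = s := by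
  apply Subtype.ext
  funext q z
  exact D.conj_conj q _

theorem finiteDimensional_horizontalSections : FiniteDimensional ℂ (horizontalSections D) := by
  let z : UpperHalfPlane := UpperHalfPlane.I
  let e := LinearEquiv.ofBijective _ (evalAt_bijective D (unif z) ⟨z, rfl⟩)
  let e' := (trivializationAt V E (unif z)).linearEquivAt ℂ (unif z)
    (mem_baseSet_trivializationAt V E (unif z))
  exact Module.Finite.equiv (e ≪≫ₗ e').symm

variable {D}

theorem isNilpotent_logMonodromy (hT : IsNilpotent (monodromy D - 1)) :
    IsNilpotent (logMonodromy D) := by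
  obtain ⟨n, hn⟩ := hT
  have h1 : IsNilpotent (unipLog (monodromy D)) := ⟨n, unipLog_pow_eq_zero hn⟩
  exact isNilpotent_neg_end h1

theorem nilExp_neg_logMonodromy (hT : IsNilpotent (monodromy D - 1)) :
    nilExp (-logMonodromy D) = monodromy D := by
  have h1 : -logMonodromy D = unipLog (monodromy D) := neg_neg (unipLog (monodromy D))
  rw [h1, nilExp_unipLog hT]

theorem evalAt_vadd (q : puncturedDisc) (z : {z : UpperHalfPlane // unif z = q})
    (s : horizontalSections D) :
    evalAt D q ⟨(1 : ℝ) +ᵥ z.1, (unif_add_one z.1).trans z.2⟩ s = evalAt D q z (monodromy D s) :=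
  rfl

variable {d : ℕ} {S : LinearMap.BilinForm ℂ (horizontalSections D)}

theorem form_monodromy (hT : IsNilpotent (monodromy D - 1))
    (hS : IsCompatibleForm (conjH D) (logMonodromy D) d S) (s t : horizontalSections D) :
    S (monodromy D s) (monodromy D t) = S s t := by
  rw [← nilExp_neg_logMonodromy hT]
  refine form_nilExp_nilExp (isNilpotent_logMonodromy hT).neg (fun u v => ?_) s t
  have := hS.isometry u v
  simp only [LinearMap.neg_apply, map_neg]
  linear_combination -this

/-- The form on the fibers induced by a form on multivalued horizontal sections. -/
theorem fiberForm_evalAt (hT : IsNilpotent (monodromy D - 1))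
    (hS : IsCompatibleForm (conjH D) (logMonodromy D) d S) (q : puncturedDisc)
    (z : {z : UpperHalfPlane // unif z = q}) (s t : horizontalSections D) :
    fiberForm D S q (evalAt D q z s) (evalAt D q z t) = S s t := by
  have key : ∃ B : LinearMap.BilinForm ℂ (E q),
      ∀ (z : {z : UpperHalfPlane // unif z = q}) (s t : horizontalSections D),
        B (evalAt D q z s) (evalAt D q z t) = S s t := by
    let e := LinearEquiv.ofBijective _ (evalAt_bijective D q z)
    let B : LinearMap.BilinForm ℂ (E q) := LinearMap.compl₁₂ S e.symm.toLinearMap e.symm.toLinearMap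
    -- `B` is defined by evaluation at one point over `q`. Invariance of `S` under monodromy carries
    -- its defining property along integer translations, which reach all points over `q`.
    let P : {z : UpperHalfPlane // unif z = q} → Prop := fun w =>
      ∀ s t, B (evalAt D q w s) (evalAt D q w t) = S s t
    have hP : P z := by
      intro s t
      have h1 : ∀ s, e.symm (evalAt D q z s) = s := fun s => e.symm_apply_apply s
      simp only [B, LinearMap.compl₁₂_apply, LinearEquiv.coe_coe, h1]
    have hsurj : Function.Surjective (monodromy D) := by
      rw [← nilExp_neg_logMonodromy hT]
      exact (nilExp_bijective (isNilpotent_logMonodromy hT).neg).2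
    have hstep : ∀ w : {z : UpperHalfPlane // unif z = q},
        P w ↔ P ⟨(1 : ℝ) +ᵥ w.1, (unif_add_one w.1).trans w.2⟩ := by
      intro w
      constructor
      · intro hw s t
        rw [evalAt_vadd, evalAt_vadd, hw, form_monodromy hT hS]
      · intro hw s t
        obtain ⟨s, rfl⟩ := hsurj s
        obtain ⟨t, rfl⟩ := hsurj t
        rw [← evalAt_vadd, ← evalAt_vadd, hw, form_monodromy hT hS]
    have hnat : ∀ (n : ℕ) (w w' : {z : UpperHalfPlane // unif z = q}),
        (w'.1 : ℂ) = w.1 + n → (P w ↔ P w') := by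
      intro n
      induction n with
      | zero =>
        intro w w' hw
        have : w = w' := Subtype.ext (UpperHalfPlane.ext (by simpa using hw.symm))
        rw [this]
      | succ n ih =>
        intro w w' hw
        rw [hstep w]
        refine ih _ _ ?_
        rw [hw, UpperHalfPlane.coe_vadd]
        push_cast; ring
    refine ⟨B, fun w => ?_⟩
    have h1 : Complex.exp (2 * Real.pi * Complex.I * w.1) =
        Complex.exp (2 * Real.pi * Complex.I * z.1) := congrArg Subtype.val (w.2.trans z.2.symm)
    obtain ⟨n, hn⟩ := Complex.exp_eq_exp_iff_exists_int.mp h1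
    have h2 : (w.1 : ℂ) = z.1 + n := by
      have h3 : (2 * Real.pi * Complex.I : ℂ) * w.1 = (2 * Real.pi * Complex.I) * (z.1 + n) := by
        rw [hn]; ring
      exact mul_left_cancel₀ Complex.two_pi_I_ne_zero h3
    rcases le_total 0 n with hn0 | hn0
    · obtain ⟨m, rfl⟩ := Int.eq_ofNat_of_zero_le hn0
      exact (hnat m z w (by simpa using h2)).mp hP
    · obtain ⟨m, hm⟩ := Int.eq_ofNat_of_zero_le (neg_nonneg.mpr hn0)
      refine (hnat m w z ?_).mpr hP
      have : (m : ℂ) = -(n : ℂ) := by exact_mod_cast hm.symm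
      rw [this, h2]
      ring
  rw [fiberForm, dif_pos key]
  exact key.choose_spec z s t

/-- The fiber at `unif z`, identified with the space of horizontal sections in such a way that the
frame of the canonical extension differs from it by `exp(i (Im z) N)`. -/
def fiberEquiv (hT : IsNilpotent (monodromy D - 1)) (z : UpperHalfPlane) :
    horizontalSections D ≃ₗ[ℂ] E (unif z) :=
  LinearEquiv.ofBijective (evalAt D (unif z) ⟨z, rfl⟩ ∘ₗ nilExp ((z.re : ℂ) • logMonodromy D))
    ((evalAt_bijective D (unif z) ⟨z, rfl⟩).comp
      (nilExp_bijective ((isNilpotent_logMonodromy hT).smul_end _)))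

theorem fiberEquiv_apply (hT : IsNilpotent (monodromy D - 1)) (z : UpperHalfPlane)
    (s : horizontalSections D) : fiberEquiv hT z s =
      evalAt D (unif z) ⟨z, rfl⟩ (nilExp ((z.re : ℂ) • logMonodromy D) s) := rfl

/-- Only the real multiple `Re z · N` of `N` enters the identification, and its exponential commutes
with conjugation. -/
theorem conj_fiberEquiv (hT : IsNilpotent (monodromy D - 1))
    (hreal : ∀ x, logMonodromy D (conjH D x) = conjH D (logMonodromy D x)) (z : UpperHalfPlane)
    (s : horizontalSections D) :
    D.conj (unif z) (fiberEquiv hT z s) = fiberEquiv hT z (conjH D s) := by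
  have h1 := conj_nilExp_smul (isNilpotent_logMonodromy hT) hreal (z.re : ℂ) s
  rw [Complex.conj_ofReal] at h1
  rw [fiberEquiv_apply, fiberEquiv_apply, ← h1]
  rfl

theorem fiberForm_fiberEquiv (hT : IsNilpotent (monodromy D - 1))
    (hS : IsCompatibleForm (conjH D) (logMonodromy D) d S) (z : UpperHalfPlane)
    (s t : horizontalSections D) :
    fiberForm D S (unif z) (fiberEquiv hT z s) (fiberEquiv hT z t) = S s t := by
  rw [fiberEquiv_apply, fiberEquiv_apply, fiberForm_evalAt hT hS]
  refine form_nilExp_nilExp ((isNilpotent_logMonodromy hT).smul_end _) (fun u v => ?_) s t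
  have := hS.isometry u v
  simp only [LinearMap.smul_apply, map_smul, smul_eq_mul]
  linear_combination (z.re : ℂ) * this

variable {F : ℤ → ∀ q, Submodule ℂ (E q)} {F' : ℤ → ℂ → Submodule ℂ (horizontalSections D)}

/-- Splitting `zN` into the commuting parts `Re z · N` and `i Im z · N` isolates the twist; it fixes
the scale as `t = √(Im z)`. -/
theorem canonicalFrame_eq (hT : IsNilpotent (monodromy D - 1)) (z : UpperHalfPlane)
    (s : horizontalSections D) : canonicalFrame D (unif z) ⟨z, rfl⟩ s =
      fiberEquiv hT z (nilExp ((Complex.I * ((√z.im : ℝ) : ℂ) ^ 2) • logMonodromy D) s) := by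
  have hN := isNilpotent_logMonodromy hT
  have h1 : ((√z.im : ℝ) : ℂ) ^ 2 = (z.im : ℂ) := by
    rw [← Complex.ofReal_pow, Real.sq_sqrt z.im_pos.le]
  have h2 : (z : ℂ) • logMonodromy D =
      (z.re : ℂ) • logMonodromy D + (Complex.I * (z.im : ℂ)) • logMonodromy D := by
    rw [← add_smul]
    congr 1
    have := Complex.re_add_im (z : ℂ)
    rw [mul_comm Complex.I]
    exact this.symm
  rw [fiberEquiv_apply, h1, ← Module.End.mul_apply, ← nilExp_add _ (hN.smul_end _) (hN.smul_end _),
    ← h2]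
  · rfl
  · exact ((Commute.refl _).smul_left _).smul_right _

theorem IsCanonicalExtension.eq_map (hT : IsNilpotent (monodromy D - 1))
    (hF' : IsCanonicalExtension D F F') (z : UpperHalfPlane) (p : ℤ) :
    F p (unif z) = (twist (logMonodromy D) (fun z : UpperHalfPlane => √z.im)
      (fun p z => F' p (unif z)) z p).map (fiberEquiv hT z).toLinearMap := by
  have hN := isNilpotent_logMonodromy hT
  have h1 := hF'.restrict p (unif z) ⟨z, rfl⟩
  ext x
  constructor
  · intro hx
    obtain ⟨s, rfl⟩ := (fiberEquiv hT z).surjective x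
    obtain ⟨s, rfl⟩ := (nilExp_bijective (hN.smul_end
      (Complex.I * ((√z.im : ℝ) : ℂ) ^ 2))).2 s
    refine ⟨_, ⟨s, ?_, rfl⟩, rfl⟩
    change s ∈ F' p (unif z)
    rw [h1, Submodule.mem_comap, canonicalFrame_eq hT]
    exact hx
  · rintro ⟨_, ⟨s, hs, rfl⟩, rfl⟩
    change s ∈ F' p (unif z) at hs
    rw [h1, Submodule.mem_comap, canonicalFrame_eq hT] at hs
    exact hs

theorem IsCanonicalExtension.isRapidFamily (hF' : IsCanonicalExtension D F F')
    (hFanti : ∀ q, Antitone fun p => F p q) :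
    IsRapidFamily atImInfty (fun z : UpperHalfPlane => √z.im) (fun p => F' p 0)
      (fun p z => F' p (unif z)) where
  anti z p p' hp := by
    dsimp only
    rw [hF'.restrict p (unif z) ⟨z, rfl⟩, hF'.restrict p' (unif z) ⟨z, rfl⟩]
    exact Submodule.comap_mono (hFanti _ hp)
  conv p := (hF'.subbundle p).rapidConv.1
  finrank p := (hF'.subbundle p).rapidConv.2

/-- `S` is invariant under `exp(zN)`, so isotropy holds on the fibers of the extended filtration
over `q ≠ 0` and passes to the limit at the origin. -/
theorem IsCanonicalExtension.form_eq_zero (hT : IsNilpotent (monodromy D - 1))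
    (hF' : IsCanonicalExtension D F F')
    (hS : IsCompatibleForm (conjH D) (logMonodromy D) d S)
    (hSF : ∀ (q : puncturedDisc) (p : ℤ), ∀ u ∈ F p q, ∀ v ∈ F (d - p + 1) q,
        fiberForm D S q u v = 0) (p : ℤ) :
    ∀ u ∈ F' p 0, ∀ v ∈ F' (d - p + 1) 0, S u v = 0 := by
  have := finiteDimensional_horizontalSections D
  have hN := isNilpotent_logMonodromy hT
  refine (hF'.subbundle p).rapidConv.1.form_eq_zero (hF'.subbundle (d - p + 1)).rapidConv.1
    (.of_forall fun z u hu v hv => ?_)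
  rw [hF'.restrict _ (unif z) ⟨z, rfl⟩, Submodule.mem_comap] at hu hv
  have h1 := hSF _ _ _ hu _ hv
  have h2 : fiberForm D S (unif z) (canonicalFrame D (unif z) ⟨z, rfl⟩ u)
      (canonicalFrame D (unif z) ⟨z, rfl⟩ v) = S u v := by
    refine (fiberForm_evalAt hT hS _ _ _ _).trans ?_
    refine form_nilExp_nilExp (hN.smul_end _) (fun u v => ?_) u v
    have := hS.isometry u v
    simp only [LinearMap.smul_apply, map_smul, smul_eq_mul]
    linear_combination (z : ℂ) * this
  rw [← h2, h1]

end FlatBundle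

end DegenerationHodge

/-! ### The numbers `s_±` in terms of strings. -/

namespace DegenerationHodge

section PrimitiveSignature

variable {X : Type*} [AddCommGroup X] [Module ℂ X]
  {N : Module.End ℂ X} {d : ℕ} {W F : ℤ → Submodule ℂ X}
  {ι : Type*} [Fintype ι] {A : ι → ℤ} {l : ι → ℕ} {v : ι → X}
  {c : X →ₛₗ[starRingEnd ℂ] X} {S : LinearMap.BilinForm ℂ X}

theorem mkQ_grLift (k : ℤ) (x : Gr W k) :
    ∃ h : grLift W k x ∈ W k, ((W (k - 1)).submoduleOf (W k)).mkQ ⟨grLift W k x, h⟩ = x :=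
  ⟨Subtype.property _,
    Function.surjInv_eq ((W (k - 1)).submoduleOf (W k)).mkQ_surjective x⟩

variable (h : IsOpposedTriple N d W F fun p => conjSub c (F p))
  (hs : IsStringFamily N d W F (fun p => conjSub c (F p)) A l v)
  (hcN : ∀ x, N (c x) = c (N x)) (hcW : ∀ k, ∀ x ∈ W k, c x ∈ W k)
  (hS : IsCompatibleForm c N d S)

include h hs hcW hS in
theorem IsStringFamily.form_pow_conj_congr {k : ℤ} (hk : d ≤ k) {u u' w w' : X}
    (hu : u ∈ W k) (hw' : w' ∈ W k)
    (huu : u - u' ∈ W (k - 1)) (hww : w - w' ∈ W (k - 1)) :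
    S u ((N ^ (k - d).toNat) (c w)) = S u' ((N ^ (k - d).toNat) (c w')) := by
  have h1 : S u ((N ^ (k - d).toNat) (c (w - w'))) = 0 := by
    refine hs.form_weight h hS (a := k) (b := k - 1 - 2 * ((k - d).toNat : ℕ)) (by omega) hu ?_
    exact pow_shift h.shift _ _ _ (hcW _ _ hww)
  have h2 : S (u - u') ((N ^ (k - d).toNat) (c w')) = 0 := by
    refine hs.form_weight h hS (a := k - 1) (b := k - 2 * ((k - d).toNat : ℕ)) (by omega) huu ?_
    exact pow_shift h.shift _ _ _ (hcW _ _ hw')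
  rw [map_sub, map_sub, map_sub, sub_eq_zero] at h1
  rw [map_sub, LinearMap.sub_apply, sub_eq_zero] at h2
  rw [h1, h2]

-- `grForm` is computed on representatives chosen without linearity. Orthogonality of weights makes
-- the value independent of them, so it agrees with the sesquilinear form obtained from a linear
-- section `r`.
include h hs hcW hS in
theorem IsStringFamily.exists_grForm_eq {a b : ℤ} (hab : d ≤ a + b) :
    ∃ Q : Gr W (a + b) →ₗ[ℂ] Gr W (a + b) →ₛₗ[starRingEnd ℂ] ℂ,
      (∀ x y, grForm c N d W S a b x y = Q x y) ∧
      ∀ u w : W (a + b), Q (((W (a + b - 1)).submoduleOf (W (a + b))).mkQ u)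
          (((W (a + b - 1)).submoduleOf (W (a + b))).mkQ w) =
        Complex.I ^ (a - b) * S u ((N ^ (a + b - d).toNat) (c w)) := by
  obtain ⟨r, hr⟩ := LinearMap.exists_rightInverse_of_surjective
    ((W (a + b - 1)).submoduleOf (W (a + b))).mkQ (Submodule.range_mkQ _)
  have hr' : ∀ x, ((W (a + b - 1)).submoduleOf (W (a + b))).mkQ (r x) = x := LinearMap.congr_fun hr
  have hsub : ∀ u w : W (a + b), ((W (a + b - 1)).submoduleOf (W (a + b))).mkQ u =
      ((W (a + b - 1)).submoduleOf (W (a + b))).mkQ w → (u : X) - w ∈ W (a + b - 1) :=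
    fun u w e => (mkQ_eq_zero_iff _ (u - w)).mp (by rw [map_sub, e, sub_self])
  let Q : Gr W (a + b) →ₗ[ℂ] Gr W (a + b) →ₛₗ[starRingEnd ℂ] ℂ :=
    LinearMap.mk₂'ₛₗ (RingHom.id ℂ) (starRingEnd ℂ)
      (fun x y => Complex.I ^ (a - b) * S (r x) ((N ^ (a + b - d).toNat) (c (r y))))
      (fun x x' y => by simp [mul_add]) (fun e x y => by simp; ring)
      (fun x y y' => by simp [mul_add]) (fun e x y => by simp; ring)
  have hQ : ∀ u w : W (a + b), ∀ x y, ((W (a + b - 1)).submoduleOf (W (a + b))).mkQ u = x →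
      ((W (a + b - 1)).submoduleOf (W (a + b))).mkQ w = y →
      Complex.I ^ (a - b) * S u ((N ^ (a + b - d).toNat) (c w)) = Q x y := by
    intro u w x y hx hy
    change _ = Complex.I ^ (a - b) * S (r x) ((N ^ (a + b - d).toNat) (c (r y)))
    rw [hs.form_pow_conj_congr h hcW hS hab u.2 (r y).2
      (hsub _ _ (hx.trans (hr' x).symm)) (hsub _ _ (hy.trans (hr' y).symm))]
  refine ⟨Q, fun x y => ?_, fun u w => (hQ u w _ _ rfl rfl).symm⟩
  obtain ⟨hx, hx'⟩ := mkQ_grLift (a + b) x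
  obtain ⟨hy, hy'⟩ := mkQ_grLift (a + b) y
  exact hQ _ _ x y hx' hy'

include hs in
theorem IsStringFamily.mkQ_mem_primComp (hW : IsMonodromyWeight N d W) {a b : ℤ} {σ : ι}
    (ha : A σ = a) (hl : d + l σ = a + b) (hv : v σ ∈ W (a + b)) :
    ((W (a + b - 1)).submoduleOf (W (a + b))).mkQ ⟨v σ, hv⟩ ∈ primComp c hW F a b := by
  refine ⟨?_, ?_, ?_⟩
  · change grPow _ _ _ _ _ _ = _
    rw [grPow_mkQ, mkQ_eq_zero_iff]
    have h1 : (a + b - d).toNat = l σ := by omega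
    have h2 := hs.pow σ
    dsimp only
    rw [h1]
    convert h2 using 2
    push_cast
    omega
  · refine (mkQ_mem_grInd_iff W _).mpr ?_
    exact Submodule.mem_sup_left ⟨ha ▸ hs.mem σ, hv⟩
  · refine (mkQ_mem_grInd_iff W _).mpr ?_
    have h1 := hs.mem' σ
    rwa [show (d + l σ - A σ : ℤ) = b by omega, hl] at h1

include hs in
theorem IsStringFamily.primComp_le_span (hW : IsMonodromyWeight N d W) {a b : ℤ}
    (hab : d ≤ a + b) (hv : ∀ σ : {σ // A σ = a ∧ d + l σ = a + b}, v σ.1 ∈ W (a + b)) :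
    primComp c hW F a b ≤ Submodule.span ℂ (Set.range
      fun σ => ((W (a + b - 1)).submoduleOf (W (a + b))).mkQ ⟨v σ.1, hv σ⟩) := by
  rintro x ⟨hx1, hx2, hx3⟩
  obtain ⟨u, rfl⟩ := ((W (a + b - 1)).submoduleOf (W (a + b))).mkQ_surjective x
  replace hx2 := (mkQ_mem_grInd_iff W _).mp hx2
  replace hx3 := (mkQ_mem_grInd_iff W _).mp hx3
  change grPow _ _ _ _ _ _ = _ at hx1
  rw [grPow_mkQ, mkQ_eq_zero_iff] at hx1
  obtain ⟨m, hm⟩ := Int.eq_ofNat_of_zero_le (sub_nonneg.mpr hab)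
  have hm' : (d + m : ℤ) = a + b := by omega
  have h1 := hs.span a m u (by
    rw [hm', typeComp, show a + b - a = b by ring]; exact ⟨hx2, hx3⟩) (by
    dsimp only at hx1
    rw [show (a + b - d).toNat = m by omega] at hx1
    convert hx1 using 2
    push_cast
    omega)
  obtain ⟨y, hy, w, hw, hyw⟩ := Submodule.mem_sup.mp h1
  rw [hm'] at hw
  let T := (Submodule.span ℂ (Set.range
      fun σ => ((W (a + b - 1)).submoduleOf (W (a + b))).mkQ ⟨v σ.1, hv σ⟩)).comap
      ((W (a + b - 1)).submoduleOf (W (a + b))).mkQ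
  have hyT : y ∈ T.map (W (a + b)).subtype := by
    refine Submodule.span_le.mpr ?_ hy
    rintro _ ⟨σ, ⟨h2, h3⟩, rfl⟩
    exact ⟨⟨v σ, hv ⟨σ, h2, by omega⟩⟩, Submodule.subset_span ⟨⟨σ, h2, by omega⟩, rfl⟩, rfl⟩
  obtain ⟨y', hy', rfl⟩ := hyT
  have h4 : ((W (a + b - 1)).submoduleOf (W (a + b))).mkQ u =
      ((W (a + b - 1)).submoduleOf (W (a + b))).mkQ y' := by
    refine (Submodule.Quotient.eq _).mpr ?_
    change (u : X) - y' ∈ W (a + b - 1)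
    rw [← hyw]
    simpa using hw
  rw [h4]
  exact hy'

variable (hc : ∀ x, c (c x) = x)
  (hS0 : ∀ p, ∀ u ∈ F p, ∀ w ∈ F (d - p + 1), S u w = 0)
  (ho : ∀ σ τ, σ ≠ τ → A σ = A τ → l σ = l τ → S (v σ) ((N ^ l σ) (c (v τ))) = 0)

include h hs hcW hS ho in
theorem IsStringFamily.exists_grForm_pos (hW : IsMonodromyWeight N d W) {a b : ℤ}
    (hab : d ≤ a + b) (e : ℝ) :
    ∃ L ≤ primComp c hW F a b, Module.finrank ℂ L = Nat.card {σ //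
        A σ = a ∧ d + l σ = a + b ∧ 0 < e * stringSign c N d S A l v σ} ∧
      ∀ x ∈ L, x ≠ 0 → 0 < e * (grForm c N d W S a b x x).re := by
  classical
  obtain ⟨Q, hQ, hQ'⟩ := hs.exists_grForm_eq h hcW hS hab
  let J := {σ // A σ = a ∧ d + l σ = a + b ∧ 0 < e * stringSign c N d S A l v σ}
  have hv : ∀ σ : J, v σ.1 ∈ W (a + b) := fun σ => by
    have := hs.weight σ.1
    rwa [σ.2.2.1] at this
  have hl : ∀ σ : J, (a + b - d).toNat = l σ.1 := fun σ => by have := σ.2.2.1; omega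
  let y : J → Unit → Gr W (a + b) := fun σ _ =>
    ((W (a + b - 1)).submoduleOf (W (a + b))).mkQ ⟨v σ.1, hv σ⟩
  -- With the filter `pure ()` the asymptotic statement becomes one about a fixed diagonal Gram
  -- matrix.
  have key := exists_span_pos (f := pure ()) ((e : ℂ) • Q) y
    (D := fun σ τ => ((e : ℂ) • Q) (y σ ()) (y τ ())) (fun σ τ => tendsto_const_nhds) ?_ ?_
  · rw [eventually_pure] at key
    refine ⟨_, Submodule.span_le.mpr ?_, key.1.trans Nat.card_eq_fintype_card.symm, ?_⟩
    · rintro _ ⟨σ, rfl⟩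
      exact hs.mkQ_mem_primComp hW σ.2.1 σ.2.2.1 (hv σ)
    · intro x hx hx0
      have := key.2 x hx hx0
      rw [LinearMap.smul_apply, LinearMap.smul_apply, smul_eq_mul, Complex.re_ofReal_mul,
        ← hQ] at this
      exact this
  · intro σ τ hne
    simp only [y, LinearMap.smul_apply, hQ', hl σ]
    rw [ho σ.1 τ.1 (fun e => hne (Subtype.ext e)) (σ.2.1.trans τ.2.1.symm)
      ((hl σ).symm.trans (hl τ))]
    simp
  · intro σ
    simp only [y, LinearMap.smul_apply, hQ', hl σ]
    rw [smul_eq_mul, Complex.re_ofReal_mul]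
    have h1 := σ.2.2.2
    rwa [stringSign, show 2 * A σ.1 - d - l σ.1 = a - b by
      have := σ.2.1; have := σ.2.2.1; omega] at h1

include h hs hc hcN hcW hS hS0 ho in
/-- The numbers `s_±^{a,b}` count the strings with highest vector of type `(a, b)`. -/
theorem IsStringFamily.sPlus_sMinus_eq [FiniteDimensional ℂ X] (hW : IsMonodromyWeight N d W)
    {a b : ℤ} (hab : d ≤ a + b) :
    sPlus c hW F S a b = Nat.card {σ //
        A σ = a ∧ d + l σ = a + b ∧ 0 < stringSign c N d S A l v σ} ∧
      sMinus c hW F S a b = Nat.card {σ //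
        A σ = a ∧ d + l σ = a + b ∧ stringSign c N d S A l v σ < 0} := by
  classical
  obtain ⟨L, hL, hLc, hLpos⟩ := hs.exists_grForm_pos h hcW hS ho hW hab 1
  obtain ⟨L', hL', hLc', hLpos'⟩ := hs.exists_grForm_pos h hcW hS ho hW hab (-1)
  have hdim : Module.finrank ℂ (primComp c hW F a b) ≤
      Module.finrank ℂ L + Module.finrank ℂ L' := by
    refine (Submodule.finrank_mono (hs.primComp_le_span hW hab
      fun σ => by have := hs.weight σ.1; rwa [σ.2.2] at this)).trans ((finrank_range_le_card _).trans ?_)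
    rw [hLc, hLc', Nat.card_eq_fintype_card, Nat.card_eq_fintype_card,
      ← Fintype.card_subtype_or_disjoint]
    · refine Fintype.card_subtype_mono _ _ fun σ hσ => ?_
      rcases lt_or_gt_of_ne (hs.stringSign_ne_zero h hc hcN hcW hS hS0 ho σ) with h1 | h1
      · exact Or.inr ⟨hσ.1, hσ.2, by linarith⟩
      · exact Or.inl ⟨hσ.1, hσ.2, by linarith⟩
    · rw [Pi.disjoint_iff]
      intro x
      rw [Prop.disjoint_iff]
      rintro ⟨⟨-, -, h1⟩, ⟨-, -, h2⟩⟩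
      linarith
  simp only [one_mul] at hLc hLpos
  simp only [neg_one_mul, Left.neg_pos_iff] at hLc' hLpos'
  exact ⟨(posIndex_eq hL hL' hLpos hLpos' hdim).trans hLc,
    (negIndex_eq hL hL' hLpos hLpos' hdim).trans hLc'⟩

end PrimitiveSignature

end DegenerationHodge

/-! ### Counting strings by the sums of `s_±`. -/

namespace DegenerationHodge

section Counting

/-- Each `σ` is counted for at most one `r`, so summing over `r` amounts to an existential
quantifier. -/
theorem finsum_natCard {α ι : Type*} [Fintype ι] (f : α → ι → Prop)
    (hf : ∀ σ r r', f r σ → f r' σ → r = r') :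
    ∑ᶠ r, Nat.card {σ // f r σ} = Nat.card {σ // ∃ r, f r σ} := by
  classical
  have hcard : ∀ P : ι → Prop, Nat.card {σ // P σ} = ∑ σ, if P σ then 1 else 0 := fun P => by
    rw [Nat.card_eq_fintype_card, Fintype.card_subtype, Finset.card_filter]
  simp only [hcard]
  have hsupp : ∀ σ, (Function.support fun r => if f r σ then (1 : ℕ) else 0).Subsingleton := by
    intro σ r hr r' hr'
    refine hf σ r r' ?_ ?_
    · by_contra h0
      simp [h0] at hr
    · by_contra h0
      simp [h0] at hr'
  rw [finsum_sum_comm _ _ fun σ _ => (hsupp σ).finite]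
  refine Finset.sum_congr rfl fun σ _ => ?_
  split_ifs with h
  · obtain ⟨r, hr⟩ := h
    rw [finsum_eq_single _ r fun r' hne => if_neg fun h' => hne (hf σ _ _ h' hr), if_pos hr]
  · rw [finsum_eq_zero_of_forall_eq_zero]
    exact fun r => if_neg fun hr => h ⟨r, hr⟩

variable {ι : Type*} {A : ι → ℤ} {l : ι → ℕ} {P : ι → Prop} {s : ℤ → ℤ → ℕ} {d : ℕ}

theorem natCard_string_eq (p : ℤ) :
    Nat.card {x : Σ σ, Fin (l σ + 1) // A x.1 - (x.2 : ℕ) = p ∧ P x.1} =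
      Nat.card {σ // P σ ∧ p ≤ A σ ∧ A σ - p ≤ l σ} :=
  Nat.card_congr
    { toFun x := ⟨x.1.1, x.2.2, by have := x.2.1; omega, by
        have := x.2.1; have := x.1.2.2; omega⟩
      invFun σ := ⟨⟨σ.1, ⟨(A σ.1 - p).toNat, by have := σ.2; omega⟩⟩, by
        have := σ.2; dsimp only; omega, σ.2.1⟩
      left_inv := by
        rintro ⟨⟨σ, j⟩, h1, h2⟩
        apply Subtype.ext
        refine congrArg (Sigma.mk σ) (Fin.ext ?_)
        dsimp only at h1 ⊢
        omega
      right_inv _ := rfl }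

variable [Fintype ι]
  (hs : ∀ a b : ℤ, d ≤ a + b → s a b = Nat.card {σ // A σ = a ∧ d + l σ = a + b ∧ P σ})

-- A string contributes through its highest vector of type `(p + r, k + r)`, so `r = A σ - p`. The
-- bound `r ≥ max(-(p + k - d), 0)` says precisely that the vector of type `(p, k)` lies within the
-- string.
include hs in
theorem bigS_eq_natCard (p k : ℤ) :
    bigS s d p k = Nat.card {σ // P σ ∧ p ≤ A σ ∧ A σ - p ≤ l σ ∧ k = d + l σ - 2 * A σ + p} := by
  have h1 : ∀ r : ℕ, (∑ᶠ (_ : max (-(p + k - d)) 0 ≤ (r : ℤ)), s (p + r) (k + r)) =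
      Nat.card {σ // (A σ = p + r ∧ A σ - p ≤ l σ ∧ k = d + l σ - 2 * A σ + p) ∧ P σ} := by
    intro r
    classical
    rw [finsum_eq_if]
    split_ifs with hr
    · rw [hs _ _ (by omega)]
      exact Nat.card_congr (Equiv.subtypeEquivRight fun σ => by
        rw [← and_assoc]
        refine and_congr_left fun _ => ?_
        omega)
    · refine (Nat.card_eq_zero.mpr (Or.inl ⟨?_⟩)).symm
      rintro ⟨σ, h2, -⟩
      omega
  rw [bigS]
  simp only [h1]
  rw [finsum_natCard _ fun σ r r' h h' => by omega]
  refine Nat.card_congr (Equiv.subtypeEquivRight fun σ => ⟨?_, ?_⟩)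
  · rintro ⟨r, h2, h3⟩
    exact ⟨h3, by omega⟩
  · rintro ⟨h3, h2⟩
    exact ⟨(A σ - p).toNat, by omega, h3⟩

include hs in
theorem finsum_bigS (p : ℤ) :
    ∑ᶠ k, bigS s d p k =
      Nat.card {x : Σ σ, Fin (l σ + 1) // A x.1 - (x.2 : ℕ) = p ∧ P x.1} := by
  rw [natCard_string_eq]
  simp only [bigS_eq_natCard hs]
  rw [finsum_natCard _ fun σ r r' h h' => by omega]
  exact Nat.card_congr (Equiv.subtypeEquivRight fun σ =>
    ⟨fun ⟨k, h1, h2⟩ => ⟨h1, by omega⟩, fun ⟨h1, h2⟩ => ⟨_, h1, by omega, by omega, rfl⟩⟩)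

-- If all types of string vectors lie in the square `[0, d]²`, then `k` outside `[0, d]` receives no
-- strings.
include hs in
theorem sum_Icc_bigS (hr : ∀ σ, A σ ≤ d ∧ l σ ≤ A σ) (p : ℤ) :
    ∑ k ∈ Finset.Icc (0 : ℤ) d, bigS s d p k = ∑ᶠ k, bigS s d p k := by
  refine (finsum_eq_sum_of_support_subset _ fun k hk => ?_).symm
  by_contra h0
  refine hk ?_
  rw [bigS_eq_natCard hs]
  refine Nat.card_eq_zero.mpr (Or.inl ⟨?_⟩)
  rintro ⟨σ, -, h1⟩
  have := hr σ
  simp only [Finset.coe_Icc, Set.mem_Icc] at h0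
  omega

-- With `l = p + k - d`, the constraint `l ≥ p - d` is `k ≥ 0`. The bounds `hr` make it automatic
-- for every string that counts.
include hs in
theorem doubleSum_eq (hr : ∀ σ, A σ ≤ d ∧ l σ ≤ A σ) (p : ℤ) :
    doubleSum s d p =
      Nat.card {x : Σ σ, Fin (l σ + 1) // A x.1 - (x.2 : ℕ) = p ∧ P x.1} := by
  have h1 : ∀ x : ℤ × ℕ, (∑ᶠ (_ : p - d ≤ x.1 ∧ max (-x.1) 0 ≤ (x.2 : ℤ)),
      s (p + x.2) (d + x.1 - p + x.2)) =
      Nat.card {σ // (p - d ≤ x.1 ∧ A σ = p + x.2 ∧ A σ - p ≤ l σ ∧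
        x.1 = l σ - 2 * A σ + 2 * p) ∧ P σ} := by
    intro x
    classical
    rw [finsum_eq_if]
    split_ifs with hx
    · rw [hs _ _ (by omega)]
      exact Nat.card_congr (Equiv.subtypeEquivRight fun σ => by
        rw [← and_assoc]
        refine and_congr_left fun _ => ?_
        omega)
    · refine (Nat.card_eq_zero.mpr (Or.inl ⟨?_⟩)).symm
      rintro ⟨σ, h2, -⟩
      omega
  rw [doubleSum, natCard_string_eq]
  simp only [h1]
  rw [finsum_natCard _ fun σ r r' h h' => by ext <;> omega]
  refine Nat.card_congr (Equiv.subtypeEquivRight fun σ => ⟨?_, ?_⟩)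
  · rintro ⟨r, h2, h3⟩
    exact ⟨h3, by omega⟩
  · rintro ⟨h3, h2⟩
    have := hr σ
    exact ⟨(l σ - 2 * A σ + 2 * p, (A σ - p).toNat), by dsimp only; omega, h3⟩

end Counting

section Definite

variable {X : Type*} [AddCommGroup X] [Module ℂ X] {h : X → X → ℂ} {K : Submodule ℂ X}

theorem pos_of_posIndex_eq [FiniteDimensional ℂ K] (hK : posIndex h K = Module.finrank ℂ K) :
    ∀ x ∈ K, x ≠ 0 → 0 < (h x x).re := by
  have h1 : posIndex h K ∈
      {n | ∃ L ≤ K, Module.finrank ℂ L = n ∧ ∀ x ∈ L, x ≠ 0 → 0 < (h x x).re} := by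
    refine Nat.sSup_mem ⟨0, ⊥, bot_le, finrank_bot ℂ X, fun x hx h0 => absurd hx h0⟩
      ⟨Module.finrank ℂ K, ?_⟩
    rintro n ⟨L, hL, rfl, -⟩
    exact Submodule.finrank_mono hL
  obtain ⟨L, hL, hLK, hpos⟩ := h1
  rwa [Submodule.eq_of_le_of_finrank_eq hL (hLK.trans hK)] at hpos

theorem negIndex_eq_zero_of_pos (hK : ∀ x ∈ K, x ≠ 0 → 0 < (h x x).re) : negIndex h K = 0 := by
  refine Nat.le_zero.mp (csSup_le ⟨0, ⊥, bot_le, finrank_bot ℂ X, fun x hx h0 => absurd hx h0⟩ ?_)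
  rintro n ⟨L, hL, rfl, hneg⟩
  have : L = ⊥ := (Submodule.eq_bot_iff L).mpr fun x hx => by
    by_contra h0
    have h1 := hneg x hx h0
    have h2 := hK x (hL hx) h0
    rw [Complex.neg_re] at h1
    linarith
  rw [this, finrank_bot]

end Definite

section StringRange

variable {X : Type*} [AddCommGroup X] [Module ℂ X]
  {N : Module.End ℂ X} {d : ℤ} {W F F' : ℤ → Submodule ℂ X}
  {ι : Type*} [Fintype ι] {A : ι → ℤ} {l : ι → ℕ} {v : ι → X}

/-- If `F p` is everything, the adapted basis lies in it entirely, in particular the last vector of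
each string. -/
theorem IsStringFamily.le_type_of_eq_top (h : IsOpposedTriple N d W F F')
    (hs : IsStringFamily N d W F F' A l v) {p : ℤ} (hp : F p = ⊤) (σ : ι) : p ≤ A σ - l σ := by
  classical
  have h1 := hs.finrank_eq h p
  rw [hp, finrank_top, Module.finrank_eq_card_basis (hs.basis h), ← Nat.card_eq_fintype_card] at h1
  have h2 := (Subtype.val_injective (p := fun x : Σ σ, Fin (l σ + 1) =>
    p ≤ A x.1 - (x.2 : ℕ))).bijective_of_nat_card_le h1.le
  obtain ⟨⟨x, hx⟩, rfl : x = _⟩ := h2.2 ⟨σ, Fin.last _⟩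
  simpa using hx

theorem IsStringFamily.type_lt_of_eq_bot (hs : IsStringFamily N d W F F' A l v)
    (h : IsOpposedTriple N d W F F') {p : ℤ} (hp : F p = ⊥) (σ : ι) : A σ < p := by
  by_contra h0
  have h1 := hs.finrank_eq h p
  rw [hp, finrank_bot] at h1
  rcases Nat.card_eq_zero.mp h1.symm with h2 | h2
  · exact h2.elim ⟨⟨σ, 0⟩, by simpa using h0⟩
  · exact h2.not_finite (Subtype.finite)

end StringRange

end DegenerationHodge

/-! ### From the cusp back to the bundle. -/

namespace DegenerationHodge

section OrthogonalStrings

variable {X : Type*} [AddCommGroup X] [Module ℂ X] [FiniteDimensional ℂ X]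
  {N : Module.End ℂ X} {d : ℕ} {W F : ℤ → Submodule ℂ X}
  {c : X →ₛₗ[starRingEnd ℂ] X} {S : LinearMap.BilinForm ℂ X}

theorem IsLimitMHS.exists_isStringFamily (hA : IsLimitMHS c N d W F) :
    ∃ (ι : Type) (_ : Fintype ι) (A : ι → ℤ) (l : ι → ℕ) (v : ι → X),
      IsStringFamily N d W F (fun p => conjSub c (F p)) A l v := by
  obtain ⟨p, hp⟩ := hA.mixed.hodge_bot
  obtain ⟨ι, hι, A, l, v, hs, -⟩ := hA.isOpposedTriple.exists_isStringFamily
    ⟨p, by rw [hp, conjSub_bot]⟩ (fun _ _ => 0) (by simp)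
  exact ⟨ι, hι, A, l, v, hs⟩

/-- The factor `i^(2a-d-m)` makes `S(u, N^m conj w)` Hermitian, by the symmetry of `S` and the
reality of `N`. Strings with the same type and length can then be chosen orthogonal. -/
theorem IsLimitMHS.exists_orthogonal_isStringFamily (hA : IsLimitMHS c N d W F)
    (hc : ∀ x, c (c x) = x) (hS : IsCompatibleForm c N d S) :
    ∃ (ι : Type) (_ : Fintype ι) (A : ι → ℤ) (l : ι → ℕ) (v : ι → X),
      IsStringFamily N d W F (fun p => conjSub c (F p)) A l v ∧
      ∀ σ τ, σ ≠ τ → A σ = A τ → l σ = l τ → S (v σ) ((N ^ l σ) (c (v τ))) = 0 := by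
  obtain ⟨p, hp⟩ := hA.mixed.hodge_bot
  obtain ⟨ι, hι, A, l, v, hs, ho⟩ := hA.isOpposedTriple.exists_isStringFamily
    ⟨p, by rw [hp, conjSub_bot]⟩
    (fun a m => Complex.I ^ (2 * a - d - m) • LinearMap.compl₂ S ((N ^ m).comp c))
    (fun a m u w => by
      have h5 : starRingEnd ℂ Complex.I = Complex.I ^ (-1 : ℤ) := by simp
      have h6 : ((-1 : ℂ)) ^ (d + m) = Complex.I ^ (2 * ((d + m : ℕ) : ℤ)) := by
        rw [I_zpow_two_mul, zpow_natCast]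
      simp only [LinearMap.smul_apply, LinearMap.compl₂_apply, LinearMap.comp_apply, smul_eq_mul]
      rw [hS.form_pow_conj_comm hA.real hc, map_mul, map_zpow₀, h5, h6, ← mul_assoc, ← zpow_mul,
        ← zpow_add₀ Complex.I_ne_zero]
      congr 1
      have h7 : (2 * a - d - m) + 2 * ((d + m : ℕ) : ℤ) = -1 * (2 * a - d - m) + 2 * (2 * a) := by
        push_cast; ring
      rw [h7, zpow_add₀ Complex.I_ne_zero, I_zpow_two_mul, (even_two_mul a).neg_one_zpow, mul_one])
  refine ⟨ι, hι, A, l, v, hs, fun σ τ h1 h2 h3 => ?_⟩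
  have := ho σ τ h1 h2 h3
  simp only [LinearMap.smul_apply, LinearMap.compl₂_apply, LinearMap.comp_apply, smul_eq_mul,
    mul_eq_zero, zpow_ne_zero _ Complex.I_ne_zero, false_or] at this
  exact this

end OrthogonalStrings

section Nearby

open UpperHalfPlane (atImInfty)

variable {V : Type*} [NormedAddCommGroup V] [NormedSpace ℂ V] [FiniteDimensional ℂ V]
    {E : puncturedDisc → Type*}
    [∀ q, AddCommGroup (E q)] [∀ q, Module ℂ (E q)] [∀ q, TopologicalSpace (E q)]
    [∀ q, IsTopologicalAddGroup (E q)] [∀ q, ContinuousSMul ℂ (E q)]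
    [TopologicalSpace (TotalSpace V E)] [FiberBundle V E] [VectorBundle ℂ V E]
    [ContMDiffVectorBundle ω V E 𝓘(ℂ, ℂ)]
    {D : RealFlatConnection V E} {d : ℕ} {F : ℤ → ∀ q, Submodule ℂ (E q)}
    {F' : ℤ → ℂ → Submodule ℂ (horizontalSections D)}
    {W : ℤ → Submodule ℂ (horizontalSections D)}
    {S : LinearMap.BilinForm ℂ (horizontalSections D)}
    {ι : Type*} [Fintype ι] {A : ι → ℤ} {l : ι → ℕ} {v : ι → horizontalSections D}

theorem sqrt_im_ne_zero (z : UpperHalfPlane) : √z.im ≠ 0 := (Real.sqrt_pos.mpr z.im_pos).ne'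

theorem fiberForm_nondegenerate (hT : IsNilpotent (monodromy D - 1))
    (hS : IsCompatibleForm (conjH D) (logMonodromy D) d S) (z : UpperHalfPlane) :
    (fiberForm D S (unif z)).Nondegenerate := by
  have h1 := hS.nondegenerate
  refine ⟨fun x hx => ?_, fun x hx => ?_⟩
  · obtain ⟨s, rfl⟩ := (fiberEquiv hT z).surjective x
    rw [h1.1 s fun t => by rw [← fiberForm_fiberEquiv hT hS z]; exact hx _, map_zero]
  · obtain ⟨s, rfl⟩ := (fiberEquiv hT z).surjective x
    rw [h1.2 s fun t => by rw [← fiberForm_fiberEquiv hT hS z]; exact hx _, map_zero]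

theorem IsCanonicalExtension.eq_top (hF' : IsCanonicalExtension D F F') {p : ℤ}
    (hp : ∀ q, F p q = ⊤) : F' p 0 = ⊤ := by
  have := finiteDimensional_horizontalSections D
  obtain ⟨z, hz⟩ := (hF'.subbundle p).rapidConv.2.exists
  refine Submodule.eq_top_of_finrank_eq ?_
  rw [← hz, hF'.restrict p (unif z) ⟨z, rfl⟩, hp, Submodule.comap_top, finrank_top]

theorem IsCanonicalExtension.eq_bot (hT : IsNilpotent (monodromy D - 1))
    (hF' : IsCanonicalExtension D F F') {p : ℤ} (hp : ∀ q, F p q = ⊥) : F' p 0 = ⊥ := by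
  have := finiteDimensional_horizontalSections D
  obtain ⟨z, hz⟩ := (hF'.subbundle p).rapidConv.2.exists
  rw [← Submodule.finrank_eq_zero (R := ℂ), ← hz, hF'.restrict p (unif z) ⟨z, rfl⟩, hp,
    Submodule.finrank_eq_zero, eq_bot_iff]
  intro s hs
  rw [Submodule.mem_comap, Submodule.mem_bot, canonicalFrame_eq hT,
    LinearEquiv.map_eq_zero_iff] at hs
  exact (nilExp_bijective ((isNilpotent_logMonodromy hT).smul_end _)).1 (hs.trans (map_zero _).symm)

theorem IsLimitMHS.eventually_isPureHodge_nearby (hT : IsNilpotent (monodromy D - 1))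
    (hFanti : ∀ q, Antitone fun p => F p q) (hF' : IsCanonicalExtension D F F')
    (hA : IsLimitMHS (conjH D) (logMonodromy D) d W (fun p => F' p 0))
    (hs : IsStringFamily (logMonodromy D) d W (fun p => F' p 0)
      (fun p => conjSub (conjH D) (F' p 0)) A l v) :
    ∀ᶠ z in atImInfty, IsPureHodge (D.conj (unif z)) (fun p => F p (unif z)) d ∧
      ∀ p, Module.finrank ℂ (hodgeComp (D.conj (unif z)) (fun p => F p (unif z)) d p) =
        Nat.card {x : Σ σ, Fin (l σ + 1) // A x.1 - (x.2 : ℕ) = p} := by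
  filter_upwards [hs.eventually_isPureHodge hA.isOpposedTriple (conjH_conjH D) hA.real
    (isNilpotent_logMonodromy hT) tendsto_sqrt_im sqrt_im_ne_zero (hF'.isRapidFamily hFanti)]
    with z hz
  rw [funext (hF'.eq_map hT z)]
  refine ⟨hz.1.map_equiv _ (conj_fiberEquiv hT hA.real z), fun p => ?_⟩
  rw [hodgeComp_map_equiv _ (conj_fiberEquiv hT hA.real z), LinearEquiv.finrank_map_eq]
  exact hz.2 p

theorem IsLimitMHS.eventually_index_nearby (hT : IsNilpotent (monodromy D - 1))
    (hFanti : ∀ q, Antitone fun p => F p q) (hF' : IsCanonicalExtension D F F')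
    (hA : IsLimitMHS (conjH D) (logMonodromy D) d W (fun p => F' p 0))
    (hs : IsStringFamily (logMonodromy D) d W (fun p => F' p 0)
      (fun p => conjSub (conjH D) (F' p 0)) A l v)
    (ho : ∀ σ τ, σ ≠ τ → A σ = A τ → l σ = l τ →
      S (v σ) ((logMonodromy D ^ l σ) (conjH D (v τ))) = 0)
    (hS : IsCompatibleForm (conjH D) (logMonodromy D) d S)
    (hS0 : ∀ p, ∀ u ∈ F' p 0, ∀ w ∈ F' (d - p + 1) 0, S u w = 0)
    (hcW : ∀ k, ∀ x ∈ W k, conjH D x ∈ W k) :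
    ∀ᶠ z in atImInfty, ∀ p, posIndex (weilForm (D.conj (unif z)) (fiberForm D S (unif z)) p (d - p))
        (hodgeComp (D.conj (unif z)) (fun p => F p (unif z)) d p) =
          Nat.card {x : Σ σ, Fin (l σ + 1) // A x.1 - (x.2 : ℕ) = p ∧
            0 < stringSign (conjH D) (logMonodromy D) d S A l v x.1} ∧
      negIndex (weilForm (D.conj (unif z)) (fiberForm D S (unif z)) p (d - p))
        (hodgeComp (D.conj (unif z)) (fun p => F p (unif z)) d p) =
          Nat.card {x : Σ σ, Fin (l σ + 1) // A x.1 - (x.2 : ℕ) = p ∧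
            stringSign (conjH D) (logMonodromy D) d S A l v x.1 < 0} := by
  filter_upwards [hs.eventually_index hA.isOpposedTriple (conjH_conjH D) hA.real hcW hS hS0 ho
    tendsto_sqrt_im sqrt_im_ne_zero (isNilpotent_logMonodromy hT) (hF'.isRapidFamily hFanti)]
    with z hz p
  simp only [hF'.eq_map hT z]
  have h1 := posIndex_weilForm_map_equiv (fiberEquiv hT z) (conj_fiberEquiv hT hA.real z)
    (fiberForm_fiberEquiv hT hS z) (twist (logMonodromy D) (fun z : UpperHalfPlane => √z.im)
      (fun p z => F' p (unif z)) z) d p p (d - p)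
  exact ⟨h1.1.trans (hz p).1, h1.2.trans (hz p).2⟩

theorem IsLimitMHS.eventually_isPolarizedHodge (hT : IsNilpotent (monodromy D - 1))
    (hFanti : ∀ q, Antitone fun p => F p q) (hF' : IsCanonicalExtension D F F')
    (hA : IsLimitMHS (conjH D) (logMonodromy D) d W (fun p => F' p 0))
    (hs : IsStringFamily (logMonodromy D) d W (fun p => F' p 0)
      (fun p => conjSub (conjH D) (F' p 0)) A l v)
    (ho : ∀ σ τ, σ ≠ τ → A σ = A τ → l σ = l τ →
      S (v σ) ((logMonodromy D ^ l σ) (conjH D (v τ))) = 0)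
    (hS : IsCompatibleForm (conjH D) (logMonodromy D) d S)
    (hSF : ∀ (q : puncturedDisc) (p : ℤ), ∀ u ∈ F p q, ∀ v ∈ F (d - p + 1) q,
        fiberForm D S q u v = 0)
    (hcW : ∀ k, ∀ x ∈ W k, conjH D x ∈ W k)
    (hpos : ∀ σ, 0 < stringSign (conjH D) (logMonodromy D) d S A l v σ) :
    ∀ᶠ z in atImInfty, IsPolarizedHodge (D.conj (unif z)) (fun p => F p (unif z)) d
      (fiberForm D S (unif z)) := by
  filter_upwards [hA.eventually_isPureHodge_nearby hT hFanti hF' hs,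
    hA.eventually_index_nearby hT hFanti hF' hs ho hS (hF'.form_eq_zero hT hS hSF) hcW] with z h1 h2
  have hfd := finiteDimensional_horizontalSections D
  have := Module.Finite.equiv (fiberEquiv hT z)
  refine ⟨h1.1, fiberForm_nondegenerate hT hS z, fun x y => ?_, fun x y => ?_,
    hSF (unif z), fun p => pos_of_posIndex_eq ?_⟩
  · obtain ⟨s, rfl⟩ := (fiberEquiv hT z).surjective x
    obtain ⟨t, rfl⟩ := (fiberEquiv hT z).surjective y
    rw [conj_fiberEquiv hT hA.real, conj_fiberEquiv hT hA.real, fiberForm_fiberEquiv hT hS,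
      fiberForm_fiberEquiv hT hS, hS.real]
  · obtain ⟨s, rfl⟩ := (fiberEquiv hT z).surjective x
    obtain ⟨t, rfl⟩ := (fiberEquiv hT z).surjective y
    rw [fiberForm_fiberEquiv hT hS, fiberForm_fiberEquiv hT hS, hS.symm]
  · rw [(h2 p).1, h1.2 p]
    simp only [hpos, and_true]

end Nearby

end DegenerationHodge

/-! ### The theorem. -/

open DegenerationHodge in
theorem theorem2p2
    (V : Type*) [NormedAddCommGroup V] [NormedSpace ℂ V] [FiniteDimensional ℂ V]
    (E : puncturedDisc → Type*)
    [∀ q, AddCommGroup (E q)] [∀ q, Module ℂ (E q)] [∀ q, TopologicalSpace (E q)]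
    [∀ q, IsTopologicalAddGroup (E q)] [∀ q, ContinuousSMul ℂ (E q)]
    [TopologicalSpace (TotalSpace V E)] [FiberBundle V E] [VectorBundle ℂ V E]
    [ContMDiffVectorBundle ω V E 𝓘(ℂ, ℂ)]
    (D : RealFlatConnection V E)
    (hT : IsNilpotent (monodromy D - 1))
    (d : ℕ)
    (F : ℤ → ∀ q, Submodule ℂ (E q))
    (hF : ∀ p, IsHolSubbundle V (F p))
    (hFanti : ∀ q, Antitone fun p => F p q)
    (F' : ℤ → ℂ → Submodule ℂ (horizontalSections D))
    (hF' : IsCanonicalExtension D F F')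
    (W : ℤ → Submodule ℂ (horizontalSections D))
    (hA : IsLimitMHS (conjH D) (logMonodromy D) d W (fun p => F' p 0)) :
    (∃ ε > 0, ∀ q : puncturedDisc, ‖(q : ℂ)‖ < ε →
      IsPureHodge (D.conj q) (fun p => F p q) d) ∧
    ∀ S : LinearMap.BilinForm ℂ (horizontalSections D),
      IsCompatibleForm (conjH D) (logMonodromy D) d S →
      (∀ (q : puncturedDisc) (p : ℤ), ∀ u ∈ F p q, ∀ v ∈ F (d - p + 1) q,
        fiberForm D S q u v = 0) →
      (∃ ε > 0, ∀ q : puncturedDisc, ‖(q : ℂ)‖ < ε → ∀ p : ℤ,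
        posIndex (weilForm (D.conj q) (fiberForm D S q) p (d - p))
            (hodgeComp (D.conj q) (fun p => F p q) d p) =
          ∑ᶠ k : ℤ, bigS (sPlus (conjH D) hA.weight (fun p => F' p 0) S) d p k ∧
        negIndex (weilForm (D.conj q) (fiberForm D S q) p (d - p))
            (hodgeComp (D.conj q) (fun p => F p q) d p) =
          ∑ᶠ k : ℤ, bigS (sMinus (conjH D) hA.weight (fun p => F' p 0) S) d p k) ∧
      ((∀ q, F 0 q = ⊤ ∧ F (d + 1) q = ⊥) →
        ∃ ε > 0, ∀ q : puncturedDisc, ‖(q : ℂ)‖ < ε → ∀ p : ℤ,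
          posIndex (weilForm (D.conj q) (fiberForm D S q) p (d - p))
              (hodgeComp (D.conj q) (fun p => F p q) d p) =
            ∑ k ∈ Finset.Icc (0 : ℤ) d,
              bigS (sPlus (conjH D) hA.weight (fun p => F' p 0) S) d p k ∧
          ∑ k ∈ Finset.Icc (0 : ℤ) d,
              bigS (sPlus (conjH D) hA.weight (fun p => F' p 0) S) d p k =
            doubleSum (sPlus (conjH D) hA.weight (fun p => F' p 0) S) d p ∧
          negIndex (weilForm (D.conj q) (fiberForm D S q) p (d - p))
              (hodgeComp (D.conj q) (fun p => F p q) d p) =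
            ∑ k ∈ Finset.Icc (0 : ℤ) d,
              bigS (sMinus (conjH D) hA.weight (fun p => F' p 0) S) d p k ∧
          ∑ k ∈ Finset.Icc (0 : ℤ) d,
              bigS (sMinus (conjH D) hA.weight (fun p => F' p 0) S) d p k =
            doubleSum (sMinus (conjH D) hA.weight (fun p => F' p 0) S) d p) ∧
      (IsPolarizedMHS (conjH D) hA.weight (fun p => F' p 0) S →
        ∃ ε > 0, ∀ q : puncturedDisc, ‖(q : ℂ)‖ < ε →
          IsPolarizedHodge (D.conj q) (fun p => F p q) d (fiberForm D S q)) ∧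
      ((∀ p q : ℤ, d ≤ p + q → sMinus (conjH D) hA.weight (fun p => F' p 0) S p q = 0) →
        ∃ ε > 0, ∀ q : puncturedDisc, ‖(q : ℂ)‖ < ε →
          IsPolarizedHodge (D.conj q) (fun p => F p q) d (fiberForm D S q)) := by
  have hfd := finiteDimensional_horizontalSections D
  have hc := conjH_conjH D
  refine ⟨?_, fun S hS hSF => ?_⟩
  · obtain ⟨ι, _, A, l, v, hs⟩ := hA.exists_isStringFamily
    exact exists_norm_lt_of_eventually
      ((hA.eventually_isPureHodge_nearby hT hFanti hF' hs).mono fun z hz => hz.1)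
  obtain ⟨ι, _, A, l, v, hs, ho⟩ := hA.exists_orthogonal_isStringFamily hc hS
  have hcW : ∀ k, ∀ x ∈ W k, conjH D x ∈ W k := fun k x hx =>
    hA.mixed.weight_real k ▸ Submodule.mem_map_of_mem hx
  have hS0 := hF'.form_eq_zero hT hS hSF
  have ht := hA.isOpposedTriple
  have hindex := hA.eventually_index_nearby hT hFanti hF' hs ho hS hS0 hcW
  have hplus := fun a b (hab : (d : ℤ) ≤ a + b) =>
    (hs.sPlus_sMinus_eq ht hA.real hcW hS hc hS0 ho hA.weight hab).1
  have hminus := fun a b (hab : (d : ℤ) ≤ a + b) =>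
    (hs.sPlus_sMinus_eq ht hA.real hcW hS hc hS0 ho hA.weight hab).2
  have hpolarized : (∀ p q : ℤ, d ≤ p + q →
      sMinus (conjH D) hA.weight (fun p => F' p 0) S p q = 0) →
      ∃ ε > 0, ∀ q : puncturedDisc, ‖(q : ℂ)‖ < ε →
        IsPolarizedHodge (D.conj q) (fun p => F p q) d (fiberForm D S q) := by
    intro h0
    refine exists_norm_lt_of_eventually
      (hA.eventually_isPolarizedHodge hT hFanti hF' hs ho hS hSF hcW fun σ => ?_)
    -- A string of negative sign would be counted by `s_-` at the type of its highest vector, and no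
    -- sign is zero.
    refine lt_of_le_of_ne (not_lt.mp fun hlt => ?_)
      (hs.stringSign_ne_zero ht hc hA.real hcW hS hS0 ho σ).symm
    have hab : (d : ℤ) ≤ A σ + (d + l σ - A σ) := by omega
    have h1 := (hminus _ _ hab).symm.trans (h0 _ _ hab)
    rcases Nat.card_eq_zero.mp h1 with h2 | h2
    · exact h2.elim ⟨σ, rfl, by omega, hlt⟩
    · exact h2.not_finite Subtype.finite
  refine ⟨?_, fun hFd => ?_, fun hpol => hpolarized fun a b hab =>
    negIndex_eq_zero_of_pos (hpol.prim_pos a b hab), hpolarized⟩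
  · refine exists_norm_lt_of_eventually (hindex.mono fun z hz p => ?_)
    exact ⟨(hz p).1.trans (finsum_bigS hplus p).symm, (hz p).2.trans (finsum_bigS hminus p).symm⟩
  · have hr : ∀ σ, A σ ≤ d ∧ l σ ≤ A σ := fun σ => by
      have h1 := hs.le_type_of_eq_top ht (hF'.eq_top fun q => (hFd q).1) σ
      have h2 := hs.type_lt_of_eq_bot ht (hF'.eq_bot hT fun q => (hFd q).2) σ
      omega
    refine exists_norm_lt_of_eventually (hindex.mono fun z hz p => ?_)
    rw [sum_Icc_bigS hplus hr, sum_Icc_bigS hminus hr, finsum_bigS hplus, finsum_bigS hminus,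
      doubleSum_eq hplus hr, doubleSum_eq hminus hr]
    exact ⟨(hz p).1, rfl, (hz p).2, rfl⟩
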